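/- Let $0<q<1$, let $k,l\ge 1$ be coprime integers and let $d\ge 1$ be an integer. **The algebras.** Let $\mathcal O(S_q^3)$ be the universal unital $*$-algebra with generators $z_0,z_1$ and relations $z_0z_1=q\,z_1z_0$, $z_iz_j^*=q\,z_j^*z_i$ ($i\ne j$), $z_0z_0^*=z_0^*z_0+(q^{-2}-1)z_1z_1^*$, $z_1z_1^*=z_1^*z_1$, $z_0z_0^*+z_1z_1^*=1$, and let $C(S_q^3)$ be its universal enveloping $C^*$-algebra. Let $\mathcal O(W_q(k,l))\subseteq\mathcal O(S_q^3)$ be the fixed point algebra of the circle action $\sigma_w(z_0)=w^kz_0$, $\sigma_w(z_1)=w^lz_1$, let $B$ be the closure of (the image of) $\mathcal O(W_q(k,l))$ in $C(S_q^3)$, and let $E$ be the closure in $C(S_q^3)$ of $\mathcal A_{(1)}(k,l)=(z_1^*)^k\mathcal O(W_q(k,l))+(z_0^*)^l\mathcal O(W_q(k,l))$. Then $E$ is a right Hilbert $B$-module under right multiplication and $\langle\xi,\eta\rangle=\xi^*\eta$, and left multiplication gives a $*$-homomorphism $\phi:B\to\mathcal L(E)$ into the adjointable operators. Let $C(S_q^3)^{1/d}$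 be the $C^*$-quantum lens space: the fixed point algebra of the action of $\mathbb Z/dlk\mathbb Z$ on $C(S_q^3)$ whose generator acts by $z_0\mapsto e^{2\pi i/(dl)}z_0$, $z_1\mapsto e^{2\pi i/(dk)}z_1$. **Pimsner algebras.** Let $F$ be a right Hilbert module over a unital $C^*$-algebra $B$ with a $*$-homomorphism $\phi:B\to\mathcal L(F)$, and suppose $(*)$ $B$ is separable, $F$ is countably generated and full, and $\phi$ is an isomorphism of $B$ onto the compact operators $\mathcal K(F)$, the closed span of the operators $\theta_{\xi,\eta}(\zeta)=\xi\langle\eta,\zeta\rangle$. Let $F^*=\{\lambda_\xi=\langle\xi,\cdot\rangle:\xi\in F\}$, with $\lambda_\xi b=\lambda_{\phi(b^*)\xi}$, $\langle\lambda_\xi,\lambda_\eta\rangle=\phi^{-1}(\theta_{\xi,\eta})$ and left action $\phi^*(b)\lambda_\xi=\lambda_{\xi b^*}$. Put $F^{(0)}=B$, $F^{(n)}=F^{\widehat\otimes_\phi n}$ and $F^{(-n)}=(F^*)^{\widehat\otimes_{\phi^*}n}$ for $n\ge1$ (interior tensor powers), and $F_\infty=\bigoplus_{n\in\mathbb Z}F^{(n)}$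 (Hilbert module direct sum). For $\xi\in F$ let $S_\xi\in\mathcal L(F_\infty)$ be the operator given by $S_\xi(b)=\xi b$ for $b\in B$, $S_\xi(w)=\xi\otimes w$ for $w\in F^{(n)}$, $n\ge1$, $S_\xi(\lambda_\eta)=\phi^{-1}(\theta_{\xi,\eta})\in B$, and $S_\xi(\lambda_\eta\otimes w)=\phi^*(\phi^{-1}(\theta_{\xi,\eta}))w$ for $w\in F^{(-n)}$, $n\ge1$, where in the last formula $\phi^*$ acts on the first tensor factor. The Pimsner algebra $\mathcal O_F$ is the smallest $C^*$-subalgebra of $\mathcal L(F_\infty)$ that contains all $S_\xi$, $\xi\in F$. **Theorem.** (i) The inclusion $\mathcal O(W_q(k,l))\to B$ exhibits $B$ as the universal enveloping $C^*$-algebra $C(W_q(k,l))$ of $\mathcal O(W_q(k,l))$: every unital $*$-homomorphism from $\mathcal O(W_q(k,l))$ to a unital $C^*$-algebra extends uniquely to a $*$-homomorphism on $B$. (ii) The $d$-fold interior tensor power $E^{\widehat\otimes_\phi d}$ satisfies $(*)$, and there is an isomorphism of $C^*$-algebras $$\mathcal O_{E^{\widehat\otimes_\phi d}}\;\cong\;C(S_q^3)^{1/d},\qquad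 S_{\xi_1\otimes\cdots\otimes\xi_d}\mapsto\xi_1\cdots\xi_d\quad\text{for all }\xi_1,\dots,\xi_d\in E .$$ -/

import Mathlib

noncomputable section
open MulOpposite

namespace QuantumLens

/-! ### The coordinate algebra of the quantum 3-sphere -/

/-- The letters `z₀, z₁` (second component `false`) and `z₀*, z₁*` (second component `true`). -/
abbrev Letter : Type := Fin 2 × Bool

/-- The letter `z i` in the free algebra. -/
def fz (i : Fin 2) : FreeAlgebra ℂ Letter := FreeAlgebra.ι ℂ (i, false)

/-- The letter `(z i)*` in the free algebra. -/
def fzs (i : Fin 2) : FreeAlgebra ℂ Letter := FreeAlgebra.ι ℂ (i, true)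

/-- The defining relations of the quantum 3-sphere, together with the adjoint of the only one whose
adjoint is not again in the list. -/
inductive SphereRel (q : ℝ) : FreeAlgebra ℂ Letter → FreeAlgebra ℂ Letter → Prop
  | zz : SphereRel q (fz 0 * fz 1) ((q : ℂ) • (fz 1 * fz 0))
  | zz_adj : SphereRel q (fzs 1 * fzs 0) ((q : ℂ) • (fzs 0 * fzs 1))
  | zzs : ∀ i j : Fin 2, i ≠ j → SphereRel q (fz i * fzs j) ((q : ℂ) • (fzs j * fz i))
  | normal_zero : SphereRel q (fz 0 * fzs 0)
      (fzs 0 * fz 0 + ((q : ℂ) ^ (-2 : ℤ) - 1) • (fz 1 * fzs 1))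
  | normal_one : SphereRel q (fz 1 * fzs 1) (fzs 1 * fz 1)
  | sphere : SphereRel q (fz 0 * fzs 0 + fz 1 * fzs 1) 1

/-- The coordinate algebra `𝒪(S_q³)`: the universal unital `*`-algebra with generators `z₀, z₁` and
the relations above. -/
def SphereAlg (q : ℝ) : Type := RingQuot (SphereRel q)

namespace SphereAlg

variable {q : ℝ}

instance : Ring (SphereAlg q) := inferInstanceAs (Ring (RingQuot (SphereRel q)))
instance : Algebra ℂ (SphereAlg q) := inferInstanceAs (Algebra ℂ (RingQuot (SphereRel q)))

/-- The quotient map from the free algebra. -/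
def mk : FreeAlgebra ℂ Letter →ₐ[ℂ] SphereAlg q := RingQuot.mkAlgHom ℂ (SphereRel q)

/-- The generators `z₀, z₁`. -/
def z (i : Fin 2) : SphereAlg q := mk (fz i)

/-- The formal adjoints of the generators; they are `star (z i)`, see `star_z`. -/
def zs (i : Fin 2) : SphereAlg q := mk (fzs i)

theorem mk_rel {a b : FreeAlgebra ℂ Letter} (h : SphereRel q a b) :
    (mk a : SphereAlg q) = mk b := RingQuot.mkAlgHom_rel ℂ h

theorem rel_zz : (z 0 * z 1 : SphereAlg q) = (q : ℂ) • (z 1 * z 0) := by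
  simpa only [z, zs, map_mul, map_smul] using mk_rel (SphereRel.zz (q := q))
theorem rel_zz_adj : (zs 1 * zs 0 : SphereAlg q) = (q : ℂ) • (zs 0 * zs 1) := by
  simpa only [z, zs, map_mul, map_smul] using mk_rel (SphereRel.zz_adj (q := q))
theorem rel_zzs (i j : Fin 2) (h : i ≠ j) : (z i * zs j : SphereAlg q) = (q : ℂ) • (zs j * z i) := by
  simpa only [z, zs, map_mul, map_smul] using mk_rel (SphereRel.zzs (q := q) i j h)
theorem rel_normal_zero : (z 0 * zs 0 : SphereAlg q) =
    zs 0 * z 0 + ((q : ℂ) ^ (-2 : ℤ) - 1) • (z 1 * zs 1) := by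
  simpa only [z, zs, map_mul, map_add, map_smul] using mk_rel (SphereRel.normal_zero (q := q))
theorem rel_normal_one : (z 1 * zs 1 : SphereAlg q) = zs 1 * z 1 := by
  simpa [z, zs] using mk_rel (SphereRel.normal_one (q := q))
theorem rel_sphere : (z 0 * zs 0 + z 1 * zs 1 : SphereAlg q) = 1 := by
  simpa [z, zs] using mk_rel (SphereRel.sphere (q := q))

/-- Lifting of algebra homomorphisms. -/
def liftAlg {A : Type*} [Ring A] [Algebra ℂ A] (f : FreeAlgebra ℂ Letter →ₐ[ℂ] A)
    (hf : ∀ ⦃a b⦄, SphereRel q a b → f a = f b) : SphereAlg q →ₐ[ℂ] A :=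
  RingQuot.liftAlgHom ℂ ⟨f, hf⟩

theorem liftAlg_mk {A : Type*} [Ring A] [Algebra ℂ A] (f : FreeAlgebra ℂ Letter →ₐ[ℂ] A)
    (hf : ∀ ⦃a b⦄, SphereRel q a b → f a = f b) (x : FreeAlgebra ℂ Letter) :
    liftAlg f hf (mk x) = f x :=
  RingQuot.liftAlgHom_mkAlgHom_apply ℂ f hf x

theorem induction' {P : SphereAlg q → Prop} (hc : ∀ c : ℂ, P (algebraMap ℂ _ c))
    (hz : ∀ i, P (z i)) (hzs : ∀ i, P (zs i)) (ha : ∀ x y, P x → P y → P (x + y))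
    (hm : ∀ x y, P x → P y → P (x * y)) (x : SphereAlg q) : P x := by
  obtain ⟨y, rfl⟩ : ∃ y, (mk y : SphereAlg q) = x := RingQuot.mkAlgHom_surjective ℂ _ x
  induction y using FreeAlgebra.induction with
  | grade0 r => simpa using hc r
  | grade1 a =>
    obtain ⟨i, b⟩ := a
    cases b
    · exact hz i
    · exact hzs i
  | mul a b ha hb => simpa using hm _ _ ha hb
  | add a b ha' hb => simpa using ha _ _ ha' hb

/-- The opposite algebra with the conjugate scalar action. -/
def ConjOp (q : ℝ) : Type := (SphereAlg q)ᵐᵒᵖ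

instance : Ring (ConjOp q) := inferInstanceAs (Ring (SphereAlg q)ᵐᵒᵖ)

/-- The identity map to the opposite algebra. -/
def toC (x : SphereAlg q) : ConjOp q := op x

/-- The identity map from the opposite algebra. -/
def ofC (x : ConjOp q) : SphereAlg q := unop x

theorem toC_mul (x y : SphereAlg q) : toC x * toC y = toC (y * x) := rfl
theorem toC_add (x y : SphereAlg q) : toC x + toC y = toC (x + y) := rfl
theorem toC_one : toC (1 : SphereAlg q) = 1 := rfl
theorem ofC_mul (x y : ConjOp q) : ofC (x * y) = ofC y * ofC x := rfl
theorem ofC_add (x y : ConjOp q) : ofC (x + y) = ofC x + ofC y := rfl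
theorem ofC_toC (x : SphereAlg q) : ofC (toC x) = x := rfl

instance : Algebra ℂ (ConjOp q) :=
  RingHom.toAlgebra'
    { toFun := fun c => toC (algebraMap ℂ (SphereAlg q) (starRingEnd ℂ c))
      map_one' := by rw [map_one, map_one, toC_one]
      map_mul' := fun a b => by rw [map_mul, map_mul, toC_mul, Algebra.commutes]
      map_zero' := by rw [map_zero, map_zero]; rfl
      map_add' := fun a b => by rw [map_add, map_add, toC_add] }
    (fun c x => congrArg toC (Algebra.commutes (starRingEnd ℂ c) (ofC x)).symm)

theorem conjOp_algebraMap (c : ℂ) :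
    algebraMap ℂ (ConjOp q) c = toC (algebraMap ℂ _ (starRingEnd ℂ c)) := rfl

theorem conjOp_smul (c : ℂ) (x : SphereAlg q) :
    c • toC x = toC ((starRingEnd ℂ c) • x) := by
  rw [Algebra.smul_def, conjOp_algebraMap, toC_mul, ← Algebra.commutes, ← Algebra.smul_def]

/-- The involution on the free algebra, with values in the quotient. -/
def starFree : FreeAlgebra ℂ Letter →ₐ[ℂ] ConjOp q :=
  FreeAlgebra.lift ℂ (fun a : Letter => toC (mk (FreeAlgebra.ι ℂ (a.1, !a.2))))

theorem starFree_fz (i : Fin 2) : (starFree (fz i) : ConjOp q) = toC (zs i) :=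
  FreeAlgebra.lift_ι_apply _ _
theorem starFree_fzs (i : Fin 2) : (starFree (fzs i) : ConjOp q) = toC (z i) :=
  FreeAlgebra.lift_ι_apply _ _

theorem starFree_rel ⦃a b : FreeAlgebra ℂ Letter⦄ (h : SphereRel q a b) :
    (starFree a : ConjOp q) = starFree b := by
  have hq : (starRingEnd ℂ) (q : ℂ) = q := Complex.conj_ofReal q
  have hq' : (starRingEnd ℂ) ((q : ℂ) ^ (-2 : ℤ) - 1) = (q : ℂ) ^ (-2 : ℤ) - 1 := by
    rw [map_sub, map_zpow₀, hq, map_one]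
  cases h with
  | zz => simp only [map_mul, map_smul, starFree_fz, toC_mul, conjOp_smul, hq, rel_zz_adj]
  | zz_adj => simp only [map_mul, map_smul, starFree_fzs, toC_mul, conjOp_smul, hq, rel_zz]
  | zzs i j hij =>
    simp only [map_mul, map_smul, starFree_fzs, starFree_fz, toC_mul, conjOp_smul, hq,
      rel_zzs j i hij.symm]
  | normal_zero =>
    simp only [map_mul, map_add, map_smul, starFree_fzs, starFree_fz, toC_mul, toC_add,
      conjOp_smul, hq']
    rw [rel_normal_zero]
  | normal_one =>
    simp only [map_mul, starFree_fzs, starFree_fz, toC_mul, rel_normal_one]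
  | sphere =>
    simp only [map_mul, map_add, map_one, starFree_fzs, starFree_fz, toC_mul, toC_add, rel_sphere,
      toC_one]

/-- The involution as a homomorphism to the opposite algebra. -/
def starHom : SphereAlg q →ₐ[ℂ] ConjOp q := liftAlg starFree starFree_rel

instance : Star (SphereAlg q) := ⟨fun x => ofC (starHom x)⟩

theorem star_def (x : SphereAlg q) : star x = ofC (starHom x) := rfl

theorem star_z (i : Fin 2) : star (z i : SphereAlg q) = zs i := by
  rw [star_def, z, starHom, liftAlg_mk, starFree_fz, ofC_toC]
theorem star_zs (i : Fin 2) : star (zs i : SphereAlg q) = z i := by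
  rw [star_def, zs, starHom, liftAlg_mk, starFree_fzs, ofC_toC]

theorem star_add' (x y : SphereAlg q) : star (x + y) = star x + star y := by
  rw [star_def, map_add, ofC_add, ← star_def, ← star_def]
theorem star_mul' (x y : SphereAlg q) : star (x * y) = star y * star x := by
  rw [star_def, map_mul, ofC_mul, ← star_def, ← star_def]
theorem star_algebraMap' (c : ℂ) :
    star (algebraMap ℂ (SphereAlg q) c) = algebraMap ℂ _ (starRingEnd ℂ c) := by
  rw [star_def, AlgHom.commutes, conjOp_algebraMap, ofC_toC]

instance : StarRing (SphereAlg q) where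
  star_involutive x := by
    induction x using induction' with
    | hc c => simp [star_algebraMap']
    | hz i => rw [star_z, star_zs]
    | hzs i => rw [star_zs, star_z]
    | ha x y hx hy => rw [star_add', star_add', hx, hy]
    | hm x y hx hy => rw [star_mul', star_mul', hx, hy]
  star_mul := star_mul'
  star_add := star_add'

instance : StarModule ℂ (SphereAlg q) where
  star_smul c x := by
    rw [Algebra.smul_def, star_mul, star_algebraMap', Algebra.smul_def, Algebra.commutes]; rfl

/-- Two elements of a `*`-algebra satisfying the relations of the quantum 3-sphere. -/
structure IsSpherePair {A : Type*} [Ring A] [StarRing A] [Algebra ℂ A] (q : ℝ) (w : Fin 2 → A) :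
    Prop where
  zz : w 0 * w 1 = (q : ℂ) • (w 1 * w 0)
  zzs : ∀ i j, i ≠ j → w i * star (w j) = (q : ℂ) • (star (w j) * w i)
  normal_zero : w 0 * star (w 0) = star (w 0) * w 0 + ((q : ℂ) ^ (-2 : ℤ) - 1) • (w 1 * star (w 1))
  normal_one : w 1 * star (w 1) = star (w 1) * w 1
  sphere : w 0 * star (w 0) + w 1 * star (w 1) = 1

theorem isSpherePair_z : IsSpherePair q (z : Fin 2 → SphereAlg q) := by
  constructor
  · exact rel_zz
  · intro i j h; rw [star_z]; exact rel_zzs i j h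
  · simp only [star_z]; exact rel_normal_zero
  · simp only [star_z]; exact rel_normal_one
  · simp only [star_z]; exact rel_sphere

section lift
variable {A : Type*} [Ring A] [StarRing A] [Algebra ℂ A]

/-- The underlying map of `lift` on the free algebra. -/
def liftFree (w : Fin 2 → A) : FreeAlgebra ℂ Letter →ₐ[ℂ] A :=
  FreeAlgebra.lift ℂ (fun a : Letter => if a.2 then star (w a.1) else w a.1)

theorem liftFree_rel [StarModule ℂ A] {w : Fin 2 → A} (hw : IsSpherePair q w) ⦃a b : FreeAlgebra ℂ Letter⦄
    (h : SphereRel q a b) : liftFree w a = liftFree w b := by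
  have h1 : ∀ i, liftFree w (fz i) = w i := fun i => by simp [liftFree, fz]
  have h2 : ∀ i, liftFree w (fzs i) = star (w i) := fun i => by simp [liftFree, fzs]
  cases h with
  | zz => simp only [map_mul, map_smul, h1, hw.zz]
  | zz_adj =>
    have := congrArg star hw.zz
    rw [star_mul, star_smul, star_mul] at this
    simp only [map_mul, map_smul, h2, this]
    congr 1
    exact Complex.conj_ofReal q
  | zzs i j hij => simp only [map_mul, map_smul, h1, h2, hw.zzs i j hij]
  | normal_zero =>
    simp only [map_mul, map_add, map_smul, h1, h2]
    exact hw.normal_zero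
  | normal_one => simp only [map_mul, h1, h2, hw.normal_one]
  | sphere => simp only [map_mul, map_add, map_one, h1, h2, hw.sphere]

/-- The universal property of `𝒪(S_q³)`. -/
def lift [StarModule ℂ A] (w : Fin 2 → A) (hw : IsSpherePair q w) : SphereAlg q →⋆ₐ[ℂ] A where
  __ := liftAlg (liftFree w) (liftFree_rel hw)
  map_star' x := by
    change liftAlg (liftFree w) (liftFree_rel hw) (star x) =
      star (liftAlg (liftFree w) (liftFree_rel hw) x)
    have h1 : ∀ i, liftAlg (liftFree w) (liftFree_rel hw) (z i) = w i := fun i => by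
      rw [z, liftAlg_mk]; simp [liftFree, fz]
    have h2 : ∀ i, liftAlg (liftFree w) (liftFree_rel hw) (zs i) = star (w i) := fun i => by
      rw [zs, liftAlg_mk]; simp [liftFree, fzs]
    induction x using induction' with
    | hc c =>
      rw [star_algebraMap', AlgHom.commutes, AlgHom.commutes, Algebra.algebraMap_eq_smul_one,
        Algebra.algebraMap_eq_smul_one, star_smul, star_one]
      rfl
    | hz i => rw [star_z, h1, h2]
    | hzs i => rw [star_zs, h1, h2, star_star]
    | ha x y hx hy => rw [star_add, map_add, map_add, star_add, hx, hy]
    | hm x y hx hy => rw [star_mul, map_mul, map_mul, star_mul, hx, hy]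

@[simp] theorem lift_z [StarModule ℂ A] (w : Fin 2 → A) (hw : IsSpherePair q w) (i : Fin 2) :
    lift w hw (z i) = w i := by
  change liftAlg (liftFree w) (liftFree_rel hw) (z i) = w i
  rw [z, liftAlg_mk]; simp [liftFree, fz]

theorem hom_ext {f g : SphereAlg q →⋆ₐ[ℂ] A} (h : ∀ i, f (z i) = g (z i)) : f = g := by
  ext x
  induction x using induction' with
  | hc c => simp [AlgHomClass.commutes]
  | hz i => exact h i
  | hzs i => rw [← star_z, map_star, map_star, h]
  | ha x y hx hy => rw [map_add, map_add, hx, hy]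
  | hm x y hx hy => rw [map_mul, map_mul, hx, hy]

theorem map_pair (f : SphereAlg q →⋆ₐ[ℂ] A) : IsSpherePair q (fun i => f (z i)) := by
  have h := isSpherePair_z (q := q)
  constructor
  · rw [← map_mul, h.zz, map_smul, map_mul]
  · intro i j hij; rw [← map_star, ← map_mul, h.zzs i j hij, map_smul, map_mul]
  · simp only [← map_star, ← map_mul, ← map_smul, ← map_add]
    rw [h.normal_zero]
  · simp only [← map_star, ← map_mul]
    rw [h.normal_one]
  · simp only [← map_star, ← map_mul, ← map_add]
    rw [h.sphere, map_one]

end lift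

theorem isSpherePair_phase (u : Fin 2 → Circle) :
    IsSpherePair q (fun i => ((u i : ℂ) • z i : SphereAlg q)) := by
  have h := isSpherePair_z (q := q)
  have hs : ∀ i, star ((u i : ℂ) • z i : SphereAlg q) = ((u i : ℂ)⁻¹) • star (z i) := fun i => by
    rw [star_smul]; congr 1
    exact (Circle.coe_inv_eq_conj (u i)).symm.trans (Circle.coe_inv (u i))
  have hu : ∀ i, (u i : ℂ) * (u i : ℂ)⁻¹ = 1 := fun i => mul_inv_cancel₀ (Circle.coe_ne_zero _)
  have hu' : ∀ i, (u i : ℂ)⁻¹ * (u i : ℂ) = 1 := fun i => inv_mul_cancel₀ (Circle.coe_ne_zero _)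
  constructor
  · simp only [smul_mul_smul_comm, h.zz, smul_smul]
    congr 1; ring
  · intro i j hij
    simp only [hs, smul_mul_smul_comm, h.zzs i j hij, smul_smul]
    congr 1; ring
  · simp only [hs, smul_mul_smul_comm, hu, hu', one_smul]; exact h.normal_zero
  · simp only [hs, smul_mul_smul_comm, hu, hu', one_smul]; exact h.normal_one
  · simp only [hs, smul_mul_smul_comm, hu, one_smul]; exact h.sphere

/-- The `*`-endomorphism `z₀ ↦ u₀ z₀`, `z₁ ↦ u₁ z₁` of `𝒪(S_q³)`, for `u₀, u₁` in the circle. -/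
def phase (u : Fin 2 → Circle) : SphereAlg q →⋆ₐ[ℂ] SphereAlg q :=
  lift (fun i => (u i : ℂ) • z i) (isSpherePair_phase u)

end SphereAlg

open SphereAlg

/-- The weighted circle action `σ_w : z₀ ↦ w ^ k z₀`, `z₁ ↦ w ^ l z₁` on `𝒪(S_q³)`. -/
def circleAction (q : ℝ) (k l : ℕ) (w : Circle) : SphereAlg q →⋆ₐ[ℂ] SphereAlg q :=
  phase ![w ^ k, w ^ l]

/-- The coordinate algebra `𝒪(W_q(k,l))` of the quantum weighted projective line: the fixed points
of the weighted circle action. -/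
def projAlg (q : ℝ) (k l : ℕ) : StarSubalgebra ℂ (SphereAlg q) where
  carrier := {x | ∀ w, circleAction q k l w x = x}
  mul_mem' hx hy w := by rw [map_mul, hx w, hy w]
  add_mem' hx hy w := by rw [map_add, hx w, hy w]
  algebraMap_mem' c w := AlgHomClass.commutes _ c
  star_mem' hx w := by rw [map_star, hx w]

/-- The module `𝒜₍₁₎(k,l) = (z₁*)ᵏ 𝒪(W_q(k,l)) + (z₀*)ˡ 𝒪(W_q(k,l))`. -/
def lineMod (q : ℝ) (k l : ℕ) : Submodule ℂ (SphereAlg q) where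
  carrier := {ξ | ∃ x ∈ projAlg q k l, ∃ y ∈ projAlg q k l,
    ξ = star (z 1) ^ k * x + star (z 0) ^ l * y}
  add_mem' := by
    rintro _ _ ⟨x, hx, y, hy, rfl⟩ ⟨x', hx', y', hy', rfl⟩
    exact ⟨x + x', add_mem hx hx', y + y', add_mem hy hy', by rw [mul_add, mul_add]; abel⟩
  zero_mem' := ⟨0, zero_mem _, 0, zero_mem _, by simp⟩
  smul_mem' := by
    rintro c _ ⟨x, hx, y, hy, rfl⟩
    exact ⟨c • x, SMulMemClass.smul_mem c hx, c • y, SMulMemClass.smul_mem c hy, by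
      rw [mul_smul_comm, mul_smul_comm, smul_add]⟩

end QuantumLens
/-! ### Enveloping C*-algebras -/

namespace QuantumLens

section Enveloping

variable (𝒜 : Type) [Ring 𝒜] [StarRing 𝒜] [Algebra ℂ 𝒜]

/-- The values `‖π x‖` of the norm of `x` in all `*`-representations `π` in C*-algebras. -/
def repNorms {𝒜 : Type} [Ring 𝒜] [StarRing 𝒜] [Algebra ℂ 𝒜] (x : 𝒜) : Set ℝ :=
  {r | ∃ (D : Type) (_ : CStarAlgebra D) (π : 𝒜 →⋆ₐ[ℂ] D), r = ‖π x‖}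

/-- The universal C*-seminorm `x ↦ sup_π ‖π x‖` is finite. -/
class HasEnveloping : Prop where
  bddAbove : ∀ x : 𝒜, BddAbove (repNorms x)

/-- The universal C*-seminorm. -/
def univNorm {𝒜 : Type} [Ring 𝒜] [StarRing 𝒜] [Algebra ℂ 𝒜] (x : 𝒜) : ℝ := sSup (repNorms x)

variable {𝒜}

theorem univNorm_nonneg (x : 𝒜) : 0 ≤ univNorm x :=
  Real.sSup_nonneg (by rintro _ ⟨D, _, π, rfl⟩; exact norm_nonneg _)

theorem univNorm_le {x : 𝒜} {a : ℝ} (ha : 0 ≤ a)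
    (h : ∀ (D : Type) (_ : CStarAlgebra D) (π : 𝒜 →⋆ₐ[ℂ] D), ‖π x‖ ≤ a) : univNorm x ≤ a :=
  Real.sSup_le (by rintro _ ⟨D, _, π, rfl⟩; exact h D _ π) ha

theorem norm_le_univNorm [HasEnveloping 𝒜] {D : Type} [CStarAlgebra D] (π : 𝒜 →⋆ₐ[ℂ] D) (x : 𝒜) :
    ‖π x‖ ≤ univNorm x :=
  le_csSup (HasEnveloping.bddAbove x) ⟨D, _, π, rfl⟩

variable (𝒜) in
/-- The algebra `𝒜` with the universal C*-seminorm. -/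
def Seminormed : Type := 𝒜

instance : Ring (Seminormed 𝒜) := inferInstanceAs (Ring 𝒜)
instance : StarRing (Seminormed 𝒜) := inferInstanceAs (StarRing 𝒜)
instance : Algebra ℂ (Seminormed 𝒜) := inferInstanceAs (Algebra ℂ 𝒜)
instance [StarModule ℂ 𝒜] : StarModule ℂ (Seminormed 𝒜) := inferInstanceAs (StarModule ℂ 𝒜)
instance [HasEnveloping 𝒜] : HasEnveloping (Seminormed 𝒜) := inferInstanceAs (HasEnveloping 𝒜)

variable [HasEnveloping 𝒜]

theorem univNorm_smul_le (c : ℂ) (x : 𝒜) :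
    univNorm (c • x) ≤ ‖c‖ * univNorm x :=
  univNorm_le (mul_nonneg (norm_nonneg _) (univNorm_nonneg (𝒜 := 𝒜) _)) fun D _ π => by
    rw [map_smul, norm_smul]
    exact mul_le_mul_of_nonneg_left (norm_le_univNorm π x) (norm_nonneg _)

instance : Norm (Seminormed 𝒜) := ⟨fun x => univNorm (𝒜 := 𝒜) x⟩

theorem seminormed_core : SeminormedSpace.Core ℂ (Seminormed 𝒜) where
  norm_nonneg := fun x => univNorm_nonneg (𝒜 := 𝒜) x
  norm_smul := by
    intro c x
    refine le_antisymm (univNorm_smul_le (𝒜 := 𝒜) c x) ?_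
    rcases eq_or_ne c 0 with rfl | hc
    · rw [norm_zero, zero_mul]; exact univNorm_nonneg _
    · have : ‖c⁻¹ • c • x‖ ≤ ‖c⁻¹‖ * ‖c • x‖ := univNorm_smul_le (𝒜 := 𝒜) c⁻¹ (c • x)
      rw [smul_smul, inv_mul_cancel₀ hc, one_smul, norm_inv] at this
      have hc' : 0 < ‖c‖ := norm_pos_iff.2 hc
      calc ‖c‖ * ‖x‖ ≤ ‖c‖ * (‖c‖⁻¹ * ‖c • x‖) := mul_le_mul_of_nonneg_left this hc'.le
        _ = _ := by rw [← mul_assoc, mul_inv_cancel₀ hc'.ne', one_mul]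
  norm_triangle := fun x y =>
    univNorm_le (add_nonneg (univNorm_nonneg (𝒜 := 𝒜) _) (univNorm_nonneg (𝒜 := 𝒜) _)) fun D _ π => by
      have : π (x + y) = π x + π y := map_add π x y
      rw [this]
      exact (norm_add_le _ _).trans (add_le_add (norm_le_univNorm π x) (norm_le_univNorm π y))

instance : SeminormedRing (Seminormed 𝒜) where
  __ := (inferInstance : Ring (Seminormed 𝒜))
  __ := SeminormedAddCommGroup.ofCore (seminormed_core (𝒜 := 𝒜))
  norm_mul_le x y :=
    univNorm_le (mul_nonneg (univNorm_nonneg (𝒜 := 𝒜) _) (univNorm_nonneg (𝒜 := 𝒜) _)) fun D _ π => by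
      have : π (x * y) = π x * π y := map_mul π x y
      rw [this]
      exact (norm_mul_le _ _).trans (mul_le_mul (norm_le_univNorm π x) (norm_le_univNorm π y)
        (norm_nonneg _) (univNorm_nonneg (𝒜 := 𝒜) _))

theorem seminormed_norm_star (x : Seminormed 𝒜) : ‖star x‖ = ‖x‖ := by
  have key : ∀ x : Seminormed 𝒜, ‖star x‖ ≤ ‖x‖ := fun x =>
    univNorm_le (univNorm_nonneg (𝒜 := 𝒜) _) fun D _ π => by
      have : ‖π (star x)‖ = ‖π x‖ := (congrArg norm (map_star π x)).trans (norm_star _)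
      exact this.le.trans (norm_le_univNorm π x)
  refine le_antisymm (key x) ?_
  simpa using key (star x)

theorem seminormed_norm_sq (x : Seminormed 𝒜) : ‖x‖ * ‖x‖ ≤ ‖star x * x‖ := by
  have h : ‖x‖ ≤ √‖star x * x‖ := univNorm_le (Real.sqrt_nonneg _) fun D _ π => by
    refine Real.le_sqrt_of_sq_le ?_
    rw [sq, ← CStarRing.norm_star_mul_self]
    have : ‖π (star x * x)‖ = ‖star (π x) * π x‖ := by
      have h1 : π (star x * x) = π (star x) * π x := map_mul π _ _
      have h2 : π (star x) = star (π x) := map_star π _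
      rw [h1, h2]
    rw [← this]
    exact norm_le_univNorm π _
  calc ‖x‖ * ‖x‖ ≤ √‖star x * x‖ * √‖star x * x‖ :=
        mul_le_mul h h (norm_nonneg _) (Real.sqrt_nonneg _)
    _ = _ := Real.mul_self_sqrt (norm_nonneg _)

instance : NormedAlgebra ℂ (Seminormed 𝒜) where
  norm_smul_le c x := univNorm_le (mul_nonneg (norm_nonneg _) (univNorm_nonneg (𝒜 := 𝒜) _)) fun D _ π => by
    have : π (c • x) = c • π x := map_smul π c x
    rw [this, norm_smul]
    exact mul_le_mul_of_nonneg_left (norm_le_univNorm π x) (norm_nonneg _)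

instance : NormedStarGroup (Seminormed 𝒜) := ⟨fun x => (seminormed_norm_star x).le⟩

variable (𝒜) in
/-- The universal enveloping C*-algebra of `𝒜`: the (separated) completion of `𝒜` in the universal
C*-seminorm. -/
def Enveloping : Type := UniformSpace.Completion (Seminormed 𝒜)

namespace Enveloping

open UniformSpace

instance : NormedRing (Enveloping 𝒜) :=
  inferInstanceAs (NormedRing (Completion (Seminormed 𝒜)))
instance : CompleteSpace (Enveloping 𝒜) :=
  inferInstanceAs (CompleteSpace (Completion (Seminormed 𝒜)))
instance : Algebra ℂ (Enveloping 𝒜) :=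
  inferInstanceAs (Algebra ℂ (Completion (Seminormed 𝒜)))
instance : NormedAlgebra ℂ (Enveloping 𝒜) where
  norm_smul_le := fun (c : ℂ) (x : Completion (Seminormed 𝒜)) => norm_smul_le c x

/-- The canonical map, as a ring homomorphism. -/
def ofRing : 𝒜 →+* Enveloping 𝒜 := Completion.coeRingHom (α := Seminormed 𝒜)

theorem norm_ofRing (x : 𝒜) : ‖(ofRing x : Enveloping 𝒜)‖ = univNorm x :=
  Completion.norm_coe (E := Seminormed 𝒜) x

theorem denseRange_ofRing : DenseRange (ofRing : 𝒜 → Enveloping 𝒜) :=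
  Completion.denseRange_coe (α := Seminormed 𝒜)

instance : Star (Enveloping 𝒜) := ⟨Completion.map (star : Seminormed 𝒜 → Seminormed 𝒜)⟩

theorem continuous_star' : Continuous (star : Enveloping 𝒜 → Enveloping 𝒜) :=
  Completion.continuous_map

theorem star_ofRing (x : 𝒜) : star (ofRing x : Enveloping 𝒜) = ofRing (star x) :=
  Completion.map_coe (f := (star : Seminormed 𝒜 → Seminormed 𝒜))
    (starNormedAddGroupHom (E := Seminormed 𝒜)).uniformContinuous x

theorem ofRing_smul (c : ℂ) (x : 𝒜) : (ofRing (c • x) : Enveloping 𝒜) = c • ofRing x :=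
  Completion.coe_smul (X := Seminormed 𝒜) c x

theorem induction_on {p : Enveloping 𝒜 → Prop} (x : Enveloping 𝒜) (hp : IsClosed {x | p x})
    (h : ∀ a, p (ofRing a)) : p x := denseRange_ofRing.induction_on x hp h

theorem induction_on₂ {p : Enveloping 𝒜 → Enveloping 𝒜 → Prop} (x y : Enveloping 𝒜)
    (hp : IsClosed {x : Enveloping 𝒜 × Enveloping 𝒜 | p x.1 x.2})
    (h : ∀ a b, p (ofRing a) (ofRing b)) : p x y := denseRange_ofRing.induction_on₂ hp h x y

instance : StarRing (Enveloping 𝒜) where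
  star_involutive x := by
    refine induction_on (p := fun x => star (star x) = x) x
      (isClosed_eq (continuous_star'.comp continuous_star') continuous_id) ?_
    intro a; rw [star_ofRing, star_ofRing, star_star]
  star_mul x y := by
    refine induction_on₂ (p := fun x y => star (x * y) = star y * star x) x y
      (isClosed_eq (continuous_star'.comp continuous_mul)
      ((continuous_star'.comp continuous_snd).mul (continuous_star'.comp continuous_fst))) ?_
    intro a b
    rw [← map_mul, star_ofRing, star_ofRing, star_ofRing, ← map_mul, star_mul]
  star_add x y := by
    refine induction_on₂ (p := fun x y => star (x + y) = star x + star y) x y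
      (isClosed_eq (continuous_star'.comp continuous_add)
      ((continuous_star'.comp continuous_fst).add (continuous_star'.comp continuous_snd))) ?_
    intro a b
    rw [← map_add, star_ofRing, star_ofRing, star_ofRing, ← map_add, star_add]

instance [StarModule ℂ 𝒜] : CStarAlgebra (Enveloping 𝒜) where
  norm_mul_self_le x := by
    refine induction_on (p := fun x => ‖x‖ * ‖x‖ ≤ ‖star x * x‖) x
      (isClosed_le (continuous_norm.mul continuous_norm)
      (continuous_norm.comp (continuous_star'.mul continuous_id))) ?_
    intro a
    rw [star_ofRing, ← map_mul, norm_ofRing, norm_ofRing]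
    exact seminormed_norm_sq (𝒜 := 𝒜) a
  star_smul c x := by
    refine induction_on (p := fun x => star (c • x) = star c • star x) x
      (isClosed_eq (continuous_star'.comp (continuous_const_smul c))
      (continuous_star'.const_smul (star c))) ?_
    intro a
    rw [← ofRing_smul, star_ofRing, star_ofRing, ← ofRing_smul, star_smul]

/-- The canonical `*`-homomorphism from `𝒜` to its enveloping C*-algebra. -/
def of : 𝒜 →⋆ₐ[ℂ] Enveloping 𝒜 where
  __ := (ofRing : 𝒜 →+* Enveloping 𝒜)
  commutes' c := by
    change ofRing (algebraMap ℂ 𝒜 c) = _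
    rw [Algebra.algebraMap_eq_smul_one, ofRing_smul, map_one, Algebra.algebraMap_eq_smul_one]
  map_star' x := (star_ofRing x).symm

theorem norm_of (x : 𝒜) : ‖(of x : Enveloping 𝒜)‖ = univNorm x := norm_ofRing x

theorem denseRange_of : DenseRange (of : 𝒜 → Enveloping 𝒜) := denseRange_ofRing

/-- The underlying map of `lift`. -/
def liftFun {D : Type} [CStarAlgebra D] (π : 𝒜 →⋆ₐ[ℂ] D) : Enveloping 𝒜 → D :=
  Completion.extension (α := Seminormed 𝒜) (β := D) (fun x => π x)

theorem continuous_liftFun {D : Type} [CStarAlgebra D] (π : 𝒜 →⋆ₐ[ℂ] D) :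
    Continuous (liftFun π) := Completion.continuous_extension

theorem liftFun_ofRing {D : Type} [CStarAlgebra D] (π : 𝒜 →⋆ₐ[ℂ] D) (x : 𝒜) :
    liftFun π (ofRing x) = π x := by
  let L : Seminormed 𝒜 →+ D :=
    { toFun := fun x => π x, map_zero' := map_zero π, map_add' := map_add π }
  have hu : UniformContinuous L :=
    AddMonoidHomClass.uniformContinuous_of_bound L 1 fun x => by
      rw [one_mul]; exact norm_le_univNorm π x
  exact Completion.extension_coe (α := Seminormed 𝒜) hu x

/-- The extension of a `*`-homomorphism to the enveloping C*-algebra. -/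
def lift {D : Type} [CStarAlgebra D] (π : 𝒜 →⋆ₐ[ℂ] D) : Enveloping 𝒜 →⋆ₐ[ℂ] D where
  toFun := liftFun π
  map_one' := by rw [← map_one ofRing, liftFun_ofRing, map_one]
  map_mul' x y := by
    have hc := continuous_liftFun π
    refine induction_on₂ (p := fun x y => liftFun π (x * y) = liftFun π x * liftFun π y) x y
      (isClosed_eq (hc.comp continuous_mul)
      ((hc.comp continuous_fst).mul (hc.comp continuous_snd))) ?_
    intro a b
    rw [← map_mul, liftFun_ofRing, liftFun_ofRing, liftFun_ofRing, map_mul]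
  map_zero' := by rw [← map_zero ofRing, liftFun_ofRing, map_zero]
  map_add' x y := by
    have hc := continuous_liftFun π
    refine induction_on₂ (p := fun x y => liftFun π (x + y) = liftFun π x + liftFun π y) x y
      (isClosed_eq (hc.comp continuous_add)
      ((hc.comp continuous_fst).add (hc.comp continuous_snd))) ?_
    intro a b
    rw [← map_add, liftFun_ofRing, liftFun_ofRing, liftFun_ofRing, map_add]
  commutes' c := by
    rw [← AlgHomClass.commutes of c]
    exact (liftFun_ofRing π _).trans (AlgHomClass.commutes π c)
  map_star' x := by
    have hc := continuous_liftFun π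
    refine induction_on (p := fun x => liftFun π (star x) = star (liftFun π x)) x
      (isClosed_eq (hc.comp continuous_star') hc.star) ?_
    intro a
    rw [star_ofRing, liftFun_ofRing, liftFun_ofRing, map_star]

theorem continuous_lift {D : Type} [CStarAlgebra D] (π : 𝒜 →⋆ₐ[ℂ] D) : Continuous (lift π) :=
  continuous_liftFun π

@[simp] theorem lift_of {D : Type} [CStarAlgebra D] (π : 𝒜 →⋆ₐ[ℂ] D) (x : 𝒜) :
    lift π (of x) = π x := liftFun_ofRing π x

/-- The extension of a `*`-endomorphism to the enveloping C*-algebra. -/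
def map [StarModule ℂ 𝒜] (f : 𝒜 →⋆ₐ[ℂ] 𝒜) : Enveloping 𝒜 →⋆ₐ[ℂ] Enveloping 𝒜 := lift (of.comp f)

@[simp] theorem map_of [StarModule ℂ 𝒜] (f : 𝒜 →⋆ₐ[ℂ] 𝒜) (x : 𝒜) : map f (of x) = of (f x) := lift_of _ x

end Enveloping

end Enveloping

/-- `j : 𝒜 → C` exhibits `C` as the universal enveloping C*-algebra of `𝒜`. -/
def IsEnveloping.{u} {𝒜 C : Type} [Ring 𝒜] [StarRing 𝒜] [Algebra ℂ 𝒜] [CStarAlgebra C]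
    (j : 𝒜 →⋆ₐ[ℂ] C) : Prop :=
  ∀ (D : Type u) [CStarAlgebra D] (ρ : 𝒜 →⋆ₐ[ℂ] D), ∃! ρ' : C →⋆ₐ[ℂ] D, ∀ x, ρ' (j x) = ρ x

end QuantumLens
/-! ### The C*-algebras of the quantum 3-sphere, lens spaces and weighted projective lines -/

namespace QuantumLens

open SphereAlg

theorem norm_one_le' {D : Type*} [CStarAlgebra D] : ‖(1 : D)‖ ≤ 1 := by
  rcases subsingleton_or_nontrivial D with h | h
  · rw [Subsingleton.elim (1 : D) 0, norm_zero]; exact zero_le_one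
  · rw [CStarRing.norm_one]

theorem norm_le_one_of_add {D : Type*} [CStarAlgebra D] {a b : D}
    (h : a * star a + b * star b = 1) : ‖a‖ ≤ 1 := by
  let _ := CStarAlgebra.spectralOrder D
  have := CStarAlgebra.spectralOrderedRing D
  have h1 : ‖a * star a‖ ≤ ‖(1 : D)‖ := by
    refine CStarAlgebra.norm_le_norm_of_nonneg_of_le (mul_star_self_nonneg a) ?_
    rw [← h]
    exact le_add_of_nonneg_right (mul_star_self_nonneg b)
  rw [CStarRing.norm_self_mul_star] at h1
  have := h1.trans norm_one_le'
  nlinarith [norm_nonneg a]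

instance (q : ℝ) : HasEnveloping (SphereAlg q) where
  bddAbove x := by
    suffices h : ∃ C : ℝ, ∀ (D : Type) (_ : CStarAlgebra D) (π : SphereAlg q →⋆ₐ[ℂ] D), ‖π x‖ ≤ C by
      obtain ⟨C, hC⟩ := h
      exact ⟨C, by rintro _ ⟨D, _, π, rfl⟩; exact hC D _ π⟩
    have hz : ∀ (i : Fin 2) (D : Type) (_ : CStarAlgebra D) (π : SphereAlg q →⋆ₐ[ℂ] D),
        ‖π (z i)‖ ≤ 1 := by
      intro i D _ π
      have h := (map_pair π).sphere
      fin_cases i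
      · exact norm_le_one_of_add h
      · rw [add_comm] at h
        exact norm_le_one_of_add h
    induction x using induction' with
    | hc c =>
      refine ⟨‖c‖ * 1, fun D _ π => ?_⟩
      rw [AlgHomClass.commutes, Algebra.algebraMap_eq_smul_one, norm_smul]
      exact mul_le_mul_of_nonneg_left norm_one_le' (norm_nonneg _)
    | hz i => exact ⟨1, hz i⟩
    | hzs i =>
      refine ⟨1, fun D _ π => ?_⟩
      rw [← star_z, map_star, norm_star]
      exact hz i D _ π
    | ha x y hx hy =>
      obtain ⟨C, hC⟩ := hx
      obtain ⟨C', hC'⟩ := hy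
      refine ⟨C + C', fun D _ π => ?_⟩
      rw [map_add]
      exact (norm_add_le _ _).trans (add_le_add (hC D _ π) (hC' D _ π))
    | hm x y hx hy =>
      obtain ⟨C, hC⟩ := hx
      obtain ⟨C', hC'⟩ := hy
      refine ⟨C * C', fun D _ π => ?_⟩
      rw [map_mul]
      exact (norm_mul_le _ _).trans (mul_le_mul (hC D _ π) (hC' D _ π) (norm_nonneg _)
        ((norm_nonneg _).trans (hC D _ π)))

/-- The C*-algebra `C(S_q³)`: the universal enveloping C*-algebra of `𝒪(S_q³)`. -/
abbrev CSphere (q : ℝ) : Type := Enveloping (SphereAlg q)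

/-- The canonical map `𝒪(S_q³) → C(S_q³)`. -/
abbrev ofSphere (q : ℝ) : SphereAlg q →⋆ₐ[ℂ] CSphere q := Enveloping.of

/-- The point `exp(2πi / n)` of the circle. -/
def root (n : ℕ) : Circle := Circle.exp (2 * Real.pi / n)

/-- The generator `α^{1/d}(1, ·)` of the action of `ℤ/dlkℤ` on `C(S_q³)`, which is given by
`z₀ ↦ exp(2πi/(dl)) z₀` and `z₁ ↦ exp(2πi/(dk)) z₁`. -/
def cyclicAction (q : ℝ) (k l d : ℕ) : CSphere q →⋆ₐ[ℂ] CSphere q :=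
  Enveloping.map (phase ![root (d * l), root (d * k)])

/-- The C*-quantum lens space `C(S_q³)^{1/d}`: the fixed point algebra of the cyclic action. -/
def lensAlg (q : ℝ) (k l d : ℕ) : StarSubalgebra ℂ (CSphere q) where
  carrier := {x | cyclicAction q k l d x = x}
  mul_mem' {a b} (hx : _ = _) (hy : _ = _) := by
    rw [Set.mem_ofPred_eq, map_mul, hx, hy]
  add_mem' {a b} (hx : _ = _) (hy : _ = _) := by
    rw [Set.mem_ofPred_eq, map_add, hx, hy]
  algebraMap_mem' c := AlgHomClass.commutes _ c
  star_mem' {a} (hx : _ = _) := by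
    rw [Set.mem_ofPred_eq, map_star, hx]

/-- The closure `B` of `𝒪(W_q(k,l))` in `C(S_q³)`. -/
def projC (q : ℝ) (k l : ℕ) : StarSubalgebra ℂ (CSphere q) :=
  ((projAlg q k l).map (ofSphere q)).topologicalClosure

instance (q : ℝ) (k l : ℕ) : CStarAlgebra (projC q k l) :=
  haveI : IsClosed (projC q k l : Set (CSphere q)) :=
    StarSubalgebra.isClosed_topologicalClosure _
  StarSubalgebra.cstarAlgebra _

theorem mem_projC_of {q : ℝ} {k l : ℕ} {x : SphereAlg q} (hx : x ∈ projAlg q k l) :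
    ofSphere q x ∈ projC q k l :=
  StarSubalgebra.le_topologicalClosure _ ⟨x, hx, rfl⟩

/-- The canonical `*`-homomorphism `𝒪(W_q(k,l)) → B`. -/
def projOf (q : ℝ) (k l : ℕ) : projAlg q k l →⋆ₐ[ℂ] projC q k l where
  toFun x := ⟨ofSphere q x, mem_projC_of x.2⟩
  map_one' := Subtype.ext (map_one _)
  map_mul' _ _ := Subtype.ext (map_mul _ _ _)
  map_zero' := Subtype.ext (map_zero _)
  map_add' _ _ := Subtype.ext (map_add _ _ _)
  commutes' c := Subtype.ext (AlgHomClass.commutes _ c)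
  map_star' _ := Subtype.ext (map_star _ _)

/-! #### Products of elements of `𝒜₍₁₎(k,l)` -/

section weights
variable {q : ℝ} {k l : ℕ}

theorem circleAction_z (w : Circle) (i : Fin 2) :
    circleAction q k l w (z i) = ((![w ^ k, w ^ l] i : Circle) : ℂ) • z i := by
  rw [circleAction, phase, lift_z]

/-- `x` has weight `n` for the weighted circle action. -/
def HasWeight (q : ℝ) (k l : ℕ) (n : ℤ) (x : SphereAlg q) : Prop :=
  ∀ w : Circle, circleAction q k l w x = ((w ^ n : Circle) : ℂ) • x

theorem HasWeight.mul {m n : ℤ} {x y : SphereAlg q} (hx : HasWeight q k l m x)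
    (hy : HasWeight q k l n y) : HasWeight q k l (m + n) (x * y) := by
  intro w
  rw [map_mul, hx, hy, smul_mul_smul_comm, zpow_add, Circle.coe_mul]

theorem HasWeight.star {n : ℤ} {x : SphereAlg q} (hx : HasWeight q k l n x) :
    HasWeight q k l (-n) (star x) := by
  intro w
  rw [map_star, hx, star_smul, zpow_neg, Circle.coe_inv_eq_conj]; rfl

theorem HasWeight.pow {n : ℤ} {x : SphereAlg q} (hx : HasWeight q k l n x) (m : ℕ) :
    HasWeight q k l (m * n) (x ^ m) := by
  induction m with
  | zero => intro w; simp
  | succ m ih =>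
    rw [pow_succ]
    convert ih.mul hx using 1
    push_cast; ring

theorem hasWeight_zero_iff {x : SphereAlg q} : HasWeight q k l 0 x ↔ x ∈ projAlg q k l := by
  refine forall_congr' fun w => ?_
  simp

theorem hasWeight_z0 : HasWeight q k l k (z 0) := fun w => by
  rw [circleAction_z]; simp
theorem hasWeight_z1 : HasWeight q k l l (z 1) := fun w => by
  rw [circleAction_z]; simp

theorem hasWeight_z0l : HasWeight q k l (k * l) (z 0 ^ l) := by
  convert hasWeight_z0.pow l using 1; ring
theorem hasWeight_z1k : HasWeight q k l (k * l) (z 1 ^ k) := hasWeight_z1.pow k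

theorem hasWeight_of_mem {x : SphereAlg q} (hx : x ∈ lineMod q k l) :
    HasWeight q k l (-(k * l)) x := by
  obtain ⟨a, ha, b, hb, rfl⟩ := hx
  intro w
  have h1 := (hasWeight_z1k (q := q) (k := k) (l := l)).star.mul (hasWeight_zero_iff.2 ha) w
  have h0 := (hasWeight_z0l (q := q) (k := k) (l := l)).star.mul (hasWeight_zero_iff.2 hb) w
  rw [add_zero, star_pow] at h1 h0
  rw [map_add, h1, h0, smul_add]

/-- `z₁ z₁*`. -/
def bElt (q : ℝ) : SphereAlg q := z 1 * star (z 1)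

theorem z0_mul_b : z 0 * bElt q = ((q : ℂ) ^ 2) • (bElt q * z 0) := by
  have h := isSpherePair_z (q := q)
  rw [bElt, ← mul_assoc, h.zz, smul_mul_assoc, mul_assoc, h.zzs 0 1 (by decide), mul_smul_comm,
    smul_smul, ← mul_assoc, ← sq]

theorem b_mul_z0 (hq : q ≠ 0) : bElt q * z 0 = ((q : ℂ) ^ 2)⁻¹ • (z 0 * bElt q) := by
  rw [z0_mul_b, smul_smul, inv_mul_cancel₀, one_smul]
  exact pow_ne_zero _ (by exact_mod_cast hq)

theorem star_z0_mul_z0 : star (z 0) * z 0 = 1 - ((q : ℂ) ^ 2)⁻¹ • bElt q := by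
  have h := isSpherePair_z (q := q)
  have h1 := h.normal_zero
  have h2 := h.sphere
  rw [h1] at h2
  have h3 : ((q : ℂ) ^ (-2 : ℤ)) = ((q : ℂ) ^ 2)⁻¹ := by
    rw [zpow_neg]; norm_cast
  rw [← h2, h3, bElt, sub_smul, one_smul]
  abel

open Polynomial in
theorem exists_poly (hq : q ≠ 0) (n : ℕ) : ∃ P : ℂ[X], IsCoprime P X ∧
    star (z 0) ^ n * z 0 ^ n = aeval (bElt q) P := by
  have hb : ∀ n, ∃ c : ℂ, bElt q * z 0 ^ n = c • (z 0 ^ n * bElt q) := by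
    intro n
    induction n with
    | zero => exact ⟨1, by simp⟩
    | succ n ih =>
      obtain ⟨c, hc⟩ := ih
      refine ⟨c * ((q : ℂ) ^ 2)⁻¹, ?_⟩
      rw [pow_succ, ← mul_assoc, hc, smul_mul_assoc, mul_assoc, b_mul_z0 hq, mul_smul_comm,
        smul_smul, mul_assoc]
  induction n with
  | zero => exact ⟨1, isCoprime_one_left, by simp⟩
  | succ n ih =>
    obtain ⟨P, hP, h⟩ := ih
    obtain ⟨c, hc⟩ := hb n
    refine ⟨P * (1 - C (((q : ℂ) ^ 2)⁻¹ * c) * X), hP.mul_left ?_, ?_⟩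
    · exact ⟨1, C (((q : ℂ) ^ 2)⁻¹ * c), by ring⟩
    · have e : star (z 0) ^ (n + 1) * z 0 ^ (n + 1) =
          star (z 0) ^ n * (star (z 0) * z 0) * (z 0 ^ n : SphereAlg q) := by
        rw [pow_succ, pow_succ']; noncomm_ring
      rw [e, star_z0_mul_z0, mul_sub, sub_mul, mul_one, h, mul_smul_comm, smul_mul_assoc, mul_assoc,
        hc, mul_smul_comm, ← mul_assoc, h, smul_smul, map_mul, map_sub, map_one, map_mul, aeval_C,
        aeval_X, mul_sub, mul_one, Algebra.algebraMap_eq_smul_one, smul_mul_assoc, one_mul,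
        mul_smul_comm]

open Polynomial in
/-- Every element of weight `-kl` lies in `𝒜₍₁₎(k,l)`. -/
theorem mem_lineMod_of_hasWeight (hq : q ≠ 0) {x : SphereAlg q}
    (hx : HasWeight q k l (-(k * l)) x) : x ∈ lineMod q k l := by
  obtain ⟨P, hP, h⟩ := exists_poly hq l
  obtain ⟨U, V, hUV⟩ := (hP.pow_right (n := k))
  have h0 : HasWeight q k l 0 (bElt q) := by
    have := (hasWeight_z1 (q := q) (k := k) (l := l)).mul hasWeight_z1.star
    rwa [add_neg_cancel] at this
  have hp : ∀ R : ℂ[X], HasWeight q k l 0 (aeval (bElt q) R) := by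
    intro R
    rw [hasWeight_zero_iff] at h0 ⊢
    rw [aeval_eq_sum_range]
    exact sum_mem fun i _ => SMulMemClass.smul_mem _ (pow_mem h0 i)
  have hbk : bElt q ^ k = star (z 1) ^ k * z 1 ^ k := by
    have hn := (isSpherePair_z (q := q)).normal_one
    rw [bElt, hn, Commute.mul_pow]
    exact hn.symm
  have key : star (z 0) ^ l * (z 0 ^ l * aeval (bElt q) U) +
      star (z 1) ^ k * (z 1 ^ k * aeval (bElt q) V) = 1 := by
    have := congrArg (fun R : ℂ[X] => aeval (bElt q) R) hUV
    simp only [mul_comm U, mul_comm V, map_add, map_mul, map_pow, aeval_X, map_one] at this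
    rw [← mul_assoc, ← mul_assoc, h, ← hbk, this]
  refine ⟨z 1 ^ k * aeval (bElt q) V * x, ?_, z 0 ^ l * aeval (bElt q) U * x, ?_, ?_⟩
  · rw [← hasWeight_zero_iff]
    convert (hasWeight_z1k.mul (hp V)).mul hx using 1; ring
  · rw [← hasWeight_zero_iff]
    convert (hasWeight_z0l.mul (hp U)).mul hx using 1; ring
  · rw [← mul_assoc (star (z 1) ^ k), ← mul_assoc (star (z 0) ^ l), ← add_mul, add_comm, key,
      one_mul]

end weights

/-! #### The closure of `𝒜₍₁₎(k,l)` -/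

/-- The closure `E` of `𝒜₍₁₎(k,l)` in `C(S_q³)`. -/
def lineC (q : ℝ) (k l : ℕ) : Submodule ℂ (CSphere q) :=
  ((lineMod q k l).map (ofSphere q : SphereAlg q →ₗ[ℂ] CSphere q)).topologicalClosure

section closure
variable {q : ℝ} {k l : ℕ}

theorem lineC_coe : (lineC q k l : Set (CSphere q)) =
    closure (ofSphere q '' (lineMod q k l : Set (SphereAlg q))) := rfl

theorem projC_coe : (projC q k l : Set (CSphere q)) =
    closure (ofSphere q '' (projAlg q k l : Set (SphereAlg q))) := rfl

theorem lineC_mul_projC {ξ b : CSphere q} (hξ : ξ ∈ lineC q k l) (hb : b ∈ projC q k l) :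
    ξ * b ∈ lineC q k l := by
  rw [← SetLike.mem_coe, lineC_coe] at hξ ⊢
  rw [← SetLike.mem_coe, projC_coe] at hb
  refine map_mem_closure₂ (f := fun a b => a * b) continuous_mul hξ hb ?_
  rintro _ ⟨x, hx, rfl⟩ _ ⟨y, hy, rfl⟩
  refine ⟨x * y, ?_, map_mul _ _ _⟩
  obtain ⟨a, ha, b, hb, rfl⟩ := hx
  exact ⟨a * y, mul_mem ha hy, b * y, mul_mem hb hy, by rw [add_mul, mul_assoc, mul_assoc]⟩

theorem star_lineC_mul_lineC {ξ η : CSphere q} (hξ : ξ ∈ lineC q k l) (hη : η ∈ lineC q k l) :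
    star ξ * η ∈ projC q k l := by
  rw [← SetLike.mem_coe, lineC_coe] at hξ hη
  rw [← SetLike.mem_coe, projC_coe]
  refine map_mem_closure₂ (f := fun a b => star a * b)
    (continuous_star.fst'.mul continuous_snd) hξ hη ?_
  rintro _ ⟨x, hx, rfl⟩ _ ⟨y, hy, rfl⟩
  refine ⟨star x * y, ?_, by rw [map_mul, map_star]⟩
  rw [SetLike.mem_coe, ← hasWeight_zero_iff]
  convert (hasWeight_of_mem hx).star.mul (hasWeight_of_mem hy) using 1; ring

theorem projC_mul_lineC (hq : 0 < q) {b ξ : CSphere q} (hb : b ∈ projC q k l)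
    (hξ : ξ ∈ lineC q k l) : b * ξ ∈ lineC q k l := by
  rw [← SetLike.mem_coe, lineC_coe] at hξ ⊢
  rw [← SetLike.mem_coe, projC_coe] at hb
  refine map_mem_closure₂ (f := fun a b => a * b) continuous_mul hb hξ ?_
  rintro _ ⟨x, hx, rfl⟩ _ ⟨y, hy, rfl⟩
  refine ⟨x * y, ?_, map_mul _ _ _⟩
  refine mem_lineMod_of_hasWeight hq.ne' ?_
  convert (hasWeight_zero_iff.2 hx).mul (hasWeight_of_mem hy) using 1; ring

end closure

end QuantumLens
/-! ### Hilbert C*-modules -/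

namespace QuantumLens

/-- Positivity in a C*-algebra. -/
def IsPos {B : Type} [CStarAlgebra B] (b : B) : Prop := ∃ c : B, b = star c * c

section Pos
variable {B : Type} [CStarAlgebra B]

theorem isPos_iff (b : B) :
    IsPos b ↔ (letI := CStarAlgebra.spectralOrder B; 0 ≤ b) := by
  let _ := CStarAlgebra.spectralOrder B
  have := CStarAlgebra.spectralOrderedRing B
  exact CStarAlgebra.nonneg_iff_eq_star_mul_self.symm

theorem IsPos.add {a b : B} (ha : IsPos a) (hb : IsPos b) : IsPos (a + b) := by
  rw [isPos_iff] at *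
  let _ := CStarAlgebra.spectralOrder B
  have := CStarAlgebra.spectralOrderedRing B
  exact add_nonneg ha hb

theorem IsPos.smul {a : B} (ha : IsPos a) {r : ℝ} (hr : 0 ≤ r) : IsPos (r • a) := by
  obtain ⟨c, rfl⟩ := ha
  refine ⟨(√r) • c, ?_⟩
  rw [star_smul, star_trivial (√r), smul_mul_smul_comm, Real.mul_self_sqrt hr]

theorem IsPos.conj {a : B} (ha : IsPos a) (b : B) : IsPos (star b * a * b) := by
  obtain ⟨c, rfl⟩ := ha
  exact ⟨c * b, by rw [star_mul]; simp only [mul_assoc]⟩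

theorem isPos_zero : IsPos (0 : B) := ⟨0, by simp⟩

theorem isPos_sum {ι : Type*} (s : Finset ι) (f : ι → B) (h : ∀ i ∈ s, IsPos (f i)) :
    IsPos (∑ i ∈ s, f i) := by
  classical
  induction s using Finset.induction_on with
  | empty => simpa using isPos_zero
  | insert i s hi ih =>
    rw [Finset.sum_insert hi]
    exact (h i (Finset.mem_insert_self _ _)).add (ih fun j hj => h j (Finset.mem_insert_of_mem hj))

theorem isClosed_isPos : IsClosed {b : B | IsPos b} := by
  simp only [isPos_iff]
  let _ := CStarAlgebra.spectralOrder B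
  have := CStarAlgebra.spectralOrderedRing B
  exact CStarAlgebra.isClosed_nonneg

theorem norm_le_of_isPos {a b : B} (ha : IsPos a) (hab : IsPos (b - a)) : ‖a‖ ≤ ‖b‖ := by
  rw [isPos_iff] at *
  let _ := CStarAlgebra.spectralOrder B
  have := CStarAlgebra.spectralOrderedRing B
  exact CStarAlgebra.norm_le_norm_of_nonneg_of_le ha (sub_nonneg.1 hab)

theorem isPos_antisymm {a : B} (ha : IsPos a) (ha' : IsPos (-a)) : a = 0 := by
  rw [isPos_iff] at *
  let _ := CStarAlgebra.spectralOrder B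
  have := CStarAlgebra.spectralOrderedRing B
  exact le_antisymm (neg_nonneg.1 ha') ha

theorem isPos_norm_sq_sub (b : B) : IsPos ((‖b‖ ^ 2) • (1 : B) - star b * b) := by
  rw [isPos_iff]
  let _ := CStarAlgebra.spectralOrder B
  have := CStarAlgebra.spectralOrderedRing B
  have h := CStarAlgebra.star_mul_le_algebraMap_norm_sq (a := b)
  rw [Algebra.algebraMap_eq_smul_one] at h
  exact sub_nonneg.2 h

/-- A criterion for positivity of a self-adjoint element. -/
theorem isPos_of_conj {m : B} (hm : star m = m)
    (h : ∀ c e : B, star c = c → c * m * c = -(star e * e) → e = 0) : IsPos m := by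
  have h' := isPos_iff m
  let _ := CStarAlgebra.spectralOrder B
  have := CStarAlgebra.spectralOrderedRing B
  rw [h', ← CFC.negPart_eq_zero_iff m hm]
  have hs : star (m⁻) = m⁻ := IsSelfAdjoint.of_nonneg (CFC.negPart_nonneg m)
  have e : m⁻ * m * m⁻ = -(m⁻ * m⁻ * m⁻) := by
    have h2 : m⁻ * m = m⁻ * (m⁺ - m⁻) := by rw [CFC.posPart_sub_negPart m hm]
    rw [h2, mul_sub, CFC.negPart_mul_posPart, zero_sub, neg_mul]
  have h2 : IsPos (m⁻ * m⁻ * m⁻) := by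
    have h3 := ((isPos_iff (m⁻)).2 (CFC.negPart_nonneg m)).conj (m⁻)
    rwa [hs] at h3
  obtain ⟨f, hf⟩ := h2
  have hf0 := h _ f hs (by rw [e, hf])
  have h4 : m⁻ * m⁻ * m⁻ = 0 := by rw [hf, hf0, mul_zero]
  have h5 : star (m⁻ * m⁻) * (m⁻ * m⁻) = 0 := by
    rw [star_mul, hs, ← mul_assoc, h4, zero_mul]
  rw [CStarRing.star_mul_self_eq_zero_iff] at h5
  nth_rewrite 1 [← hs] at h5
  rwa [CStarRing.star_mul_self_eq_zero_iff] at h5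

end Pos

/-- A right module `V` with a (possibly degenerate) `B`-valued inner product, linear in the second
variable. -/
structure PreHilbert (B V : Type) [CStarAlgebra B] [AddCommGroup V] [Module ℂ V] where
  /-- the inner product -/
  inn : V → V → B
  /-- the right action of `B` -/
  ract : Bᵐᵒᵖ →ₐ[ℂ] Module.End ℂ V
  inn_add_right : ∀ x y z, inn x (y + z) = inn x y + inn x z
  inn_smul_right : ∀ (c : ℂ) (x y), inn x (c • y) = c • inn x y
  inn_ract : ∀ (b : B) (x y), inn x (ract (op b) y) = inn x y * b
  star_inn : ∀ x y, star (inn x y) = inn y x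
  inn_pos : ∀ x, IsPos (inn x x)

namespace PreHilbert

variable {B V : Type} [CStarAlgebra B] [AddCommGroup V] [Module ℂ V] (P : PreHilbert B V)

theorem inn_add_left (x y z : V) : P.inn (x + y) z = P.inn x z + P.inn y z := by
  rw [← P.star_inn, P.inn_add_right, star_add, P.star_inn, P.star_inn]

theorem inn_smul_left (c : ℂ) (x y : V) : P.inn (c • x) y = (starRingEnd ℂ c) • P.inn x y := by
  rw [← P.star_inn, P.inn_smul_right, star_smul, P.star_inn]; rfl

theorem inn_ract_left (b : B) (x y : V) : P.inn (P.ract (op b) x) y = star b * P.inn x y := by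
  rw [← P.star_inn, P.inn_ract, star_mul, P.star_inn]

/-- The inner product as a sesquilinear map. -/
def innL : V →ₗ⋆[ℂ] V →ₗ[ℂ] B :=
  LinearMap.mk₂'ₛₗ (starRingEnd ℂ) (RingHom.id ℂ) P.inn P.inn_add_left P.inn_smul_left
    P.inn_add_right P.inn_smul_right

theorem innL_apply (x y : V) : P.innL x y = P.inn x y := rfl

theorem inn_zero_right (x : V) : P.inn x 0 = 0 := map_zero (P.innL x)
theorem inn_sub_right (x y z : V) : P.inn x (y - z) = P.inn x y - P.inn x z :=
  map_sub (P.innL x) y z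
theorem inn_sub_left (x y z : V) : P.inn (x - y) z = P.inn x z - P.inn y z := by
  rw [← innL_apply, map_sub]; rfl
theorem inn_sum_right {ι : Type*} (s : Finset ι) (x : V) (f : ι → V) :
    P.inn x (∑ i ∈ s, f i) = ∑ i ∈ s, P.inn x (f i) := map_sum (P.innL x) f s
theorem inn_sum_left {ι : Type*} (s : Finset ι) (x : V) (f : ι → V) :
    P.inn (∑ i ∈ s, f i) x = ∑ i ∈ s, P.inn (f i) x := by
  rw [← innL_apply, map_sum, LinearMap.sum_apply]; rfl

theorem inn_smul_real_left (r : ℝ) (x y : V) : P.inn ((r : ℂ) • x) y = r • P.inn x y := by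
  rw [P.inn_smul_left, Complex.conj_ofReal]; rfl
theorem inn_smul_real_right (r : ℝ) (x y : V) : P.inn x ((r : ℂ) • y) = r • P.inn x y := by
  rw [P.inn_smul_right]; rfl

/-- The Cauchy-Schwarz inequality. -/
theorem norm_inn_sq_le (x y : V) : ‖P.inn x y‖ ^ 2 ≤ ‖P.inn x x‖ * ‖P.inn y y‖ := by
  set a := P.inn x y with ha
  have hstar : P.inn y x = star a := (P.star_inn x y).symm
  have key : ∀ t : ℝ, ‖P.inn x x‖ < t → ‖a‖ ^ 2 ≤ t * ‖P.inn y y‖ := by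
    intro t ht
    have ht0 : 0 < t := (norm_nonneg _).trans_lt ht
    obtain ⟨s, hs⟩ := P.inn_pos x
    have e1 : IsPos ((‖P.inn x x‖) • (star a * a) - star a * P.inn x x * a) := by
      have h := (isPos_norm_sq_sub s).conj a
      have h2 : ‖P.inn x x‖ = ‖s‖ ^ 2 := by rw [hs, CStarRing.norm_star_mul_self, sq]
      rw [← hs, ← h2, mul_sub, sub_mul, mul_smul_comm, mul_one, smul_mul_assoc] at h
      exact h
    have e2 := P.inn_pos (P.ract (op a) x - (t : ℂ) • y)
    have e3 : P.inn (P.ract (op a) x - (t : ℂ) • y) (P.ract (op a) x - (t : ℂ) • y) =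
        star a * P.inn x x * a - (2 * t) • (star a * a) + (t ^ 2) • P.inn y y := by
      rw [P.inn_sub_left, P.inn_sub_right, P.inn_sub_right, P.inn_ract, P.inn_ract_left,
        P.inn_smul_real_right, P.inn_smul_real_left, P.inn_ract_left, ← ha,
        P.inn_ract, P.inn_smul_real_left, P.inn_smul_real_right, hstar, two_mul, add_smul, smul_smul, sq]
      abel
    rw [e3] at e2
    have e4 : IsPos ((t ^ 2) • P.inn y y - t • (star a * a)) := by
      have h1 : IsPos ((t - ‖P.inn x x‖) • (star a * a)) :=
        IsPos.smul ⟨a, rfl⟩ (sub_nonneg.2 ht.le)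
      have h2 := (e1.add e2).add h1
      convert h2 using 1
      rw [sub_smul, two_mul, add_smul]
      abel
    have e5 := norm_le_of_isPos (IsPos.smul ⟨a, rfl⟩ ht0.le) e4
    rw [norm_smul, norm_smul, CStarRing.norm_star_mul_self, Real.norm_of_nonneg ht0.le,
      Real.norm_of_nonneg (sq_nonneg t)] at e5
    have e6 : t * ‖a‖ ^ 2 ≤ t * (t * ‖P.inn y y‖) := by
      calc t * ‖a‖ ^ 2 = t * (‖a‖ * ‖a‖) := by ring
        _ ≤ _ := e5
        _ = _ := by ring
    exact le_of_mul_le_mul_left e6 ht0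
  refine le_of_forall_gt_imp_ge_of_dense ?_
  intro c hc
  rcases (norm_nonneg (P.inn y y)).eq_or_lt with h0 | h0
  · have := key (‖P.inn x x‖ + 1) (by linarith)
    rw [← h0, mul_zero] at this
    rw [← h0, mul_zero] at hc
    exact this.trans hc.le
  · have := key (c / ‖P.inn y y‖) (by rwa [lt_div_iff₀ h0])
    rwa [div_mul_cancel₀ _ h0.ne'] at this

/-- The seminorm `‖x‖ = ‖⟨x, x⟩‖ ^ (1/2)`. -/
def nrm (x : V) : ℝ := √‖P.inn x x‖

theorem nrm_sq (x : V) : P.nrm x ^ 2 = ‖P.inn x x‖ := Real.sq_sqrt (norm_nonneg _)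

theorem nrm_nonneg (x : V) : 0 ≤ P.nrm x := Real.sqrt_nonneg _

theorem norm_inn_le (x y : V) : ‖P.inn x y‖ ≤ P.nrm x * P.nrm y := by
  refine abs_le_of_sq_le_sq' ?_ (mul_nonneg (P.nrm_nonneg x) (P.nrm_nonneg y)) |>.2
  rw [mul_pow, nrm_sq, nrm_sq]
  exact P.norm_inn_sq_le x y

theorem nrm_smul (c : ℂ) (x : V) : P.nrm (c • x) = ‖c‖ * P.nrm x := by
  have h : P.inn (c • x) (c • x) = ((‖c‖ ^ 2 : ℝ) : ℂ) • P.inn x x := by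
    rw [P.inn_smul_left, P.inn_smul_right, smul_smul, RCLike.conj_mul]
    norm_cast
  rw [nrm, h, norm_smul, Complex.norm_real, Real.norm_of_nonneg (sq_nonneg _),
    Real.sqrt_mul (sq_nonneg _), Real.sqrt_sq (norm_nonneg _), nrm]

theorem nrm_add_le (x y : V) : P.nrm (x + y) ≤ P.nrm x + P.nrm y := by
  refine abs_le_of_sq_le_sq' ?_ (add_nonneg (P.nrm_nonneg x) (P.nrm_nonneg y)) |>.2
  rw [nrm_sq, P.inn_add_left, P.inn_add_right, P.inn_add_right]
  have h1 := P.norm_inn_le x y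
  have h2 := P.norm_inn_le y x
  have h3 := P.nrm_sq x
  have h4 := P.nrm_sq y
  calc _ ≤ ‖P.inn x x‖ + ‖P.inn x y‖ + (‖P.inn y x‖ + ‖P.inn y y‖) :=
        (norm_add_le _ _).trans (add_le_add (norm_add_le _ _) (norm_add_le _ _))
    _ ≤ _ := by rw [← h3, ← h4]; nlinarith

theorem norm_innL_le (x y : V) : ‖P.innL x y‖ ≤ P.nrm x * P.nrm y := P.norm_inn_le x y

/-- The space `V` with the seminorm of the inner product. -/
def Pre (_ : PreHilbert B V) : Type := V

instance : AddCommGroup P.Pre := inferInstanceAs (AddCommGroup V)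
instance : Module ℂ P.Pre := inferInstanceAs (Module ℂ V)
instance : Norm P.Pre := ⟨P.nrm⟩

theorem pre_core : SeminormedSpace.Core ℂ P.Pre where
  norm_nonneg := P.nrm_nonneg
  norm_smul := P.nrm_smul
  norm_triangle := P.nrm_add_le

instance : SeminormedAddCommGroup P.Pre := SeminormedAddCommGroup.ofCore P.pre_core
instance : NormedSpace ℂ P.Pre where
  norm_smul_le c x := (P.pre_core.norm_smul c x).le

theorem norm_pre (x : P.Pre) : ‖x‖ = P.nrm x := rfl

end PreHilbert

/-- A (right) Hilbert C*-module `E` over a unital C*-algebra `B`, with inner product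
`⟨·,·⟩ = inn B · ·` that is linear in the second variable. The right action is that of
`MulOpposite`. -/
class HilbertModule (B E : Type) [CStarAlgebra B] [NormedAddCommGroup E] [NormedSpace ℂ E]
    [Module Bᵐᵒᵖ E] extends CompleteSpace E where
  /-- the inner product -/
  inn : E → E → B
  inn_add_right : ∀ x y z : E, inn x (y + z) = inn x y + inn x z
  inn_smul_right : ∀ (c : ℂ) (x y : E), inn x (c • y) = c • inn x y
  inn_op_smul_right : ∀ (b : B) (x y : E), inn x (op b • y) = inn x y * b
  star_inn : ∀ x y : E, star (inn x y) = inn y x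
  inn_pos : ∀ x : E, IsPos (inn x x)
  norm_sq_eq : ∀ x : E, ‖x‖ ^ 2 = ‖inn x x‖

section HilbertModule

open HilbertModule

variable {B E : Type} [CStarAlgebra B] [NormedAddCommGroup E] [NormedSpace ℂ E]
    [Module Bᵐᵒᵖ E] [HilbertModule B E]

theorem HilbertModule.inn_sub_right' (x y z : E) : inn (B := B) x (y - z) = inn x y - inn x z := by
  have := inn_add_right (B := B) x (y - z) z
  rw [sub_add_cancel] at this
  rw [this, add_sub_cancel_right]

variable (B) in
theorem HilbertModule.ext_inn {x y : E} (h : ∀ z : E, inn (B := B) z x = inn z y) : x = y := by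
  have h1 : inn (B := B) (x - y) (x - y) = 0 := by rw [inn_sub_right', h, sub_self]
  have h2 := norm_sq_eq (B := B) (x - y)
  rw [h1, norm_zero] at h2
  exact sub_eq_zero.1 (norm_eq_zero.1 (pow_eq_zero_iff two_ne_zero |>.1 h2))

variable (B E) in
/-- The inner product data underlying a Hilbert module. -/
def HilbertModule.pre : PreHilbert B E where
  inn := inn
  ract :=
    { toFun := fun b =>
        { toFun := fun x => b • x
          map_add' := smul_add b
          map_smul' := fun c x => ext_inn B fun z => by
            rw [RingHom.id_apply, ← op_unop b, inn_op_smul_right, inn_smul_right, inn_smul_right,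
              inn_op_smul_right, smul_mul_assoc] }
      map_one' := LinearMap.ext fun x => one_smul _ x
      map_mul' := fun a b => LinearMap.ext fun x => mul_smul a b x
      map_zero' := LinearMap.ext fun x => zero_smul _ x
      map_add' := fun a b => LinearMap.ext fun x => add_smul a b x
      commutes' := fun c => LinearMap.ext fun x => ext_inn B fun z => by
        change inn z (op (algebraMap ℂ B c) • x) = inn z (c • x)
        rw [inn_op_smul_right, inn_smul_right, ← Algebra.commutes, Algebra.smul_def] }
  inn_add_right := inn_add_right
  inn_smul_right := inn_smul_right
  inn_ract := inn_op_smul_right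
  star_inn := star_inn
  inn_pos := inn_pos

theorem HilbertModule.nrm_pre (x : E) : (pre B E).nrm x = ‖x‖ := by
  change √‖inn (B := B) x x‖ = ‖x‖
  rw [← norm_sq_eq (B := B), Real.sqrt_sq (norm_nonneg x)]

theorem HilbertModule.norm_inn_le (x y : E) : ‖inn (B := B) x y‖ ≤ ‖x‖ * ‖y‖ := by
  have := (pre B E).norm_inn_le x y
  rwa [nrm_pre, nrm_pre] at this

variable (B E) in
/-- The inner product as a continuous sesquilinear map. -/
def HilbertModule.innCLM : E →L⋆[ℂ] E →L[ℂ] B :=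
  (pre B E).innL.mkContinuous₂ 1 fun x y => by rw [one_mul]; exact norm_inn_le x y

theorem HilbertModule.continuous_inn {X : Type*} [TopologicalSpace X] {f g : X → E}
    (hf : Continuous f) (hg : Continuous g) : Continuous fun x => inn (B := B) (f x) (g x) :=
  ((innCLM B E).continuous.comp hf).clm_apply hg

theorem HilbertModule.norm_op_smul_le (b : B) (x : E) : ‖op b • x‖ ≤ ‖b‖ * ‖x‖ := by
  refine abs_le_of_sq_le_sq' ?_ (mul_nonneg (norm_nonneg b) (norm_nonneg x)) |>.2
  rw [mul_pow, norm_sq_eq (B := B) x, norm_sq_eq (B := B) (op b • x)]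
  have : inn (B := B) (op b • x) (op b • x) = star b * inn x x * b := by
    rw [inn_op_smul_right]; exact congrArg (· * b) ((pre B E).inn_ract_left b x x)
  rw [this]
  calc ‖star b * inn x x * b‖ ≤ ‖star b‖ * ‖inn (B := B) x x‖ * ‖b‖ :=
        (norm_mul_le _ _).trans (mul_le_mul_of_nonneg_right (norm_mul_le _ _) (norm_nonneg _))
    _ = _ := by rw [norm_star]; ring

end HilbertModule

/-! #### Completion of pre-Hilbert modules -/

namespace PreHilbert

open UniformSpace

variable {B V : Type} [CStarAlgebra B] [AddCommGroup V] [Module ℂ V] (P : PreHilbert B V)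

/-- The (separated) completion of a pre-Hilbert module. -/
def Compl : Type := Completion P.Pre

instance : NormedAddCommGroup P.Compl := inferInstanceAs (NormedAddCommGroup (Completion P.Pre))
instance : NormedSpace ℂ P.Compl := inferInstanceAs (NormedSpace ℂ (Completion P.Pre))
instance : CompleteSpace P.Compl := inferInstanceAs (CompleteSpace (Completion P.Pre))

/-- The identity, from `V` to `V` with its seminorm. -/
def toPre : V ≃ₗ[ℂ] P.Pre := LinearEquiv.refl ℂ V

theorem norm_toPre (x : V) : ‖P.toPre x‖ = P.nrm x := rfl

/-- The canonical map to the completion. -/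
def of : V →ₗ[ℂ] P.Compl := (Completion.toComplL (𝕜 := ℂ) (E := P.Pre)).toLinearMap ∘ₗ P.toPre

theorem norm_of (x : V) : ‖P.of x‖ = P.nrm x := Completion.norm_coe (P.toPre x)

theorem denseRange_of : DenseRange P.of := Completion.denseRange_coe (α := P.Pre)

theorem induction_on {p : P.Compl → Prop} (x : P.Compl) (hp : IsClosed {x | p x})
    (h : ∀ a, p (P.of a)) : p x := P.denseRange_of.induction_on x hp h

theorem induction_on₂ {p : P.Compl → P.Compl → Prop} (x y : P.Compl)
    (hp : IsClosed {x : P.Compl × P.Compl | p x.1 x.2})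
    (h : ∀ a b, p (P.of a) (P.of b)) : p x y := P.denseRange_of.induction_on₂ hp h x y

/-- Extension of bounded (semi)linear maps to the completion. -/
def ext {σ : ℂ →+* ℂ} {F : Type*} [NormedAddCommGroup F] [NormedSpace ℂ F] [CompleteSpace F]
    [RingHomIsometric σ] (f : V →ₛₗ[σ] F) (C : ℝ) (hf : ∀ x, ‖f x‖ ≤ C * P.nrm x) :
    P.Compl →SL[σ] F :=
  ((f.comp P.toPre.symm.toLinearMap).mkContinuous C hf).fromCompletion

@[simp] theorem ext_of {σ : ℂ →+* ℂ} {F : Type*} [NormedAddCommGroup F] [NormedSpace ℂ F]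
    [CompleteSpace F] [RingHomIsometric σ] (f : V →ₛₗ[σ] F) (C : ℝ)
    (hf : ∀ x, ‖f x‖ ≤ C * P.nrm x) (x : V) : P.ext f C hf (P.of x) = f x :=
  ContinuousLinearMap.fromCompletion_apply_coe _ (P.toPre x)

theorem norm_ext_le {σ : ℂ →+* ℂ} {F : Type*} [NormedAddCommGroup F] [NormedSpace ℂ F]
    [CompleteSpace F] [RingHomIsometric σ] (f : V →ₛₗ[σ] F) (C : ℝ) 
    (hf : ∀ x, ‖f x‖ ≤ C * P.nrm x) (x : P.Compl) : ‖P.ext f C hf x‖ ≤ C * ‖x‖ := by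
  refine P.induction_on (p := fun x => ‖P.ext f C hf x‖ ≤ C * ‖x‖) x
    (isClosed_le ((P.ext f C hf).continuous.norm) (continuous_const.mul continuous_norm)) ?_
  intro a
  rw [ext_of, norm_of]
  exact hf a

/-- The map `y ↦ ⟨x, y⟩` on the completion, for `x` in `V`. -/
def innRight : V →ₗ⋆[ℂ] P.Compl →L[ℂ] B where
  toFun x := P.ext (P.innL x) (P.nrm x) (P.norm_innL_le x)
  map_add' x y := by
    ext z
    refine P.induction_on (p := fun z => P.ext (P.innL (x + y)) _ (P.norm_innL_le (x + y)) z =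
      (P.ext (P.innL x) _ (P.norm_innL_le x) + P.ext (P.innL y) _ (P.norm_innL_le y)) z) z
      (isClosed_eq (ContinuousLinearMap.continuous _) (ContinuousLinearMap.continuous _)) ?_
    intro a
    rw [add_apply, ext_of, ext_of, ext_of, map_add, LinearMap.add_apply]
  map_smul' c x := by
    ext z
    refine P.induction_on (p := fun z => P.ext (P.innL (c • x)) _ (P.norm_innL_le (c • x)) z =
      ((starRingEnd ℂ c) • P.ext (P.innL x) _ (P.norm_innL_le x)) z) z
      (isClosed_eq (ContinuousLinearMap.continuous _) (ContinuousLinearMap.continuous _)) ?_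
    intro a
    rw [smul_apply, ext_of, ext_of, map_smulₛₗ, LinearMap.smul_apply]

/-- The inner product of the completion. -/
def complInn : P.Compl →L⋆[ℂ] P.Compl →L[ℂ] B :=
  P.ext P.innRight 1 fun x => by
    rw [one_mul]
    exact ContinuousLinearMap.opNorm_le_bound _ (P.nrm_nonneg x) (P.norm_ext_le _ _ _)

theorem complInn_of (x y : V) : P.complInn (P.of x) (P.of y) = P.inn x y := by
  rw [complInn, ext_of]
  exact P.ext_of _ _ _ _

theorem nrm_ract_le (b : B) (x : V) : P.nrm (P.ract (op b) x) ≤ ‖b‖ * P.nrm x := by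
  refine abs_le_of_sq_le_sq' ?_ (mul_nonneg (norm_nonneg b) (P.nrm_nonneg x)) |>.2
  rw [mul_pow, nrm_sq, nrm_sq, P.inn_ract, P.inn_ract_left]
  calc ‖star b * P.inn x x * b‖ ≤ ‖star b‖ * ‖P.inn x x‖ * ‖b‖ :=
        (norm_mul_le _ _).trans (mul_le_mul_of_nonneg_right (norm_mul_le _ _) (norm_nonneg _))
    _ = _ := by rw [norm_star]; ring

/-- The right action on the completion. -/
def complRact (b : Bᵐᵒᵖ) : P.Compl →L[ℂ] P.Compl :=
  P.ext (P.of ∘ₗ P.ract b) ‖unop b‖ fun x => by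
    rw [LinearMap.comp_apply, norm_of]; exact P.nrm_ract_le (unop b) x

@[simp] theorem complRact_of (b : Bᵐᵒᵖ) (x : V) : P.complRact b (P.of x) = P.of (P.ract b x) :=
  P.ext_of _ _ _ _

theorem complRact_eq {f g : P.Compl →L[ℂ] P.Compl} (h : ∀ x, f (P.of x) = g (P.of x)) : f = g :=
  ContinuousLinearMap.ext fun z => P.induction_on (p := fun z => f z = g z) z
    (isClosed_eq f.continuous g.continuous) h

instance : Module Bᵐᵒᵖ P.Compl where
  smul b x := P.complRact b x
  one_smul x := congrArg (fun f : P.Compl →L[ℂ] P.Compl => f x)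
    (P.complRact_eq (f := P.complRact 1) (g := ContinuousLinearMap.id ℂ _) fun x => by simp)
  mul_smul a b x := congrArg (fun f : P.Compl →L[ℂ] P.Compl => f x)
    (P.complRact_eq (f := P.complRact (a * b)) (g := P.complRact a ∘L P.complRact b)
      fun x => by simp)
  smul_zero b := map_zero (P.complRact b)
  smul_add b := map_add (P.complRact b)
  add_smul a b x := congrArg (fun f : P.Compl →L[ℂ] P.Compl => f x)
    (P.complRact_eq (f := P.complRact (a + b)) (g := P.complRact a + P.complRact b)
      fun x => by simp)
  zero_smul x := congrArg (fun f : P.Compl →L[ℂ] P.Compl => f x)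
    (P.complRact_eq (f := P.complRact 0) (g := 0) fun x => by simp)

theorem op_smul_of (b : Bᵐᵒᵖ) (x : V) : b • P.of x = P.of (P.ract b x) := P.complRact_of b x

instance : HilbertModule B P.Compl where
  inn x y := P.complInn x y
  inn_add_right x y z := map_add _ y z
  inn_smul_right c x y := map_smul _ c y
  inn_op_smul_right b x y := by
    refine P.induction_on₂ (p := fun x y => P.complInn x (P.complRact (op b) y) =
      P.complInn x y * b) x y (isClosed_eq ?_ ?_) ?_
    · exact (P.complInn.continuous.comp continuous_fst).clm_apply
        ((P.complRact (op b)).continuous.comp continuous_snd)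
    · exact ((P.complInn.continuous.comp continuous_fst).clm_apply continuous_snd).mul
        continuous_const
    · intro u v
      rw [complRact_of, complInn_of, complInn_of, P.inn_ract]
  star_inn x y := by
    refine P.induction_on₂ (p := fun x y => star (P.complInn x y) = P.complInn y x) x y
      (isClosed_eq ?_ ?_) ?_
    · exact ((P.complInn.continuous.comp continuous_fst).clm_apply continuous_snd).star
    · exact (P.complInn.continuous.comp continuous_snd).clm_apply continuous_fst
    · intro u v
      rw [complInn_of, complInn_of, P.star_inn]
  inn_pos x := by
    refine P.induction_on (p := fun x => IsPos (P.complInn x x)) x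
      (isClosed_isPos.preimage (P.complInn.continuous.clm_apply continuous_id)) ?_
    intro u
    rw [complInn_of]; exact P.inn_pos u
  norm_sq_eq x := by
    refine P.induction_on (p := fun x => ‖x‖ ^ 2 = ‖P.complInn x x‖) x
      (isClosed_eq (continuous_norm.pow 2)
        (P.complInn.continuous.clm_apply continuous_id).norm) ?_
    intro u
    rw [complInn_of, norm_of, nrm_sq]

theorem inn_of (x y : V) : HilbertModule.inn (P.of x) (P.of y) = P.inn x y := P.complInn_of x y

end PreHilbert

end QuantumLens
/-! ### Adjointable operators -/

namespace QuantumLens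

open HilbertModule (inn)

section Adj

variable (B E : Type) [CStarAlgebra B] [NormedAddCommGroup E] [NormedSpace ℂ E]
    [Module Bᵐᵒᵖ E] [HilbertModule B E]

/-- The algebra `ℒ(E)` of bounded adjointable operators on a Hilbert module. -/
def Adjointable : Subalgebra ℂ (E →L[ℂ] E) where
  carrier := {T | ∃ T' : E →L[ℂ] E, ∀ x y, inn (B := B) (T x) y = inn x (T' y)}
  mul_mem' := by
    rintro S T ⟨S', hS⟩ ⟨T', hT⟩
    refine ⟨T' * S', fun x y => ?_⟩
    change inn (S (T x)) y = inn x (T' (S' y))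
    rw [hS, hT]
  add_mem' := by
    rintro S T ⟨S', hS⟩ ⟨T', hT⟩
    refine ⟨S' + T', fun x y => ?_⟩
    change inn (S x + T x) y = inn x (S' y + T' y)
    rw [HilbertModule.inn_add_right, ← hS, ← hT]
    exact (HilbertModule.pre B E).inn_add_left _ _ _
  algebraMap_mem' := by
    intro c
    refine ⟨algebraMap ℂ _ (starRingEnd ℂ c), fun x y => ?_⟩
    change inn (c • x) y = inn x ((starRingEnd ℂ c) • y)
    rw [HilbertModule.inn_smul_right]
    exact (HilbertModule.pre B E).inn_smul_left _ _ _

variable {B E}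

namespace Adjointable

/-- Build an adjointable operator from an operator and its adjoint. -/
def mk (T T' : E →L[ℂ] E) (h : ∀ x y, inn (B := B) (T x) y = inn x (T' y)) : Adjointable B E :=
  ⟨T, T', h⟩

theorem ext {S T : Adjointable B E} (h : ∀ x, (S : E →L[ℂ] E) x = (T : E →L[ℂ] E) x) : S = T :=
  Subtype.ext (ContinuousLinearMap.ext h)

theorem inn_swap {S T : E →L[ℂ] E} (h : ∀ x y, inn (B := B) (S x) y = inn x (T y)) (x y : E) :
    inn (B := B) (T x) y = inn x (S y) := by
  rw [← HilbertModule.star_inn, ← h, HilbertModule.star_inn]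

instance : Star (Adjointable B E) :=
  ⟨fun T => ⟨T.2.choose, T, inn_swap T.2.choose_spec⟩⟩

theorem inn_star_right (T : Adjointable B E) (x y : E) :
    inn (B := B) x ((star T : Adjointable B E).1 y) = inn (T.1 x) y :=
  (T.2.choose_spec x y).symm

theorem inn_star_left (T : Adjointable B E) (x y : E) :
    inn (B := B) ((star T : Adjointable B E).1 x) y = inn x (T.1 y) :=
  inn_swap T.2.choose_spec x y

theorem star_eq {S T : Adjointable B E} (h : ∀ x y, inn (B := B) (S.1 x) y = inn x (T.1 y)) :
    star S = T :=
  ext fun y => HilbertModule.ext_inn B fun x => by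
    rw [inn_star_right, h]

instance : StarRing (Adjointable B E) where
  star_involutive T := star_eq fun x y => inn_star_left T x y
  star_mul S T := star_eq fun x y => by
    change inn (S.1 (T.1 x)) y = inn x ((star T : Adjointable B E).1 ((star S : Adjointable B E).1 y))
    rw [inn_star_right, inn_star_right]
  star_add S T := star_eq fun x y => by
    change inn (S.1 x + T.1 x) y =
      inn x ((star S : Adjointable B E).1 y + (star T : Adjointable B E).1 y)
    rw [HilbertModule.inn_add_right, inn_star_right, inn_star_right]
    exact (HilbertModule.pre B E).inn_add_left _ _ _

instance : StarModule ℂ (Adjointable B E) where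
  star_smul c T := star_eq fun x y => by
    change inn (c • T.1 x) y = inn x ((starRingEnd ℂ c) • (star T : Adjointable B E).1 y)
    rw [HilbertModule.inn_smul_right, inn_star_right]
    exact (HilbertModule.pre B E).inn_smul_left _ _ _

theorem norm_star_le (T : Adjointable B E) : ‖(star T).1‖ ≤ ‖T.1‖ := by
  refine ContinuousLinearMap.opNorm_le_bound _ (norm_nonneg _) fun x => ?_
  set y := (star T : Adjointable B E).1 x with hy
  have h1 : ‖y‖ * ‖y‖ ≤ (‖T.1‖ * ‖x‖) * ‖y‖ := by
    rw [← sq, HilbertModule.norm_sq_eq (B := B)]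
    nth_rewrite 1 [hy]
    rw [inn_star_left]
    refine (HilbertModule.norm_inn_le _ _).trans ?_
    calc ‖x‖ * ‖T.1 y‖ ≤ ‖x‖ * (‖T.1‖ * ‖y‖) :=
          mul_le_mul_of_nonneg_left (T.1.le_opNorm y) (norm_nonneg x)
      _ = (‖T.1‖ * ‖x‖) * ‖y‖ := by ring
  change ‖y‖ ≤ ‖T.1‖ * ‖x‖
  rcases (norm_nonneg y).eq_or_lt with h0 | h0
  · rw [← h0]; exact mul_nonneg (norm_nonneg _) (norm_nonneg _)
  · exact le_of_mul_le_mul_right h1 h0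

instance : ContinuousStar (Adjointable B E) where
  continuous_star := by
    have h : Continuous (starAddEquiv : Adjointable B E ≃+ Adjointable B E) :=
      AddMonoidHomClass.continuous_of_bound (starAddEquiv (R := Adjointable B E)) 1 fun T => by
        rw [one_mul]; exact norm_star_le T
    exact h

/-- Adjointable operators are right `B`-linear. -/
theorem map_op_smul (T : Adjointable B E) (b : B) (x : E) : T.1 (op b • x) = op b • T.1 x :=
  HilbertModule.ext_inn B fun z => by
    rw [← inn_star_left, HilbertModule.inn_op_smul_right, HilbertModule.inn_op_smul_right,
      inn_star_left]

end Adjointable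

/-- The operator `θ_{ξ,η}(ζ) = ξ ⟨η, ζ⟩`. -/
def thetaCLM (ξ η : E) : E →L[ℂ] E :=
  LinearMap.mkContinuous
    { toFun := fun ζ => op (inn (B := B) η ζ) • ξ
      map_add' := fun x y => by rw [HilbertModule.inn_add_right, op_add, add_smul]
      map_smul' := fun c x => HilbertModule.ext_inn B fun z => by
        rw [RingHom.id_apply, HilbertModule.inn_smul_right, HilbertModule.inn_op_smul_right,
          HilbertModule.inn_smul_right, HilbertModule.inn_op_smul_right, mul_smul_comm] }
    (‖ξ‖ * ‖η‖) fun ζ => by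
      change ‖op (inn (B := B) η ζ) • ξ‖ ≤ _
      refine (HilbertModule.norm_op_smul_le _ _).trans ?_
      have := HilbertModule.norm_inn_le (B := B) η ζ
      calc _ ≤ (‖η‖ * ‖ζ‖) * ‖ξ‖ := mul_le_mul_of_nonneg_right this (norm_nonneg _)
        _ = _ := by ring

variable (B) in
/-- The operator `θ_{ξ,η}`, as an adjointable operator. -/
def theta (ξ η : E) : Adjointable B E :=
  Adjointable.mk (thetaCLM (B := B) ξ η) (thetaCLM (B := B) η ξ) fun x y => by
    change inn (op (inn (B := B) η x) • ξ) y = inn x (op (inn (B := B) ξ y) • η)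
    rw [HilbertModule.inn_op_smul_right]
    refine ((HilbertModule.pre B E).inn_ract_left _ _ _).trans ?_
    rw [HilbertModule.star_inn]; rfl

theorem theta_apply (ξ η ζ : E) : (theta B ξ η).1 ζ = op (inn (B := B) η ζ) • ξ := rfl

variable (B E) in
/-- The compact operators `𝒦(E)`: the closed linear span of the `θ_{ξ,η}`. -/
def compacts : Set (Adjointable B E) :=
  closure (Submodule.span ℂ {T | ∃ ξ η : E, T = theta B ξ η} : Set (Adjointable B E))

end Adj

namespace PreHilbert

variable {B V : Type} [CStarAlgebra B] [AddCommGroup V] [Module ℂ V] (P : PreHilbert B V)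

theorem nrm_le_of_adj {W : Type} [AddCommGroup W] [Module ℂ W] (Q : PreHilbert B W)
    (A : V →ₗ[ℂ] W) (A' : W →ₗ[ℂ] V) (h : ∀ x y, Q.inn (A x) y = P.inn x (A' y)) {C : ℝ} (hC0 : 0 ≤ C)
    (hC : ∀ x, Q.nrm (A x) ≤ C * P.nrm x) (y : W) : P.nrm (A' y) ≤ C * Q.nrm y := by
  have h1 : P.nrm (A' y) * P.nrm (A' y) ≤ (C * Q.nrm y) * P.nrm (A' y) := by
    rw [← sq, nrm_sq, ← h]
    refine (Q.norm_inn_le _ _).trans ?_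
    calc _ ≤ (C * P.nrm (A' y)) * Q.nrm y :=
          mul_le_mul_of_nonneg_right (hC _) (Q.nrm_nonneg y)
      _ = _ := by ring
  rcases (P.nrm_nonneg (A' y)).eq_or_lt with h0 | h0
  · rw [← h0]; exact mul_nonneg hC0 (Q.nrm_nonneg y)
  · exact le_of_mul_le_mul_right h1 h0

end PreHilbert
end QuantumLens
namespace QuantumLens

open HilbertModule (inn)

namespace Adjointable

variable {B E : Type} [CStarAlgebra B] [NormedAddCommGroup E] [NormedSpace ℂ E]
    [Module Bᵐᵒᵖ E] [HilbertModule B E]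

theorem isClosed_adjointable : IsClosed (Adjointable B E : Set (E →L[ℂ] E)) := by
  refine isClosed_of_closure_subset fun T hT => ?_
  obtain ⟨u, hu, hlim⟩ := mem_closure_iff_seq_limit.1 hT
  let v : ℕ → Adjointable B E := fun n => ⟨u n, hu n⟩
  have hc : CauchySeq fun n => (star (v n)).1 := by
    rw [Metric.cauchySeq_iff']
    intro ε hε
    obtain ⟨N, hN⟩ := Metric.cauchySeq_iff'.1 hlim.cauchySeq ε hε
    refine ⟨N, fun n hn => lt_of_le_of_lt ?_ (hN n hn)⟩
    have h1 := norm_star_le (v n - v N)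
    rw [star_sub] at h1
    rw [dist_eq_norm, dist_eq_norm]
    exact h1
  obtain ⟨T', hT'⟩ := cauchySeq_tendsto_of_complete hc
  refine ⟨T', fun x y => ?_⟩
  have h1 : Filter.Tendsto (fun n => inn (B := B) (u n x) y) Filter.atTop
      (nhds (inn (T x) y)) :=
    ((HilbertModule.continuous_inn (B := B) continuous_id continuous_const).tendsto (T x)).comp
      (((ContinuousLinearMap.apply ℂ E x).continuous.tendsto T).comp hlim)
  have h2 : Filter.Tendsto (fun n => inn (B := B) x ((star (v n)).1 y)) Filter.atTop
      (nhds (inn x (T' y))) :=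
    ((HilbertModule.continuous_inn (B := B) continuous_const continuous_id).tendsto (T' y)).comp
      (((ContinuousLinearMap.apply ℂ E y).continuous.tendsto T').comp hT')
  refine tendsto_nhds_unique h1 (h2.congr fun n => ?_)
  rw [inn_star_right]

/-- The C*-algebra structure of `ℒ(E)`. -/
instance : CStarAlgebra (Adjointable B E) where
  complete := (isClosed_adjointable (B := B) (E := E)).completeSpace_coe.complete
  norm_mul_self_le T := by
    have h1 : ∀ x, ‖T.1 x‖ ≤ √‖(star T * T).1‖ * ‖x‖ := fun x => by
      refine abs_le_of_sq_le_sq' ?_ (mul_nonneg (Real.sqrt_nonneg _) (norm_nonneg x)) |>.2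
      rw [mul_pow, Real.sq_sqrt (norm_nonneg _), HilbertModule.norm_sq_eq (B := B) (T.1 x),
        ← inn_star_right]
      refine (HilbertModule.norm_inn_le _ _).trans ?_
      calc _ ≤ ‖x‖ * (‖(star T * T).1‖ * ‖x‖) :=
            mul_le_mul_of_nonneg_left ((star T * T).1.le_opNorm x) (norm_nonneg x)
        _ = _ := by ring
    have h2 := ContinuousLinearMap.opNorm_le_bound _ (Real.sqrt_nonneg _) h1
    calc ‖T‖ * ‖T‖ ≤ √‖(star T * T).1‖ * √‖(star T * T).1‖ :=
          mul_self_le_mul_self (norm_nonneg _) h2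
      _ = _ := Real.mul_self_sqrt (norm_nonneg _)

end Adjointable

end QuantumLens
/-! ### C*-correspondences -/

namespace QuantumLens

open HilbertModule (inn)

namespace PreHilbert

variable {B V : Type} [CStarAlgebra B] [AddCommGroup V] [Module ℂ V] (P : PreHilbert B V)

/-- The extension of a bounded operator with a formal adjoint to the completion. -/
def liftAdj (A A' : V →ₗ[ℂ] V) (h : ∀ x y, P.inn (A x) y = P.inn x (A' y)) {C : ℝ} (hC0 : 0 ≤ C)
    (hC : ∀ x, P.nrm (A x) ≤ C * P.nrm x) : Adjointable B P.Compl :=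
  Adjointable.mk
    (P.ext (P.of ∘ₗ A) C fun x => by rw [LinearMap.comp_apply, norm_of]; exact hC x)
    (P.ext (P.of ∘ₗ A') C fun x => by
      rw [LinearMap.comp_apply, norm_of]; exact P.nrm_le_of_adj P A A' h hC0 hC x)
    fun x y => by
      refine P.induction_on₂ (p := fun x y => HilbertModule.inn (B := B) (P.ext (P.of ∘ₗ A) C _ x) y =
        HilbertModule.inn x (P.ext (P.of ∘ₗ A') C _ y)) x y (isClosed_eq ?_ ?_) ?_
      · exact HilbertModule.continuous_inn
          ((ContinuousLinearMap.continuous _).comp continuous_fst) continuous_snd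
      · exact HilbertModule.continuous_inn continuous_fst
          ((ContinuousLinearMap.continuous _).comp continuous_snd)
      · intro u v
        rw [ext_of, ext_of, LinearMap.comp_apply, LinearMap.comp_apply, inn_of, inn_of, h]

theorem liftAdj_of (A A' : V →ₗ[ℂ] V) (h : ∀ x y, P.inn (A x) y = P.inn x (A' y)) {C : ℝ}
    (hC0 : 0 ≤ C) (hC : ∀ x, P.nrm (A x) ≤ C * P.nrm x) (x : V) :
    (P.liftAdj A A' h hC0 hC).1 (P.of x) = P.of (A x) := P.ext_of _ _ _ _

theorem adjointable_ext {S T : Adjointable B P.Compl} (h : ∀ x, S.1 (P.of x) = T.1 (P.of x)) :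
    S = T :=
  Subtype.ext (P.complRact_eq h)

theorem adjointable_star {S T : Adjointable B P.Compl}
    (h : ∀ x y, HilbertModule.inn (B := B) (S.1 (P.of x)) (P.of y) = HilbertModule.inn (P.of x) (T.1 (P.of y))) :
    star S = T :=
  Adjointable.star_eq fun x y => by
    refine P.induction_on₂ (p := fun x y => HilbertModule.inn (B := B) (S.1 x) y = HilbertModule.inn x (T.1 y)) x y
      (isClosed_eq ?_ ?_) h
    · exact HilbertModule.continuous_inn (S.1.continuous.comp continuous_fst) continuous_snd
    · exact HilbertModule.continuous_inn continuous_fst (T.1.continuous.comp continuous_snd)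

/-- If `⟨A x, A x⟩ ≤ M ⟨x, x⟩` then `‖A x‖ ≤ √M ‖x‖`. -/
theorem nrm_le_of_isPos {W : Type} [AddCommGroup W] [Module ℂ W] (Q : PreHilbert B W) {x : V}
    {y : W} {M : ℝ} (hM : 0 ≤ M) (h : IsPos (M • P.inn x x - Q.inn y y)) :
    Q.nrm y ≤ √M * P.nrm x := by
  have h1 := norm_le_of_isPos (Q.inn_pos y) h
  rw [norm_smul, Real.norm_of_nonneg hM] at h1
  rw [nrm, nrm, ← Real.sqrt_mul hM]
  exact Real.sqrt_le_sqrt h1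

/-- A left action on a pre-Hilbert module by operators with `b ↦ b*` as formal adjoint. -/
structure LeftAction {B V : Type} [CStarAlgebra B] [AddCommGroup V] [Module ℂ V]
    (P : PreHilbert B V) where
  /-- the action -/
  act : B →ₐ[ℂ] Module.End ℂ V
  inn_act : ∀ b x y, P.inn (act b x) y = P.inn x (act (star b) y)

variable {P} (L : P.LeftAction)

theorem nrm_act_le (b : B) (x : V) : P.nrm (L.act b x) ≤ ‖b‖ * P.nrm x := by
  rw [← Real.sqrt_sq (norm_nonneg b)]
  refine P.nrm_le_of_isPos P (sq_nonneg _) ?_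
  obtain ⟨c, hc⟩ := isPos_norm_sq_sub b
  convert P.inn_pos (L.act c x) using 1
  have h1 : L.act (star b) (L.act b x) = L.act (star b * b) x := by rw [map_mul]; rfl
  have h2 : L.act (star c) (L.act c x) = L.act (star c * c) x := by rw [map_mul]; rfl
  rw [L.inn_act, L.inn_act, h1, h2, ← hc, map_sub, LinearMap.sub_apply, P.inn_sub_right]
  congr 1
  have h3 : ((‖b‖ ^ 2) • (1 : B)) = ((‖b‖ ^ 2 : ℝ) : ℂ) • (1 : B) := rfl
  rw [h3, map_smul, map_one, LinearMap.smul_apply, Module.End.one_apply, P.inn_smul_real_right]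

/-- The operator of the left action by `b` on the completion. -/
def LeftAction.liftFun (b : B) : Adjointable B P.Compl :=
  P.liftAdj (L.act b) (L.act (star b)) (L.inn_act b) (norm_nonneg b) (nrm_act_le L b)

theorem LeftAction.liftFun_of (b : B) (x : V) : (L.liftFun b).1 (P.of x) = P.of (L.act b x) :=
  P.liftAdj_of _ _ _ _ _ _

/-- The left action on the completion. -/
def LeftAction.lift : B →⋆ₐ[ℂ] Adjointable B P.Compl where
  toFun b := L.liftFun b
  map_one' := P.adjointable_ext fun x => by
    rw [L.liftFun_of, map_one]; rfl
  map_mul' a b := P.adjointable_ext fun x => by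
    rw [L.liftFun_of, map_mul]
    change P.of (L.act a (L.act b x)) = (L.liftFun a).1 ((L.liftFun b).1 (P.of x))
    rw [L.liftFun_of, L.liftFun_of]
  map_zero' := P.adjointable_ext fun x => by
    rw [L.liftFun_of, map_zero]; exact map_zero P.of
  map_add' a b := P.adjointable_ext fun x => by
    rw [L.liftFun_of, map_add]
    change P.of (L.act a x + L.act b x) = (L.liftFun a).1 (P.of x) + (L.liftFun b).1 (P.of x)
    rw [L.liftFun_of, L.liftFun_of, map_add]
  commutes' c := P.adjointable_ext fun x => by
    rw [L.liftFun_of, AlgHomClass.commutes]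
    exact map_smul P.of c x
  map_star' b := by
    refine (P.adjointable_star fun x y => ?_).symm
    rw [L.liftFun_of, L.liftFun_of, inn_of, inn_of, L.inn_act]

theorem LeftAction.lift_of (b : B) (x : V) : (L.lift b).1 (P.of x) = P.of (L.act b x) :=
  L.liftFun_of b x

end PreHilbert

/-- A C*-correspondence over the unital C*-algebra `B`: a right Hilbert `B`-module `E` with a
(unital) `*`-homomorphism `φ : B → ℒ(E)`. An isomorphism `B → 𝒦(E)` is automatically unital. -/
structure Corr (B : Type) [CStarAlgebra B] where
  /-- the underlying space -/
  carrier : Type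
  [normed : NormedAddCommGroup carrier]
  [space : NormedSpace ℂ carrier]
  [module : Module Bᵐᵒᵖ carrier]
  [hilbert : HilbertModule B carrier]
  /-- the left action -/
  φ : B →⋆ₐ[ℂ] Adjointable B carrier

namespace Corr

variable {B : Type} [CStarAlgebra B]

instance : CoeSort (Corr B) Type := ⟨Corr.carrier⟩

attribute [instance] Corr.normed Corr.space Corr.module Corr.hilbert

/-- The pre-Hilbert module underlying a correspondence. -/
def pre (E : Corr B) : PreHilbert B E := HilbertModule.pre B E

theorem pre_inn (E : Corr B) (x y : E) : E.pre.inn x y = HilbertModule.inn x y := rfl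

/-- The left action as an algebra homomorphism to linear maps. -/
def act (E : Corr B) : B →ₐ[ℂ] Module.End ℂ E where
  toFun b := ((E.φ b).1 : E →ₗ[ℂ] E)
  map_one' := by rw [map_one]; rfl
  map_mul' a b := by rw [map_mul]; rfl
  map_zero' := by rw [map_zero]; rfl
  map_add' a b := by rw [map_add]; rfl
  commutes' c := by rw [AlgHomClass.commutes]; rfl

theorem act_apply (E : Corr B) (b : B) (x : E) : E.act b x = (E.φ b).1 x := rfl

theorem inn_act (E : Corr B) (b : B) (x y : E) :
    E.pre.inn (E.act b x) y = E.pre.inn x (E.act (star b) y) := by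
  change inn (B := B) ((E.φ b).1 x) y = inn x ((E.φ (star b)).1 y)
  rw [map_star, Adjointable.inn_star_right]

theorem act_ract (E : Corr B) (b c : B) (x : E) :
    E.act b (E.pre.ract (op c) x) = E.pre.ract (op c) (E.act b x) :=
  Adjointable.map_op_smul (E.φ b) c x

/-- The correspondence obtained by completing a pre-Hilbert module with a left action. -/
def ofPre {V : Type} [AddCommGroup V] [Module ℂ V] {P : PreHilbert B V} (L : P.LeftAction) :
    Corr B where
  carrier := P.Compl
  φ := L.lift

end Corr

/-- A C*-algebra is a Hilbert module over itself, with `⟨x, y⟩ = x* y`. -/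
instance (B : Type) [CStarAlgebra B] : HilbertModule B B where
  inn x y := star x * y
  inn_add_right x y z := mul_add _ _ _
  inn_smul_right c x y := mul_smul_comm _ _ _
  inn_op_smul_right b x y := (mul_assoc _ _ _).symm
  star_inn x y := by rw [star_mul, star_star]
  inn_pos x := ⟨x, rfl⟩
  norm_sq_eq x := by rw [CStarRing.norm_star_mul_self, sq]

namespace Corr

variable (B : Type) [CStarAlgebra B]

/-- The identity correspondence `B`, with the left multiplication as left action. -/
def unit : Corr B where
  carrier := B
  φ :=
    { toFun := fun b => Adjointable.mk (ContinuousLinearMap.mul ℂ B b)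
        (ContinuousLinearMap.mul ℂ B (star b)) fun x y => by
          change star (b * x) * y = star x * (star b * y)
          rw [star_mul, mul_assoc]
      map_one' := Adjointable.ext fun x => one_mul x
      map_mul' := fun a b => Adjointable.ext fun x => mul_assoc a b x
      map_zero' := Adjointable.ext fun x => zero_mul x
      map_add' := fun a b => Adjointable.ext fun x => add_mul a b x
      commutes' := fun c => Adjointable.ext fun x => (Algebra.smul_def c x).symm
      map_star' := fun b => (Adjointable.star_eq fun x y => by
        change star (b * x) * y = star x * (star b * y)
        rw [star_mul, mul_assoc]).symm }

end Corr

end QuantumLens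
/-! ### The interior tensor product -/

namespace QuantumLens

open HilbertModule (inn)
open scoped TensorProduct

/-- Gram matrices over a C*-algebra are positive. -/
theorem PreHilbert.exists_gram {B V : Type} [CStarAlgebra B] [AddCommGroup V] [Module ℂ V]
    (P : PreHilbert B V) {n : ℕ} (x : Fin n → V) :
    ∃ c : Fin n → Fin n → B, ∀ i j, P.inn (x i) (x j) = ∑ k, star (c k i) * c k j := by
  let _ := CStarAlgebra.spectralOrder B
  have := CStarAlgebra.spectralOrderedRing B
  let M : CStarMatrix (Fin n) (Fin n) B := CStarMatrix.ofMatrix fun i j => P.inn (x i) (x j)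
  have hM : ∀ i j, M i j = P.inn (x i) (x j) := fun i j => rfl
  have hs : star M = M := by
    ext i j
    rw [CStarMatrix.star_apply, hM, hM, P.star_inn]
  have key : IsPos M := by
    refine isPos_of_conj hs fun c e hc he => ?_
    have hc' : ∀ i j, star (c i j) = c j i := fun i j => by
      rw [← CStarMatrix.star_apply, hc]
    have h1 : ∀ i, IsPos ((c * M * c) i i) := by
      intro i
      have h2 : (c * M * c) i i =
          P.inn (∑ j, P.ract (op (c j i)) (x j)) (∑ j, P.ract (op (c j i)) (x j)) := by
        rw [P.inn_sum_right, CStarMatrix.mul_apply]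
        refine Finset.sum_congr rfl fun j _ => ?_
        rw [P.inn_sum_left, CStarMatrix.mul_apply, Finset.sum_mul]
        refine Finset.sum_congr rfl fun k _ => ?_
        rw [P.inn_ract, P.inn_ract_left, hc', hM]
      rw [h2]
      exact P.inn_pos _
    have h2 : ∀ i, ∑ k, star (e k i) * e k i = 0 := by
      intro i
      have h3 : (c * M * c) i i = -∑ k, star (e k i) * e k i := by
        rw [he, CStarMatrix.neg_apply, CStarMatrix.mul_apply]
        simp only [CStarMatrix.star_apply]
      have h4 := h1 i
      rw [h3] at h4
      exact isPos_antisymm (isPos_sum _ _ fun k _ => ⟨e k i, rfl⟩) h4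
    ext k i
    have h5 : IsPos (∑ k, star (e k i) * e k i - star (e k i) * e k i) := by
      rw [← Finset.sum_erase_eq_sub (Finset.mem_univ k)]
      exact isPos_sum _ _ fun k _ => ⟨e k i, rfl⟩
    have h6 := norm_le_of_isPos ⟨e k i, rfl⟩ h5
    rw [h2, norm_zero, CStarRing.norm_star_mul_self] at h6
    have h7 : ‖e k i‖ = 0 := by nlinarith [norm_nonneg (e k i)]
    rw [norm_eq_zero.1 h7]; rfl
  obtain ⟨c, hc⟩ := key
  refine ⟨fun k i => c k i, fun i j => ?_⟩
  rw [← hM, hc, CStarMatrix.mul_apply]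
  simp only [CStarMatrix.star_apply]

namespace Corr

variable {B : Type} [CStarAlgebra B] (E F : Corr B)

/-- The form `(x', y') ↦ ⟨y, φ(⟨x, x'⟩) y'⟩`, as a linear map on the tensor product. -/
def tensorInnAux (x : E) (y : F) : E ⊗[ℂ] F →ₗ[ℂ] B :=
  TensorProduct.lift (LinearMap.mk₂ ℂ (fun x' y' => F.pre.inn y (F.act (E.pre.inn x x') y'))
    (fun a b c => by
      rw [E.pre.inn_add_right, map_add, LinearMap.add_apply, F.pre.inn_add_right])
    (fun s a c => by
      rw [E.pre.inn_smul_right, map_smul, LinearMap.smul_apply, F.pre.inn_smul_right])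
    (fun a b c => by rw [map_add, F.pre.inn_add_right])
    (fun s a c => by rw [map_smul, F.pre.inn_smul_right]))

theorem tensorInnAux_tmul (x x' : E) (y y' : F) :
    tensorInnAux E F x y (x' ⊗ₜ y') = F.pre.inn y (F.act (E.pre.inn x x') y') := rfl

/-- The inner product `⟨x ⊗ y, x' ⊗ y'⟩ = ⟨y, φ(⟨x, x'⟩) y'⟩` on the algebraic tensor product. -/
def tensorInn : E ⊗[ℂ] F →ₗ⋆[ℂ] E ⊗[ℂ] F →ₗ[ℂ] B :=
  TensorProduct.lift (LinearMap.mk₂'ₛₗ (starRingEnd ℂ) (starRingEnd ℂ) (tensorInnAux E F)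
    (fun a b c => TensorProduct.ext' fun x y => by
      rw [LinearMap.add_apply, tensorInnAux_tmul, tensorInnAux_tmul, tensorInnAux_tmul,
        E.pre.inn_add_left, map_add, LinearMap.add_apply, F.pre.inn_add_right])
    (fun s a c => TensorProduct.ext' fun x y => by
      rw [LinearMap.smul_apply, tensorInnAux_tmul, tensorInnAux_tmul,
        E.pre.inn_smul_left, map_smul, LinearMap.smul_apply, F.pre.inn_smul_right])
    (fun a b c => TensorProduct.ext' fun x y => by
      rw [LinearMap.add_apply, tensorInnAux_tmul, tensorInnAux_tmul, tensorInnAux_tmul,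
        F.pre.inn_add_left])
    (fun s a c => TensorProduct.ext' fun x y => by
      rw [LinearMap.smul_apply, tensorInnAux_tmul, tensorInnAux_tmul, F.pre.inn_smul_left]))

theorem tensorInn_tmul (x x' : E) (y y' : F) :
    tensorInn E F (x ⊗ₜ y) (x' ⊗ₜ y') = F.pre.inn y (F.act (E.pre.inn x x') y') := rfl

theorem exists_eq_sum_tmul {V W : Type} [AddCommGroup V] [Module ℂ V] [AddCommGroup W]
    [Module ℂ W] (t : V ⊗[ℂ] W) :
    ∃ (n : ℕ) (x : Fin n → V) (y : Fin n → W), t = ∑ i, x i ⊗ₜ[ℂ] y i := by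
  obtain ⟨S, rfl⟩ := TensorProduct.exists_finset t
  refine ⟨S.card, fun i => (S.equivFin.symm i).1.1, fun i => (S.equivFin.symm i).1.2, ?_⟩
  rw [Equiv.sum_comp S.equivFin.symm (fun p : S => p.1.1 ⊗ₜ[ℂ] p.1.2), ← Finset.sum_coe_sort]

/-- The algebraic tensor product as a pre-Hilbert module. -/
def tensorPre : PreHilbert B (E ⊗[ℂ] F) where
  inn s t := tensorInn E F s t
  ract := (Module.End.lTensorAlgHom ℂ F E).comp F.pre.ract
  inn_add_right _ _ _ := map_add _ _ _
  inn_smul_right _ _ _ := map_smul _ _ _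
  inn_ract b s t := by
    induction t with
    | zero => rw [map_zero, map_zero, zero_mul]
    | add t t' h h' => rw [map_add, map_add, map_add, add_mul, h, h']
    | tmul x' y' =>
      induction s with
      | zero => rw [map_zero]; exact (zero_mul b).symm
      | add s s' h h' =>
        rw [map_add, LinearMap.add_apply, LinearMap.add_apply, add_mul, h, h']
      | tmul x y =>
        change tensorInn E F (x ⊗ₜ y) (x' ⊗ₜ F.pre.ract (op b) y') = _
        rw [tensorInn_tmul, tensorInn_tmul, F.act_ract, F.pre.inn_ract]
  star_inn s t := by
    induction t with
    | zero => rw [map_zero, map_zero, star_zero]; rfl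
    | add t t' h h' => rw [map_add, map_add, LinearMap.add_apply, star_add, h, h']
    | tmul x' y' =>
      induction s with
      | zero => rw [map_zero, map_zero]; exact star_zero B
      | add s s' h h' =>
        rw [map_add, map_add, LinearMap.add_apply, star_add, h, h']
      | tmul x y =>
        rw [tensorInn_tmul, tensorInn_tmul, F.pre.star_inn, F.inn_act, E.pre.star_inn]
  inn_pos t := by
    obtain ⟨n, x, y, rfl⟩ := exists_eq_sum_tmul t
    obtain ⟨c, hc⟩ := E.pre.exists_gram x
    have h : tensorInn E F (∑ i, x i ⊗ₜ[ℂ] y i) (∑ i, x i ⊗ₜ[ℂ] y i) =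
        ∑ k, F.pre.inn (∑ i, F.act (c k i) (y i)) (∑ i, F.act (c k i) (y i)) := by
      have h1 : ∀ i j, tensorInn E F (x i ⊗ₜ[ℂ] y i) (x j ⊗ₜ[ℂ] y j) =
          ∑ k, F.pre.inn (F.act (c k i) (y i)) (F.act (c k j) (y j)) := fun i j => by
        rw [tensorInn_tmul, hc, map_sum, LinearMap.sum_apply, F.pre.inn_sum_right]
        refine Finset.sum_congr rfl fun k _ => ?_
        rw [F.inn_act, map_mul, Module.End.mul_apply]
      simp only [map_sum, LinearMap.sum_apply, F.pre.inn_sum_right, F.pre.inn_sum_left, h1]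
      exact (Finset.sum_congr rfl fun _ _ => Finset.sum_comm).trans Finset.sum_comm
    rw [h]
    exact isPos_sum _ _ fun k _ => F.pre.inn_pos _

/-- The left action on the algebraic tensor product. -/
def tensorAct : (tensorPre E F).LeftAction where
  act := (Module.End.rTensorAlgHom ℂ E F).comp E.act
  inn_act b s t := by
    change tensorInn E F _ t = tensorInn E F s _
    induction t with
    | zero => rw [map_zero, map_zero, map_zero]
    | add t t' h h' => rw [map_add, map_add, map_add, h, h']
    | tmul x' y' =>
      induction s with
      | zero => rw [map_zero, map_zero]; rfl
      | add s s' h h' =>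
        rw [map_add, map_add, map_add, LinearMap.add_apply, LinearMap.add_apply, h, h']
      | tmul x y =>
        change tensorInn E F (E.act b x ⊗ₜ y) (x' ⊗ₜ y') =
          tensorInn E F (x ⊗ₜ y) (E.act (star b) x' ⊗ₜ y')
        rw [tensorInn_tmul, tensorInn_tmul, E.inn_act]

/-- The interior tensor product `E ⊗_φ F`. -/
def tensor : Corr B := ofPre (tensorAct E F)

/-- The elementary tensor `x ⊗ y`. -/
def tmul {E F : Corr B} (x : E) (y : F) : tensor E F := (tensorPre E F).of (x ⊗ₜ[ℂ] y)

theorem inn_tmul {E F : Corr B} (x x' : E) (y y' : F) :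
    inn (B := B) (tmul x y) (tmul x' y') = F.pre.inn y (F.act (E.pre.inn x x') y') :=
  (tensorPre E F).inn_of _ _

end Corr
end QuantumLens
/-! ### Tensor powers, creation and annihilation maps -/

namespace QuantumLens

open HilbertModule (inn)
open scoped TensorProduct

/-- A pair of mutually adjoint maps `up : F → G` and `down : G → F`, with
`⟨up x, up x⟩ ≤ M ⟨x, x⟩`. -/
structure AdjPair {B : Type} [CStarAlgebra B] (F G : Corr B) (M : ℝ) where
  /-- the map from `F` to `G` -/
  up : F →ₗ[ℂ] G
  /-- the map from `G` to `F` -/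
  down : G →ₗ[ℂ] F
  adj : ∀ x y, G.pre.inn (up x) y = F.pre.inn x (down y)
  pos : ∀ x, IsPos (M • F.pre.inn x x - G.pre.inn (up x) (up x))

namespace Corr

variable {B : Type} [CStarAlgebra B]

theorem isPos_sq_sub_inn (E : Corr B) (ξ : E) {M : ℝ} (hM : ‖ξ‖ ^ 2 ≤ M) :
    IsPos (M • (1 : B) - E.pre.inn ξ ξ) := by
  obtain ⟨s, hs⟩ := E.pre.inn_pos ξ
  have h : ‖s‖ ^ 2 ≤ M := by
    rw [sq, ← CStarRing.norm_star_mul_self, ← hs]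
    refine le_trans (le_of_eq ?_) hM
    exact (HilbertModule.norm_sq_eq (B := B) ξ).symm
  have h2 := (isPos_norm_sq_sub s).add
    (IsPos.smul (a := (1 : B)) ⟨1, by simp⟩ (sub_nonneg.2 h))
  rw [hs]
  convert h2 using 1
  rw [sub_smul]; abel

theorem isPos_sub_act (E F : Corr B) (ξ : E) {M : ℝ} (hM : ‖ξ‖ ^ 2 ≤ M) (w : F) :
    IsPos (M • F.pre.inn w w - F.pre.inn w (F.act (E.pre.inn ξ ξ) w)) := by
  obtain ⟨c, hc⟩ := E.isPos_sq_sub_inn ξ hM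
  have h : F.pre.inn (F.act c w) (F.act c w) =
      M • F.pre.inn w w - F.pre.inn w (F.act (E.pre.inn ξ ξ) w) := by
    rw [F.inn_act, ← Module.End.mul_apply, ← map_mul, ← hc, map_sub, LinearMap.sub_apply,
      F.pre.inn_sub_right]
    congr 1
    have h3 : (M • (1 : B)) = (M : ℂ) • (1 : B) := rfl
    rw [h3, map_smul, map_one, LinearMap.smul_apply, Module.End.one_apply,
      F.pre.inn_smul_real_right]
  rw [← h]
  exact F.pre.inn_pos _

/-- The map `b ↦ ξ b`. -/
def rightMul (E : Corr B) (ξ : E) : B →ₗ[ℂ] E where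
  toFun b := E.pre.ract (op b) ξ
  map_add' a b := by rw [op_add, map_add]; rfl
  map_smul' c a := by rw [op_smul, map_smul]; rfl

/-- The map `η ↦ ⟨ξ, η⟩`. -/
def innMap (E : Corr B) (ξ : E) : E →ₗ[ℂ] B := E.pre.innL ξ

theorem isPos_sub_rightMul (E : Corr B) (ξ : E) {M : ℝ} (hM : ‖ξ‖ ^ 2 ≤ M) (b : B) :
    IsPos (M • (star b * b) - E.pre.inn (E.rightMul ξ b) (E.rightMul ξ b)) := by
  have h := (E.isPos_sq_sub_inn ξ hM).conj b
  convert h using 1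
  rw [mul_sub, sub_mul, mul_smul_comm, mul_one, smul_mul_assoc]
  congr 1
  exact (E.pre.inn_ract b _ _).trans (congrArg (· * b) (E.pre.inn_ract_left b ξ ξ))

/-- The maps `b ↦ ξ b` and `η ↦ ⟨ξ, η⟩` between `B` and `E`. -/
def unitPair (E : Corr B) (ξ : E) {M : ℝ} (hM : ‖ξ‖ ^ 2 ≤ M) : AdjPair (unit B) E M where
  up := rightMul E ξ
  down := innMap E ξ
  adj b η := E.pre.inn_ract_left b ξ η
  pos b := E.isPos_sub_rightMul ξ hM b

/-- The map `η ⊗ w ↦ φ(⟨ξ, η⟩) w` on the algebraic tensor product. -/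
def contract (E F : Corr B) (ξ : E) : E ⊗[ℂ] F →ₗ[ℂ] F :=
  TensorProduct.lift (LinearMap.mk₂ ℂ (fun η w => F.act (E.pre.inn ξ η) w)
    (fun a b c => by rw [E.pre.inn_add_right, map_add, LinearMap.add_apply])
    (fun s a c => by rw [E.pre.inn_smul_right, map_smul, LinearMap.smul_apply])
    (fun a b c => map_add _ _ _) (fun s a c => map_smul _ _ _))

theorem inn_contract (E F : Corr B) (ξ : E) (w : F) (t : E ⊗[ℂ] F) :
    (tensorPre E F).inn (TensorProduct.mk ℂ E F ξ w) t = F.pre.inn w (contract E F ξ t) := by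
  induction t with
  | zero =>
    rw [map_zero, F.pre.inn_zero_right, PreHilbert.inn_zero_right]
  | add t t' h h' => rw [map_add, F.pre.inn_add_right, PreHilbert.inn_add_right, h, h']
  | tmul x y => rfl

theorem nrm_contract_le (E F : Corr B) (ξ : E) (t : E ⊗[ℂ] F) :
    ‖contract E F ξ t‖ ≤ √(‖ξ‖ ^ 2) * (tensorPre E F).nrm t := by
  have h := F.pre.nrm_le_of_adj (tensorPre E F) (TensorProduct.mk ℂ E F ξ) (contract E F ξ)
    (E.inn_contract F ξ) (Real.sqrt_nonneg (‖ξ‖ ^ 2))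
    (fun w => F.pre.nrm_le_of_isPos (tensorPre E F) (sq_nonneg _)
      (E.isPos_sub_act F ξ le_rfl w)) t
  rwa [← HilbertModule.nrm_pre (B := B)]

/-- The map `η ⊗ w ↦ φ(⟨ξ, η⟩) w` on `E ⊗_φ F`. -/
def contractCompl (E F : Corr B) (ξ : E) : (tensorPre E F).Compl →ₗ[ℂ] F :=
  ((tensorPre E F).ext (contract E F ξ) _ (nrm_contract_le E F ξ)).toLinearMap

/-- The maps `w ↦ ξ ⊗ w` and `η ⊗ w ↦ φ(⟨ξ, η⟩) w` between `F` and `E ⊗_φ F`. -/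
def tensorPair (E F : Corr B) (ξ : E) {M : ℝ} (hM : ‖ξ‖ ^ 2 ≤ M) :
    AdjPair F (tensor E F) M where
  up := (tensorPre E F).of ∘ₗ TensorProduct.mk ℂ E F ξ
  down := contractCompl E F ξ
  adj w t := by
    refine (tensorPre E F).induction_on (p := fun t =>
      inn (B := B) ((tensorPre E F).of (TensorProduct.mk ℂ E F ξ w)) t =
        inn w ((tensorPre E F).ext (contract E F ξ) _ (nrm_contract_le E F ξ) t)) t
      (isClosed_eq ?_ ?_) ?_
    · exact HilbertModule.continuous_inn continuous_const continuous_id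
    · exact HilbertModule.continuous_inn continuous_const (ContinuousLinearMap.continuous _)
    · intro t
      rw [PreHilbert.ext_of, PreHilbert.inn_of]
      exact inn_contract E F ξ w t
  pos w := by
    have h := E.isPos_sub_act F ξ hM w
    convert h using 1
    congr 1
    exact (tensorPre E F).inn_of _ _

/-- The tensor powers: `E^{⊗ 0} = B`, `E^{⊗ 1} = E`, `E^{⊗ (n + 2)} = E ⊗_φ E^{⊗ (n + 1)}`. -/
def tensorPow (E : Corr B) : ℕ → Corr B
  | 0 => unit B
  | 1 => E
  | n + 2 => tensor E (tensorPow E (n + 1))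

/-- The elementary tensor `ξ₁ ⊗ ⋯ ⊗ ξ_d`. -/
def tprod (E : Corr B) : (d : ℕ) → (Fin d → E) → tensorPow E d
  | 0, _ => (1 : B)
  | 1, ξ => ξ 0
  | n + 2, ξ => tmul (E := E) (F := tensorPow E (n + 1)) (ξ 0) (tprod E (n + 1) (Fin.tail ξ))

/-- The maps `w ↦ ξ ⊗ w` (`b ↦ ξ b` for `n = 0`) and `η ⊗ w ↦ φ(⟨ξ, η⟩) w` (`η ↦ ⟨ξ, η⟩` for
`n = 0`) between `E^{⊗ n}` and `E^{⊗ (n + 1)}`. -/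
def powPair (E : Corr B) (ξ : E) {M : ℝ} (hM : ‖ξ‖ ^ 2 ≤ M) :
    (n : ℕ) → AdjPair (tensorPow E n) (tensorPow E (n + 1)) M
  | 0 => unitPair E ξ hM
  | n + 1 => tensorPair E (tensorPow E (n + 1)) ξ hM

end Corr

namespace AdjPair

variable {B : Type} [CStarAlgebra B] {F G : Corr B} {M : ℝ}

theorem adj' (p : AdjPair F G M) (x : G) (y : F) :
    F.pre.inn (p.down x) y = G.pre.inn x (p.up y) := by
  rw [← F.pre.star_inn, ← p.adj, G.pre.star_inn]

/-- The pair with the two maps exchanged. -/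
def symm (p : AdjPair F G M) (hM : 0 < M) : AdjPair G F M where
  up := p.down
  down := p.up
  adj := p.adj'
  pos y := by
    obtain ⟨c, hc⟩ := p.pos (p.down y)
    have h1 := G.pre.inn_pos ((M : ℂ) • y - p.up (p.down y))
    have h2 : G.pre.inn ((M : ℂ) • y - p.up (p.down y)) ((M : ℂ) • y - p.up (p.down y)) +
        star c * c = M • (M • G.pre.inn y y - F.pre.inn (p.down y) (p.down y)) := by
      rw [← hc, G.pre.inn_sub_left, G.pre.inn_sub_right, G.pre.inn_sub_right,
        G.pre.inn_smul_real_left, G.pre.inn_smul_real_left, G.pre.inn_smul_real_right,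
        G.pre.inn_smul_real_right, p.adj (p.down y) y, ← p.adj' y (p.down y), smul_sub]
      abel
    have h3 := (h1.add ⟨c, rfl⟩).smul (inv_nonneg.2 hM.le)
    rwa [h2, smul_smul, inv_mul_cancel₀ hM.ne', one_smul] at h3

end AdjPair

end QuantumLens
/-! ### The dual correspondence -/

namespace QuantumLens

open HilbertModule (inn)

namespace Corr

variable {B : Type} [CStarAlgebra B]

/-- The standing assumptions on the pair `(E, φ)`: `B` is separable, `E` is countably generated and
full, and `φ` is an isomorphism from `B` onto the compact operators `𝒦(E)`. -/
structure IsPimsnerPair (E : Corr B) : Prop where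
  separable : TopologicalSpace.SeparableSpace B
  countablyGenerated : ∃ s : Set E, s.Countable ∧ Dense (Submodule.span Bᵐᵒᵖ s : Set E)
  full : Dense (Submodule.span ℂ {b : B | ∃ ξ η : E, b = inn ξ η} : Set B)
  injective : Function.Injective E.φ
  range_eq : Set.range E.φ = compacts B E

variable {E : Corr B}

theorem IsPimsnerPair.exists_theta (h : E.IsPimsnerPair) (ξ η : E) :
    ∃ b : B, E.φ b = theta B ξ η := by
  have h1 : theta B ξ η ∈ Set.range E.φ := by
    rw [h.range_eq]
    exact subset_closure (Submodule.subset_span ⟨ξ, η, rfl⟩)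
  exact h1

/-- The element `φ⁻¹(θ_{ξ,η})` of `B`. -/
def IsPimsnerPair.inv (h : E.IsPimsnerPair) (ξ η : E) : B := (h.exists_theta ξ η).choose

theorem IsPimsnerPair.φ_inv (h : E.IsPimsnerPair) (ξ η : E) : E.φ (h.inv ξ η) = theta B ξ η :=
  (h.exists_theta ξ η).choose_spec

theorem IsPimsnerPair.inv_eq (h : E.IsPimsnerPair) {ξ η : E} {b : B}
    (hb : ∀ ζ, E.act b ζ = E.pre.ract (op (E.pre.inn η ζ)) ξ) : h.inv ξ η = b :=
  h.injective (by rw [h.φ_inv]; exact Adjointable.ext fun ζ => (hb ζ).symm)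

theorem IsPimsnerPair.act_inv (h : E.IsPimsnerPair) (ξ η ζ : E) :
    E.act (h.inv ξ η) ζ = E.pre.ract (op (E.pre.inn η ζ)) ξ := by
  rw [act_apply, h.φ_inv]; rfl

theorem IsPimsnerPair.inv_add (h : E.IsPimsnerPair) (ξ η η' : E) :
    h.inv ξ (η + η') = h.inv ξ η + h.inv ξ η' :=
  h.inv_eq fun ζ => by
    rw [map_add, LinearMap.add_apply, h.act_inv, h.act_inv, E.pre.inn_add_left, op_add, map_add,
      LinearMap.add_apply]

theorem IsPimsnerPair.inv_smul (h : E.IsPimsnerPair) (c : ℂ) (ξ η : E) :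
    h.inv ξ ((starRingEnd ℂ c) • η) = c • h.inv ξ η :=
  h.inv_eq fun ζ => by
    rw [map_smul, LinearMap.smul_apply, h.act_inv, E.pre.inn_smul_left, Complex.conj_conj, op_smul,
      map_smul, LinearMap.smul_apply]

theorem IsPimsnerPair.inv_act (h : E.IsPimsnerPair) (b : B) (ξ η : E) :
    h.inv ξ (E.act (star b) η) = h.inv ξ η * b :=
  h.inv_eq fun ζ => by
    rw [map_mul, Module.End.mul_apply, h.act_inv, E.inn_act, star_star]

theorem IsPimsnerPair.star_inv (h : E.IsPimsnerPair) (ξ η : E) :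
    star (h.inv ξ η) = h.inv η ξ :=
  (h.inv_eq fun ζ => by
    refine HilbertModule.ext_inn B fun ω => ?_
    change E.pre.inn ω (E.act (star (h.inv ξ η)) ζ) = E.pre.inn ω _
    rw [← E.inn_act, h.act_inv, E.pre.inn_ract, E.pre.inn_ract_left, E.pre.star_inn]).symm

theorem IsPimsnerPair.inv_ract (h : E.IsPimsnerPair) (b : B) (ξ η : E) :
    h.inv (E.pre.ract (op (star b)) ξ) η = h.inv ξ (E.pre.ract (op b) η) :=
  h.inv_eq fun ζ => by
    rw [h.act_inv, E.pre.inn_ract_left, op_mul, map_mul, Module.End.mul_apply]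

theorem IsPimsnerPair.inv_pos (h : E.IsPimsnerPair) (ξ : E) : IsPos (h.inv ξ ξ) := by
  refine isPos_of_conj (h.star_inv ξ ξ) fun c e hc he => ?_
  have key : ∀ ζ : E, E.act e ζ = 0 := by
    intro ζ
    have h1 : E.pre.inn ζ (E.act (c * h.inv ξ ξ * c) ζ) =
        star (E.pre.inn (E.act c ξ) ζ) * E.pre.inn (E.act c ξ) ζ := by
      rw [map_mul, map_mul, Module.End.mul_apply, Module.End.mul_apply, h.act_inv, act_ract,
        E.pre.inn_ract, E.pre.star_inn, E.inn_act, hc]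
    have h2 : E.pre.inn ζ (E.act (c * h.inv ξ ξ * c) ζ) =
        -E.pre.inn (E.act e ζ) (E.act e ζ) := by
      rw [he, map_neg, LinearMap.neg_apply, map_mul, Module.End.mul_apply, E.inn_act]
      exact map_neg (E.pre.innL ζ) _
    have h3 : E.pre.inn (E.act e ζ) (E.act e ζ) = 0 := by
      refine isPos_antisymm (E.pre.inn_pos _) ?_
      rw [← h2, h1]
      exact ⟨_, rfl⟩
    have h4 := HilbertModule.norm_sq_eq (B := B) (E.act e ζ)
    change _ = ‖E.pre.inn (E.act e ζ) (E.act e ζ)‖ at h4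
    rw [h3, norm_zero] at h4
    exact norm_eq_zero.1 (pow_eq_zero_iff two_ne_zero |>.1 h4)
  refine h.injective ?_
  rw [map_zero]
  exact Adjointable.ext key

theorem norm_sq (E : Corr B) (ξ : E) : ‖ξ‖ ^ 2 = ‖E.pre.inn ξ ξ‖ :=
  HilbertModule.norm_sq_eq (B := B) ξ

theorem norm_act_le (E : Corr B) (b : B) (ξ : E) : ‖E.act b ξ‖ ≤ ‖b‖ * ‖ξ‖ := by
  have h := PreHilbert.nrm_act_le (P := E.pre) ⟨E.act, E.inn_act⟩ b ξ
  change (HilbertModule.pre B E).nrm _ ≤ _ * (HilbertModule.pre B E).nrm _ at h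
  rwa [HilbertModule.nrm_pre, HilbertModule.nrm_pre] at h

theorem IsPimsnerPair.norm_inv (h : E.IsPimsnerPair) (ξ : E) : ‖ξ‖ ^ 2 = ‖h.inv ξ ξ‖ := by
  apply le_antisymm
  · have h1 : E.pre.inn (E.act (h.inv ξ ξ) ξ) ξ = star (E.pre.inn ξ ξ) * E.pre.inn ξ ξ := by
      rw [h.act_inv, E.pre.inn_ract_left]
    have h2 : (‖ξ‖ ^ 2) * ‖ξ‖ ^ 2 ≤ ‖h.inv ξ ξ‖ * ‖ξ‖ ^ 2 := by
      calc (‖ξ‖ ^ 2) * ‖ξ‖ ^ 2 = ‖E.pre.inn (E.act (h.inv ξ ξ) ξ) ξ‖ := by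
            rw [h1, CStarRing.norm_star_mul_self, norm_sq]
        _ ≤ ‖E.act (h.inv ξ ξ) ξ‖ * ‖ξ‖ := HilbertModule.norm_inn_le _ _
        _ ≤ (‖h.inv ξ ξ‖ * ‖ξ‖) * ‖ξ‖ :=
          mul_le_mul_of_nonneg_right (E.norm_act_le _ _) (norm_nonneg _)
        _ = _ := by ring
    rcases (sq_nonneg ‖ξ‖).eq_or_lt with h0 | h0
    · rw [← h0]; exact norm_nonneg _
    · exact le_of_mul_le_mul_right h2 h0
  · obtain ⟨c, hc⟩ := E.isPos_sq_sub_inn ξ le_rfl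
    have h1 := h.inv_pos (E.pre.ract (op (star c)) ξ)
    have h2 : h.inv (E.pre.ract (op (star c)) ξ) (E.pre.ract (op (star c)) ξ) =
        (‖ξ‖ ^ 2) • h.inv ξ ξ - star (h.inv ξ ξ) * h.inv ξ ξ := by
      refine h.inv_eq fun ζ => ?_
      rw [E.pre.inn_ract_left, ← Module.End.mul_apply, ← map_mul, ← op_mul, star_star, ← mul_assoc,
        ← hc, sub_mul, smul_mul_assoc, one_mul, op_sub, map_sub, map_sub, h.star_inv, map_mul,
        LinearMap.sub_apply, LinearMap.sub_apply, Module.End.mul_apply, h.act_inv, h.act_inv,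
        E.pre.inn_ract]
      congr 1
      have h3 : ((‖ξ‖ ^ 2) • h.inv ξ ξ) = ((‖ξ‖ ^ 2 : ℝ) : ℂ) • h.inv ξ ξ := rfl
      have h4 : ((‖ξ‖ ^ 2) • E.pre.inn ξ ζ) = ((‖ξ‖ ^ 2 : ℝ) : ℂ) • E.pre.inn ξ ζ := rfl
      rw [h3, h4, map_smul, LinearMap.smul_apply, h.act_inv, op_smul, map_smul,
        LinearMap.smul_apply]
    rw [h2] at h1
    have h5 := norm_le_of_isPos ⟨_, rfl⟩ h1
    rw [CStarRing.norm_star_mul_self, norm_smul, Real.norm_of_nonneg (sq_nonneg _)] at h5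
    rcases (norm_nonneg (h.inv ξ ξ)).eq_or_lt with h0 | h0
    · rw [← h0]; exact sq_nonneg _
    · exact le_of_mul_le_mul_right h5 h0

/-- The dual `E*` of `E`: the space of the functionals `λ_ξ = ⟨ξ, ·⟩`, which depend conjugate
linearly on `ξ`. -/
def Dual (E : Corr B) : Type := E.carrier

/-- The functional `λ_ξ`. -/
def lam (ξ : E) : Dual E := ξ

/-- The element `ξ` that represents the functional `λ_ξ`. -/
def unlam (x : Dual E) : E := x

namespace Dual

instance : NormedAddCommGroup (Dual E) := inferInstanceAs (NormedAddCommGroup E.carrier)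
instance : CompleteSpace (Dual E) := inferInstanceAs (CompleteSpace E.carrier)

theorem lam_add (x y : E) : lam (x + y) = lam x + lam y := rfl
theorem unlam_add (x y : Dual E) : unlam (x + y) = unlam x + unlam y := rfl
theorem unlam_zero : unlam (0 : Dual E) = 0 := rfl
theorem lam_zero : lam (0 : E) = 0 := rfl
theorem norm_lam (x : E) : ‖lam x‖ = ‖x‖ := rfl
theorem norm_unlam (x : Dual E) : ‖unlam x‖ = ‖x‖ := rfl
theorem lam_unlam (x : Dual E) : lam (unlam x) = x := rfl
theorem unlam_lam (x : E) : unlam (lam x) = x := rfl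

instance : NormedSpace ℂ (Dual E) where
  smul c x := lam ((starRingEnd ℂ c) • unlam x)
  one_smul x := by
    change lam ((starRingEnd ℂ 1) • unlam x) = x
    rw [map_one, one_smul, lam_unlam]
  mul_smul a b x := by
    change lam ((starRingEnd ℂ (a * b)) • unlam x) =
      lam ((starRingEnd ℂ a) • (starRingEnd ℂ b) • unlam x)
    rw [map_mul, mul_smul]
  smul_zero a := by
    change lam ((starRingEnd ℂ a) • (0 : E)) = 0
    rw [smul_zero, lam_zero]
  smul_add a x y := by
    change lam ((starRingEnd ℂ a) • (unlam x + unlam y)) = _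
    rw [smul_add]; rfl
  add_smul a b x := by
    change lam ((starRingEnd ℂ (a + b)) • unlam x) = _
    rw [map_add, add_smul]; rfl
  zero_smul x := by
    change lam ((starRingEnd ℂ 0) • unlam x) = _
    rw [map_zero, zero_smul]; rfl
  norm_smul_le c x := by
    change ‖lam ((starRingEnd ℂ c) • unlam x)‖ ≤ _
    rw [norm_lam, norm_smul, RCLike.norm_conj, norm_unlam]

theorem smul_def (c : ℂ) (x : Dual E) : c • x = lam ((starRingEnd ℂ c) • unlam x) := rfl

/-- The right action `λ_ξ b = λ_{φ(b*) ξ}`. -/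
instance : Module Bᵐᵒᵖ (Dual E) where
  smul b x := lam (E.act (star (unop b)) (unlam x))
  one_smul x := by
    change lam (E.act (star (1 : B)) (unlam x)) = x
    rw [star_one, map_one]; rfl
  mul_smul a b x := by
    change lam (E.act (star (unop b * unop a)) (unlam x)) =
      lam (E.act (star (unop a)) (E.act (star (unop b)) (unlam x)))
    rw [star_mul, map_mul]; rfl
  smul_zero a := by
    change lam (E.act (star (unop a)) (0 : E)) = 0
    rw [map_zero, lam_zero]
  smul_add a x y := by
    change lam (E.act (star (unop a)) (unlam x + unlam y)) = _
    rw [map_add]; rfl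
  add_smul a b x := by
    change lam (E.act (star (unop a + unop b)) (unlam x)) = _
    rw [star_add, map_add]; rfl
  zero_smul x := by
    change lam (E.act (star (0 : B)) (unlam x)) = _
    rw [star_zero, map_zero]; rfl

theorem op_smul_def (b : B) (x : Dual E) : op b • x = lam (E.act (star b) (unlam x)) := rfl

/-- The inner product `⟨λ_ξ, λ_η⟩ = φ⁻¹(θ_{ξ,η})`. -/
@[reducible] def hilbert (h : E.IsPimsnerPair) : HilbertModule B (Dual E) where
  inn x y := h.inv (unlam x) (unlam y)
  inn_add_right _ _ _ := h.inv_add _ _ _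
  inn_smul_right c _ _ := h.inv_smul c _ _
  inn_op_smul_right b _ _ := h.inv_act b _ _
  star_inn _ _ := h.star_inv _ _
  inn_pos _ := h.inv_pos _
  norm_sq_eq x := h.norm_inv (unlam x)

/-- The map `λ_ξ ↦ λ_{ξ b*}`. -/
def lact (b : B) : Dual E →L[ℂ] Dual E :=
  LinearMap.mkContinuous
    { toFun := fun x => lam (E.pre.ract (op (star b)) (unlam x))
      map_add' := fun x y => by rw [unlam_add, map_add, lam_add]
      map_smul' := fun c x => by
        rw [smul_def, unlam_lam, map_smul]; rfl }
    ‖b‖ fun x => by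
      have h := HilbertModule.norm_op_smul_le (star b) (unlam x)
      rw [norm_star] at h
      exact h

theorem lact_apply (b : B) (x : Dual E) :
    lact b x = lam (E.pre.ract (op (star b)) (unlam x)) := rfl

end Dual

/-- The correspondence `E*`, with `⟨λ_ξ, λ_η⟩ = φ⁻¹(θ_{ξ,η})`, `λ_ξ b = λ_{φ(b*) ξ}` and the left
action `φ*(b) λ_ξ = λ_{ξ b*}`. -/
def dual (E : Corr B) (h : E.IsPimsnerPair) : Corr B :=
  letI := Dual.hilbert h
  { carrier := Dual E
    φ :=
      { toFun := fun b => Adjointable.mk (Dual.lact b) (Dual.lact (star b)) fun x y => by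
          change h.inv (E.pre.ract (op (star b)) (unlam x)) (unlam y) =
            h.inv (unlam x) (E.pre.ract (op (star (star b))) (unlam y))
          rw [h.inv_ract, star_star]
        map_one' := Adjointable.ext fun x => by
          change lam (E.pre.ract (op (star (1 : B))) (unlam x)) = x
          rw [star_one, op_one, map_one]; rfl
        map_mul' := fun a b => Adjointable.ext fun x => by
          change lam (E.pre.ract (op (star (a * b))) (unlam x)) =
            lam (E.pre.ract (op (star a)) (E.pre.ract (op (star b)) (unlam x)))
          rw [star_mul, op_mul, map_mul]; rfl
        map_zero' := Adjointable.ext fun x => by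
          change lam (E.pre.ract (op (star (0 : B))) (unlam x)) = 0
          rw [star_zero, op_zero, map_zero]; rfl
        map_add' := fun a b => Adjointable.ext fun x => by
          change lam (E.pre.ract (op (star (a + b))) (unlam x)) =
            lam (E.pre.ract (op (star a)) (unlam x)) + lam (E.pre.ract (op (star b)) (unlam x))
          rw [star_add, op_add, map_add]; rfl
        commutes' := fun c => Adjointable.ext fun x => by
          change lam (E.pre.ract (op (star (algebraMap ℂ B c))) (unlam x)) =
            lam ((starRingEnd ℂ c) • unlam x)
          rw [← algebraMap_star_comm, ← MulOpposite.algebraMap_apply, AlgHom.commutes]; rfl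
        map_star' := fun b => (Adjointable.star_eq fun x y => by
          change h.inv (E.pre.ract (op (star b)) (unlam x)) (unlam y) =
            h.inv (unlam x) (E.pre.ract (op (star (star b))) (unlam y))
          rw [h.inv_ract, star_star]).symm } }

end Corr

end QuantumLens
/-! ### The Pimsner algebra -/

namespace QuantumLens

open HilbertModule (inn)
open scoped DirectSum

namespace Corr

variable {B : Type} [CStarAlgebra B]

section directSum

variable {ι : Type} (F : ι → Corr B)

/-- The inner product `∑ₙ ⟨xₙ, yₙ⟩` on the algebraic direct sum. -/
def sumInn (x y : ⨁ n, F n) : B := ∑ᶠ n, (F n).pre.inn (x n) (y n)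

theorem sumInn_eq (x y : ⨁ n, F n) (s : Finset ι) (hs : ∀ n ∉ s, x n = 0 ∨ y n = 0) :
    sumInn F x y = ∑ n ∈ s, (F n).pre.inn (x n) (y n) := by
  refine finsum_eq_sum_of_support_subset _ fun n hn => ?_
  by_contra h
  refine hn ?_
  change (F n).pre.inn (x n) (y n) = 0
  rcases hs n h with h0 | h0
  · rw [h0, ← (F n).pre.star_inn, (F n).pre.inn_zero_right, star_zero]
  · rw [h0, (F n).pre.inn_zero_right]

theorem exists_finset (x : ⨁ n, F n) : ∃ s : Finset ι, ∀ n ∉ s, x n = 0 := by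
  refine ⟨(DFinsupp.finite_support x).toFinset, fun n hn => ?_⟩
  by_contra h
  exact hn ((Set.Finite.mem_toFinset _).2 h)

/-- The right action on the algebraic direct sum. -/
def sumRact : Bᵐᵒᵖ →ₐ[ℂ] Module.End ℂ (⨁ n, F n) where
  toFun b := DirectSum.lmap fun n => (F n).pre.ract b
  map_one' := LinearMap.ext fun x => DFinsupp.ext fun n => by
    change (F n).pre.ract 1 (x n) = x n
    rw [map_one]; rfl
  map_mul' a b := LinearMap.ext fun x => DFinsupp.ext fun n => by
    change (F n).pre.ract (a * b) (x n) = (F n).pre.ract a ((F n).pre.ract b (x n))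
    rw [map_mul]; rfl
  map_zero' := LinearMap.ext fun x => DFinsupp.ext fun n => by
    change (F n).pre.ract 0 (x n) = 0
    rw [map_zero]; rfl
  map_add' a b := LinearMap.ext fun x => DFinsupp.ext fun n => by
    change (F n).pre.ract (a + b) (x n) = (F n).pre.ract a (x n) + (F n).pre.ract b (x n)
    rw [map_add]; rfl
  commutes' c := LinearMap.ext fun x => DFinsupp.ext fun n => by
    change (F n).pre.ract (algebraMap ℂ _ c) (x n) = c • x n
    rw [AlgHom.commutes]; rfl

theorem sumRact_apply (b : Bᵐᵒᵖ) (x : ⨁ n, F n) (n : ι) :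
    sumRact F b x n = (F n).pre.ract b (x n) := rfl

/-- The algebraic direct sum as a pre-Hilbert module. -/
def sumPre : PreHilbert B (⨁ n, F n) where
  inn := sumInn F
  ract := sumRact F
  inn_add_right x y z := by
    obtain ⟨s, hs⟩ := exists_finset F x
    rw [sumInn_eq F x (y + z) s fun n hn => .inl (hs n hn),
      sumInn_eq F x y s fun n hn => .inl (hs n hn), sumInn_eq F x z s fun n hn => .inl (hs n hn),
      ← Finset.sum_add_distrib]
    exact Finset.sum_congr rfl fun n _ => (F n).pre.inn_add_right _ _ _
  inn_smul_right c x y := by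
    obtain ⟨s, hs⟩ := exists_finset F x
    rw [sumInn_eq F x (c • y) s fun n hn => .inl (hs n hn),
      sumInn_eq F x y s fun n hn => .inl (hs n hn), Finset.smul_sum]
    exact Finset.sum_congr rfl fun n _ => (F n).pre.inn_smul_right _ _ _
  inn_ract b x y := by
    obtain ⟨s, hs⟩ := exists_finset F x
    rw [sumInn_eq F x _ s fun n hn => .inl (hs n hn),
      sumInn_eq F x y s fun n hn => .inl (hs n hn), Finset.sum_mul]
    exact Finset.sum_congr rfl fun n _ => (F n).pre.inn_ract _ _ _
  star_inn x y := by
    obtain ⟨s, hs⟩ := exists_finset F x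
    rw [sumInn_eq F x y s fun n hn => .inl (hs n hn),
      sumInn_eq F y x s fun n hn => .inr (hs n hn), star_sum]
    exact Finset.sum_congr rfl fun n _ => (F n).pre.star_inn _ _
  inn_pos x := by
    obtain ⟨s, hs⟩ := exists_finset F x
    rw [sumInn_eq F x x s fun n hn => .inl (hs n hn)]
    exact isPos_sum _ _ fun n _ => (F n).pre.inn_pos _

theorem sumPre_inn_lof [DecidableEq ι] (n : ι) (a : F n) (y : ⨁ n, F n) :
    (sumPre F).inn (DirectSum.lof ℂ ι (fun n => F n) n a) y = (F n).pre.inn a (y n) := by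
  refine (sumInn_eq F _ y {n} fun m hm => .inl ?_).trans ?_
  · exact DirectSum.of_eq_of_ne _ _ _ (by simpa using hm)
  · rw [Finset.sum_singleton, DirectSum.lof_apply]

end directSum

section shift

variable {F : ℤ → Corr B} {M : ℝ} (p : ∀ n, AdjPair (F n) (F (n + 1)) M)

/-- The shift operator with components `up : F n → F (n + 1)` on the algebraic direct sum. -/
def shiftUp : (⨁ n, F n) →ₗ[ℂ] ⨁ n, F n :=
  DirectSum.toModule ℂ ℤ _ fun n => DirectSum.lof ℂ ℤ (fun n => F n) (n + 1) ∘ₗ (p n).up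

theorem shiftUp_lof (n : ℤ) (a : F n) :
    shiftUp p (DirectSum.lof ℂ ℤ (fun n => F n) n a) =
      DirectSum.lof ℂ ℤ (fun n => F n) (n + 1) ((p n).up a) :=
  DirectSum.toModule_lof (M := fun n => (F n : Type)) ℂ n a

theorem shiftUp_apply (x : ⨁ n, F n) (n : ℤ) : shiftUp p x (n + 1) = (p n).up (x n) := by
  induction x using DirectSum.induction_on with
  | zero => rw [map_zero]; exact (map_zero (p n).up).symm
  | add x y hx hy =>
    rw [map_add, DirectSum.add_apply, DirectSum.add_apply, map_add, hx, hy]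
  | of m a =>
    have h := shiftUp_lof p m a
    change shiftUp p (DirectSum.of (fun n => (F n : Type)) m a) = _ at h
    rw [h]
    rcases eq_or_ne m n with rfl | hmn
    · rw [DirectSum.lof_apply, DirectSum.of_eq_same]
    · rw [DirectSum.of_eq_of_ne _ _ _ hmn.symm, map_zero]
      exact DirectSum.of_eq_of_ne _ _ _ fun h => hmn (by omega)

/-- The shift operator with components `down : F (n + 1) → F n` on the algebraic direct sum. -/
def shiftDown : (⨁ n, F n) →ₗ[ℂ] ⨁ n, F n :=
  DirectSum.lmap (fun n => (p n).down) ∘ₗ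
    ({ toFun := DFinsupp.comapDomain (fun n : ℤ => n + 1) (add_left_injective 1)
       map_add' := DFinsupp.comapDomain_add _ _
       map_smul' := DFinsupp.comapDomain_smul _ _ } : (⨁ n, F n) →ₗ[ℂ] ⨁ n, F (n + 1))

theorem shiftDown_apply (x : ⨁ n, F n) (n : ℤ) : shiftDown p x n = (p n).down (x (n + 1)) := rfl

theorem shift_adj (x y : ⨁ n, F n) :
    (sumPre F).inn (shiftUp p x) y = (sumPre F).inn x (shiftDown p y) := by
  induction x using DirectSum.induction_on with
  | zero =>
    have h0 : ∀ z, (sumPre F).inn 0 z = 0 := fun z => by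
      rw [← (sumPre F).star_inn, (sumPre F).inn_zero_right, star_zero]
    rw [map_zero, h0, h0]
  | add x x' hx hx' => rw [map_add, PreHilbert.inn_add_left, PreHilbert.inn_add_left, hx, hx']
  | of m a =>
    change (sumPre F).inn (shiftUp p (DirectSum.lof ℂ ℤ (fun n => F n) m a)) y =
      (sumPre F).inn (DirectSum.lof ℂ ℤ (fun n => F n) m a) _
    rw [shiftUp_lof, sumPre_inn_lof, sumPre_inn_lof, (p m).adj, shiftDown_apply]

theorem nrm_shiftUp_le (hM : 0 ≤ M) (x : ⨁ n, F n) :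
    (sumPre F).nrm (shiftUp p x) ≤ √M * (sumPre F).nrm x := by
  refine (sumPre F).nrm_le_of_isPos (sumPre F) hM ?_
  rw [shift_adj]
  obtain ⟨s, hs⟩ := exists_finset F x
  change IsPos (M • sumInn F x x - sumInn F x _)
  rw [sumInn_eq F x x s fun n hn => .inl (hs n hn), sumInn_eq F x _ s fun n hn => .inl (hs n hn),
    Finset.smul_sum, ← Finset.sum_sub_distrib]
  refine isPos_sum _ _ fun n _ => ?_
  rw [shiftDown_apply, shiftUp_apply, ← (p n).adj]
  exact (p n).pos (x n)

/-- The shift operator with components `up : F n → F (n + 1)` on the Hilbert module direct sum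
of the `F n`. -/
def shift (hM : 0 ≤ M) : Adjointable B (sumPre F).Compl :=
  (sumPre F).liftAdj (shiftUp p) (shiftDown p) (shift_adj p) (Real.sqrt_nonneg M)
    (nrm_shiftUp_le p hM)

end shift

variable (E : Corr B) (h : E.IsPimsnerPair)

/-- The modules `E^{(n)}`: `E^{⊗ n}` for `n ≥ 0` (which is `B` for `n = 0`) and
`(E*)^{⊗ (-n)}` for `n < 0`. -/
def fockMod : ℤ → Corr B
  | Int.ofNat n => tensorPow E n
  | Int.negSucc n => tensorPow (dual E h) (n + 1)

theorem norm_sq_le_succ (ξ : E) : ‖ξ‖ ^ 2 ≤ ‖ξ‖ ^ 2 + 1 := le_add_of_nonneg_right zero_le_one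

theorem norm_sq_succ_pos (ξ : E) : 0 < ‖ξ‖ ^ 2 + 1 := by positivity

theorem norm_sq_lam_le_succ (ξ : E) : ‖(lam ξ : dual E h)‖ ^ 2 ≤ ‖ξ‖ ^ 2 + 1 :=
  norm_sq_le_succ E ξ

/-- The components `E^{(n)} → E^{(n + 1)}` of `S_ξ`, with their adjoints. They are `w ↦ ξ ⊗ w` for
`n ≥ 0` (`b ↦ ξ b` for `n = 0`) and `λ_η ⊗ w ↦ φ*(⟨λ_ξ, λ_η⟩) w` for `n < 0`
(`λ_η ↦ ⟨λ_ξ, λ_η⟩` for `n = -1`), where `⟨λ_ξ, λ_η⟩ = φ⁻¹(θ_{ξ,η})`. -/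
def fockPair (ξ : E) : ∀ n : ℤ, AdjPair (fockMod E h n) (fockMod E h (n + 1)) (‖ξ‖ ^ 2 + 1)
  | Int.ofNat n => E.powPair ξ (norm_sq_le_succ E ξ) n
  | Int.negSucc 0 =>
    ((dual E h).powPair (lam ξ) (norm_sq_lam_le_succ E h ξ) 0).symm (norm_sq_succ_pos E ξ)
  | Int.negSucc (n + 1) =>
    ((dual E h).powPair (lam ξ) (norm_sq_lam_le_succ E h ξ) (n + 1)).symm (norm_sq_succ_pos E ξ)

/-- The Hilbert module `E_∞`, the direct sum of the `E^{(n)}`, `n ∈ ℤ`. -/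
abbrev Fock : Type := (sumPre (fockMod E h)).Compl

/-- The operator `S_ξ` on `E_∞`. -/
def S (ξ : E) : Adjointable B (Fock E h) := shift (fockPair E h ξ) (norm_sq_succ_pos E ξ).le

/-- The Pimsner algebra of `E`: the smallest C*-subalgebra of `ℒ(E_∞)` that contains all `S_ξ`. -/
def pimsner : NonUnitalStarSubalgebra ℂ (Adjointable B (Fock E h)) :=
  (NonUnitalStarAlgebra.adjoin ℂ (Set.range (S E h))).topologicalClosure

theorem S_mem_pimsner (ξ : E) : S E h ξ ∈ pimsner E h :=
  NonUnitalStarSubalgebra.le_topologicalClosure _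
    (NonUnitalStarAlgebra.subset_adjoin ℂ _ ⟨ξ, rfl⟩)

/-- The Pimsner algebra, as a C*-algebra. -/
def PimsnerAlg : Type := pimsner E h

instance : NonUnitalCStarAlgebra (PimsnerAlg E h) :=
  NonUnitalStarSubalgebra.nonUnitalCStarAlgebra (pimsner E h)
    (h_closed := NonUnitalStarSubalgebra.isClosed_topologicalClosure _)

/-- The generator `S_ξ` of the Pimsner algebra. -/
def pimsnerS (ξ : E) : PimsnerAlg E h := (⟨S E h ξ, S_mem_pimsner E h ξ⟩ : pimsner E h)

end Corr

end QuantumLens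
/-! ### The correspondence of the quantum weighted projective line -/

namespace QuantumLens

section lineCorr

variable {q : ℝ} {k l : ℕ}

/-- The space `E`, the closure of `𝒜₍₁₎(k,l)` in `C(S_q³)`. -/
abbrev LineSpace (q : ℝ) (k l : ℕ) : Type := lineC q k l

instance : CompleteSpace (LineSpace q k l) :=
  (Submodule.isClosed_topologicalClosure _ : IsClosed (lineC q k l : Set (CSphere q))).completeSpace_coe

/-- The right action of `B` on `E` by multiplication in `C(S_q³)`. -/
instance : Module (projC q k l)ᵐᵒᵖ (LineSpace q k l) where
  smul b ξ := ⟨ξ.1 * (unop b).1, lineC_mul_projC ξ.2 (unop b).2⟩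
  one_smul ξ := Subtype.ext (mul_one ξ.1)
  mul_smul a b ξ := Subtype.ext (mul_assoc ξ.1 (unop b).1 (unop a).1).symm
  smul_zero b := Subtype.ext (zero_mul (unop b).1)
  smul_add b ξ η := Subtype.ext (add_mul ξ.1 η.1 (unop b).1)
  add_smul a b ξ := Subtype.ext (mul_add ξ.1 (unop a).1 (unop b).1)
  zero_smul ξ := Subtype.ext (mul_zero ξ.1)

/-- `E` is a Hilbert module over `B`, with `⟨ξ, η⟩ = ξ* η`. -/
instance : HilbertModule (projC q k l) (LineSpace q k l) where
  inn ξ η := ⟨star ξ.1 * η.1, star_lineC_mul_lineC ξ.2 η.2⟩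
  inn_add_right ξ η ζ := Subtype.ext (mul_add (star ξ.1) η.1 ζ.1)
  inn_smul_right c ξ η := Subtype.ext (mul_smul_comm c (star ξ.1) η.1)
  inn_op_smul_right b ξ η := Subtype.ext (mul_assoc (star ξ.1) η.1 b.1).symm
  star_inn ξ η := Subtype.ext (by
    change star (star ξ.1 * η.1) = star η.1 * ξ.1
    rw [star_mul, star_star])
  inn_pos ξ := by
    refine isPos_of_conj (Subtype.ext ?_) fun c e hc he => ?_
    · change star (star ξ.1 * ξ.1) = star ξ.1 * ξ.1
      rw [star_mul, star_star]
    · have hc' : star c.1 = c.1 := congrArg Subtype.val hc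
      have he' : c.1 * (star ξ.1 * ξ.1) * c.1 = -(star e.1 * e.1) := congrArg Subtype.val he
      have h1 : star (ξ.1 * c.1) * (ξ.1 * c.1) = -(star e.1 * e.1) := by
        rw [← he', star_mul, hc']; simp only [mul_assoc]
      have h2 : star e.1 * e.1 = 0 := isPos_antisymm ⟨e.1, rfl⟩ ⟨ξ.1 * c.1, h1.symm⟩
      exact Subtype.ext ((CStarRing.star_mul_self_eq_zero_iff _).1 h2)
  norm_sq_eq ξ := by
    change ‖ξ.1‖ ^ 2 = ‖star ξ.1 * ξ.1‖
    rw [CStarRing.norm_star_mul_self, sq]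

/-- The left multiplication by an element of `B`. -/
def leftMul (hq : 0 < q) (b : projC q k l) : LineSpace q k l →L[ℂ] LineSpace q k l :=
  LinearMap.mkContinuous
    { toFun := fun ξ => ⟨b.1 * ξ.1, projC_mul_lineC hq b.2 ξ.2⟩
      map_add' := fun ξ η => Subtype.ext (mul_add b.1 ξ.1 η.1)
      map_smul' := fun c ξ => Subtype.ext (mul_smul_comm c b.1 ξ.1) }
    ‖b‖ fun ξ => norm_mul_le b.1 ξ.1

theorem leftMul_coe (hq : 0 < q) (b : projC q k l) (ξ : LineSpace q k l) :
    (leftMul hq b ξ : CSphere q) = b.1 * ξ.1 := rfl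

theorem leftMul_adj (hq : 0 < q) (b : projC q k l) (ξ η : LineSpace q k l) :
    HilbertModule.inn (B := projC q k l) (leftMul hq b ξ) η =
      HilbertModule.inn ξ (leftMul hq (star b) η) :=
  Subtype.ext (by
    change star (b.1 * ξ.1) * η.1 = star ξ.1 * (star b.1 * η.1)
    rw [star_mul, mul_assoc])

/-- The correspondence `E` over `B`: the closure of `𝒜₍₁₎(k,l)` in `C(S_q³)`, with the inner product
`⟨ξ, η⟩ = ξ* η` and the left and right multiplication by elements of `B`. -/
def lineCorr (q : ℝ) (hq : 0 < q) (k l : ℕ) : Corr (projC q k l) where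
  carrier := LineSpace q k l
  φ :=
    { toFun := fun b => Adjointable.mk (leftMul hq b) (leftMul hq (star b)) (leftMul_adj hq b)
      map_one' := Adjointable.ext fun ξ => Subtype.ext (one_mul ξ.1)
      map_mul' := fun a b => Adjointable.ext fun ξ => Subtype.ext (mul_assoc a.1 b.1 ξ.1)
      map_zero' := Adjointable.ext fun ξ => Subtype.ext (zero_mul ξ.1)
      map_add' := fun a b => Adjointable.ext fun ξ => Subtype.ext (add_mul a.1 b.1 ξ.1)
      commutes' := fun c => Adjointable.ext fun ξ => Subtype.ext (Algebra.smul_def c ξ.1).symm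
      map_star' := fun b => (Adjointable.star_eq (leftMul_adj hq b)).symm }

end lineCorr

end QuantumLens

end

universe u

open QuantumLens QuantumLens.Corr

/-! Everything takes place inside `C(S_q³)`, graded by the weighted circle action. Write `b = z₁
z₁*`. The products `f(b) z₀^α z₁^β`, where negative exponents stand for powers of the adjoint, span
the coordinate algebra (`span_monom`) and are eigenvectors of the whole 2-torus. Averaging over the
circle is contractive and faithful: if the mean of `x* x` vanishes then `x = 0`
(`eq_zero_of_circleAvg_star_mul_self`, `eq_zero_of_circleMean`).

(i) Let `ρ` be a representation of `𝒪(W_q(k,l))`. The element `a = z₀ˡ (z₁*)ᵏ` has weight zero,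
satisfies `b a = q⁻²ˡ a b`, and `a* a` is a polynomial in `b` whose zeros lie in `{0} ∪ {q²ⁿ⁺² : n ≥
0}`. Hence a point of the spectrum of `ρ(b)` outside this set could be multiplied by `q⁻²ˡ` again
and again without leaving the spectrum, which is bounded (`spectrum_map_pB_subset`). On the other
hand, an explicit weighted shift representation shows that the whole set lies in the spectrum of `b`
in `C(S_q³)`. So `‖ρ(f(b))‖ ≤ ‖f(b)‖` for all polynomials `f` (`norm_map_aeval_pB_le`). The algebra
`ℂ[b]` is the image of the conditional expectation given by rotating `z₀` alone. In the closed
algebra generated by the pairs of `x` and the orbit function `w ↦ ρ(w·x)`, the mean of the second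
entry is therefore dominated by the mean of the first. Faithfulness of the mean makes the projection
to the first entry injective (`orbitFst_injective`), hence an isomorphism onto `B`. Its inverse
followed by evaluation of the orbit at `1` extends `ρ` (`isEnveloping_projOf`).

(ii) Let `cwt n` be the closure of the elements of weight `n`, so that `cwt 0` is `B` and `cwt
(-kl)` is `E`. Since `z₀ⁿ (z₀*)ⁿ` and `(z₀*)ⁿ z₀ⁿ` are polynomials in `b` with constant term `1`,
they are coprime to every power of `b`. A Bezout identity then writes `1 = ∑ uᵢ vᵢ` with finitely
many `uᵢ` of weight `n` and `vᵢ` of weight `-n`, for every multiple `n` of `kl`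
(`isFullWeight_of_dvd`). This identity makes each `cwt n` a finitely generated full module on which
`B` acts exactly by the compact operators. It also shows that tensor products and duals of such
modules are again weight spaces, tensors becoming products and `λ_ξ` becoming `ξ*`
(`Realization.tensor`, `Realization.dual`). The Fock module of `F = E^{⊗d}` is thus the Hilbert
module sum of the spaces `cwt (-jdkl)`, `j ∈ ℤ`, and `S_ξ` is left multiplication by `ξ`. Consider
the closed algebra generated by the pairs `(S_ξ, ξ)`. The matrix coefficients of the operator in a
pair are circle means of products with the second entry (`inn_of_mem_pairAlg`), so faithfulness
shows that one entry vanishes if and only if the other does (`fst_eq_zero_iff`). Both projections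
are then isomorphisms, and the Pimsner algebra is the C*-algebra generated by `F` in `C(S_q³)`.
Averaging over the roots of unity of order `dkl` identifies the latter with the lens space
(`lensAlg_eq_genAlg`). -/

noncomputable section
open MulOpposite

namespace QuantumLens

open SphereAlg Polynomial

/-! ### Spanning monomials of the coordinate algebra -/

section monomials

variable {q : ℝ}

/-- The powers `z i ^ n` for `n ≥ 0` and `(z i)* ^ (-n)` for `n < 0`. -/
def zpw (i : Fin 2) : ℤ → SphereAlg q
  | Int.ofNat n => z i ^ n
  | Int.negSucc n => star (z i) ^ (n + 1)

theorem zpw_natCast (i : Fin 2) (n : ℕ) : (zpw i (n : ℤ) : SphereAlg q) = z i ^ n := rfl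

theorem zpw_neg_natCast (i : Fin 2) (n : ℕ) :
    (zpw i (-(n : ℤ)) : SphereAlg q) = star (z i) ^ n := by
  cases n with
  | zero => rw [Nat.cast_zero, neg_zero, pow_zero]; exact pow_zero (z i)
  | succ n => rfl

/-- A cancellation occurs only for negative exponents, where one factor `z i` meets one adjoint and
leaves `f(b)`. This is why the coefficients of the monomials must be polynomials in `b` and not
scalars. -/
theorem z_mul_zpw {i : Fin 2} {f : ℂ[X]} (hf : z i * star (z i) = aeval (bElt q) f) (n : ℤ) :
    ∃ g : ℂ[X], z i * zpw i n = aeval (bElt q) g * zpw i (n + 1) := by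
  obtain ⟨m, rfl | rfl⟩ := n.eq_nat_or_neg
  · refine ⟨1, ?_⟩
    rw [map_one, one_mul, zpw_natCast, ← pow_succ']; rfl
  · cases m with
    | zero => exact ⟨1, by rw [map_one, one_mul, Nat.cast_zero, neg_zero]; exact (pow_succ' (z i) 0).symm⟩
    | succ m =>
      refine ⟨f, ?_⟩
      rw [zpw_neg_natCast, pow_succ', ← mul_assoc, hf, ← zpw_neg_natCast]
      congr 2
      push_cast; ring

theorem star_z_mul_zpw {i : Fin 2} {f : ℂ[X]} (hf : star (z i) * z i = aeval (bElt q) f) (n : ℤ) :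
    ∃ g : ℂ[X], star (z i) * zpw i n = aeval (bElt q) g * zpw i (n - 1) := by
  obtain ⟨m, rfl | rfl⟩ := n.eq_nat_or_neg
  · cases m with
    | zero =>
      refine ⟨1, ?_⟩
      rw [map_one, one_mul, Nat.cast_zero, zero_sub]
      have h := zpw_neg_natCast (q := q) i 1
      rw [Nat.cast_one] at h
      rw [h, pow_one]
      change star (z i) * z i ^ 0 = _
      rw [pow_zero, mul_one]
    | succ m =>
      refine ⟨f, ?_⟩
      rw [zpw_natCast, pow_succ', ← mul_assoc, hf, ← zpw_natCast]
      congr 2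
      push_cast; ring
  · refine ⟨1, ?_⟩
    rw [map_one, one_mul, zpw_neg_natCast, ← pow_succ', ← zpw_neg_natCast]
    congr 1
    push_cast; ring

theorem mul_pow_of_qcomm {A : Type*} [Ring A] [Algebra ℂ A] {x y : A} {c : ℂ}
    (h : x * y = c • (y * x)) (n : ℕ) : x * y ^ n = c ^ n • (y ^ n * x) := by
  induction n with
  | zero => simp
  | succ n ih =>
    rw [pow_succ, ← mul_assoc, ih, smul_mul_assoc, mul_assoc, h, mul_smul_comm, smul_smul,
      ← mul_assoc, ← pow_succ]

theorem pow_mul_of_qcomm {A : Type*} [Ring A] [Algebra ℂ A] {x y : A} {c : ℂ}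
    (h : x * y = c • (y * x)) (n : ℕ) : x ^ n * y = c ^ n • (y * x ^ n) := by
  induction n with
  | zero => simp
  | succ n ih =>
    rw [pow_succ', mul_assoc, ih, mul_smul_comm, ← mul_assoc, h, smul_mul_assoc, smul_smul,
      mul_assoc, ← pow_succ, ← pow_succ']

theorem mul_zpw_of_qcomm {i : Fin 2} {x : SphereAlg q} {c c' : ℂ} (h : x * z i = c • (z i * x))
    (h' : x * star (z i) = c' • (star (z i) * x)) (n : ℤ) :
    ∃ e : ℂ, x * zpw i n = e • (zpw i n * x) := by
  obtain ⟨m, rfl | rfl⟩ := n.eq_nat_or_neg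
  · exact ⟨_, by rw [zpw_natCast]; exact mul_pow_of_qcomm h m⟩
  · exact ⟨_, by rw [zpw_neg_natCast]; exact mul_pow_of_qcomm h' m⟩

/-- Moving `x` past `b` rescales the variable, so `g(X) = f(cX)`. -/
theorem mul_aeval_of_qcomm {A : Type*} [Ring A] [Algebra ℂ A] {x b : A} {c : ℂ}
    (h : x * b = c • (b * x)) (f : ℂ[X]) : ∃ g : ℂ[X], x * aeval b f = aeval b g * x := by
  refine ⟨f.comp (C c * X), ?_⟩
  rw [aeval_comp, map_mul, aeval_C, aeval_X, ← Algebra.smul_def]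
  induction f using Polynomial.induction_on' with
  | add f g hf hg => rw [map_add, map_add, mul_add, add_mul, hf, hg]
  | monomial n a =>
    rw [aeval_monomial, aeval_monomial, ← mul_assoc, ← Algebra.commutes, mul_assoc,
      mul_pow_of_qcomm h, _root_.smul_pow]
    simp only [smul_mul_assoc, mul_smul_comm, mul_assoc]

theorem z0_mul_star_z0 : z 0 * star (z 0) = 1 - bElt q :=
  eq_sub_of_add_eq (isSpherePair_z (q := q)).sphere

theorem star_z1_mul_z1 : star (z 1) * z 1 = bElt q := (isSpherePair_z (q := q)).normal_one.symm

theorem star_bElt : star (bElt q) = bElt q := by rw [bElt, star_mul, star_star]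

theorem star_z0_mul_b (hq : q ≠ 0) :
    star (z 0) * bElt q = ((q : ℂ) ^ 2)⁻¹ • (bElt q * star (z 0)) := by
  have hq2 : star (((q : ℂ) ^ 2)⁻¹) = ((q : ℂ) ^ 2)⁻¹ := by
    rw [star_inv₀, star_pow]; congr 2; exact Complex.conj_ofReal q
  have h := congrArg star (b_mul_z0 hq)
  rw [star_mul, star_smul, star_mul, star_bElt, hq2] at h
  exact h

theorem z1_mul_b : z 1 * bElt q = (1 : ℂ) • (bElt q * z 1) := by
  rw [one_smul, bElt, mul_assoc, star_z1_mul_z1, bElt]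

theorem star_z1_mul_b : star (z 1) * bElt q = (1 : ℂ) • (bElt q * star (z 1)) := by
  have h : star (z 1) * bElt q = bElt q * star (z 1) := by
    rw [bElt, ← mul_assoc, star_z1_mul_z1]; rfl
  rw [one_smul, h]

variable (q) in
/-- The monomials `f(b) z₀^α z₁^β`. -/
def monom (p : ℂ[X] × ℤ × ℤ) : SphereAlg q := aeval (bElt q) p.1 * (zpw 0 p.2.1 * zpw 1 p.2.2)

theorem mul_mem_span_monom {x : SphereAlg q} (h : ∀ p, ∃ e : ℂ, ∃ p', x * monom q p = e • monom q p')
    {y : SphereAlg q} (hy : y ∈ Submodule.span ℂ (Set.range (monom q))) :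
    x * y ∈ Submodule.span ℂ (Set.range (monom q)) := by
  induction hy using Submodule.span_induction with
  | mem y hy =>
    obtain ⟨p, rfl⟩ := hy
    obtain ⟨e, p', h⟩ := h p
    rw [h]
    exact Submodule.smul_mem _ _ (Submodule.subset_span ⟨p', rfl⟩)
  | zero => rw [mul_zero]; exact zero_mem _
  | add y y' _ _ h h' => rw [mul_add]; exact add_mem h h'
  | smul c y _ h => rw [mul_smul_comm]; exact Submodule.smul_mem _ _ h

/-- For `x = z₀` or `z₀*`, with shift `s = ±1`: after passing `f(b)` the letter is already next to
the power of `z₀`. -/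
theorem mul_monom_zero {x : SphereAlg q} {c : ℂ} (hb : x * bElt q = c • (bElt q * x))
    {s : ℤ} (h : ∀ n, ∃ g : ℂ[X], x * zpw 0 n = aeval (bElt q) g * zpw 0 (n + s))
    (p : ℂ[X] × ℤ × ℤ) : ∃ e : ℂ, ∃ p', x * monom q p = e • monom q p' := by
  obtain ⟨f, α, β⟩ := p
  obtain ⟨g, hg⟩ := mul_aeval_of_qcomm hb f
  obtain ⟨g', hg'⟩ := h α
  refine ⟨1, ⟨g * g', α + s, β⟩, ?_⟩
  rw [one_smul, monom, monom, ← mul_assoc, hg, map_mul, mul_assoc, ← mul_assoc x, hg']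
  simp only [mul_assoc]

/-- For `x = z₁` or `z₁*`: the letter also has to cross the power of `z₀`, at the price of a scalar,
and the polynomial created by the power of `z₁` has to be carried back to the left, which is what
`h₀` is for. -/
theorem mul_monom_one {x : SphereAlg q} {c : ℂ} (hb : x * bElt q = c • (bElt q * x))
    {c₁ c₂ : ℂ} (h₁ : x * z 0 = c₁ • (z 0 * x)) (h₂ : x * star (z 0) = c₂ • (star (z 0) * x))
    {s : ℤ} (h : ∀ n, ∃ g : ℂ[X], x * zpw 1 n = aeval (bElt q) g * zpw 1 (n + s))
    (h₀ : ∀ (g : ℂ[X]) (n : ℤ), ∃ g' : ℂ[X],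
      zpw 0 n * aeval (bElt q) g = aeval (bElt q) g' * zpw 0 n)
    (p : ℂ[X] × ℤ × ℤ) : ∃ e : ℂ, ∃ p', x * monom q p = e • monom q p' := by
  obtain ⟨f, α, β⟩ := p
  obtain ⟨g, hg⟩ := mul_aeval_of_qcomm hb f
  obtain ⟨e, he⟩ := mul_zpw_of_qcomm h₁ h₂ α
  obtain ⟨g', hg'⟩ := h β
  obtain ⟨g'', hg''⟩ := h₀ g' α
  refine ⟨e, ⟨g * g'', α, β + s⟩, ?_⟩
  simp only [monom]
  rw [← mul_assoc, hg, mul_assoc, ← mul_assoc x, he, smul_mul_assoc, mul_assoc (zpw 0 α), hg',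
    ← mul_assoc (zpw 0 α), hg'', map_mul, mul_smul_comm]
  simp only [mul_assoc]

theorem zpw_zero_mul_aeval (hq : q ≠ 0) (g : ℂ[X]) (n : ℤ) : ∃ g' : ℂ[X],
    zpw 0 n * aeval (bElt q) g = aeval (bElt q) g' * zpw 0 n := by
  obtain ⟨m, rfl | rfl⟩ := n.eq_nat_or_neg
  · rw [zpw_natCast]
    exact mul_aeval_of_qcomm (pow_mul_of_qcomm z0_mul_b m) g
  · rw [zpw_neg_natCast]
    exact mul_aeval_of_qcomm (pow_mul_of_qcomm (star_z0_mul_b hq) m) g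

theorem z1_mul_z0 (hq : q ≠ 0) : z 1 * z 0 = (q : ℂ)⁻¹ • (z 0 * z 1 : SphereAlg q) := by
  rw [(isSpherePair_z (q := q)).zz, smul_smul, inv_mul_cancel₀ (by exact_mod_cast hq), one_smul]

theorem star_z1_mul_z0 (hq : q ≠ 0) :
    star (z 1) * z 0 = (q : ℂ)⁻¹ • (z 0 * star (z 1) : SphereAlg q) := by
  rw [(isSpherePair_z (q := q)).zzs 0 1 (by decide), smul_smul,
    inv_mul_cancel₀ (by exact_mod_cast hq), one_smul]

theorem star_z1_mul_star_z0 :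
    star (z 1) * star (z 0) = (q : ℂ) • (star (z 0) * star (z 1) : SphereAlg q) := by
  simp only [star_z]
  exact rel_zz_adj

/-- The span is stable under left multiplication by the four letters, hence by every element, and it
contains `1`. -/
theorem span_monom (hq : q ≠ 0) : Submodule.span ℂ (Set.range (monom q)) = ⊤ := by
  refine (Submodule.eq_top_iff').2 fun x => ?_
  have key : ∀ y ∈ Submodule.span ℂ (Set.range (monom q)),
      x * y ∈ Submodule.span ℂ (Set.range (monom q)) := by
    induction x using SphereAlg.induction' with
    | hc c =>
      intro y hy
      rw [← Algebra.smul_def]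
      exact Submodule.smul_mem _ _ hy
    | ha x y hx hy =>
      intro w hw
      rw [add_mul]
      exact add_mem (hx w hw) (hy w hw)
    | hm x y hx hy =>
      intro w hw
      rw [mul_assoc]
      exact hx _ (hy w hw)
    | hz i =>
      intro y hy
      refine mul_mem_span_monom (fun p => ?_) hy
      fin_cases i
      · exact mul_monom_zero (s := 1) z0_mul_b
          (z_mul_zpw (f := 1 - X) (by rw [map_sub, map_one, aeval_X]; exact z0_mul_star_z0)) p
      · exact mul_monom_one (s := 1) z1_mul_b (z1_mul_z0 hq)
          ((isSpherePair_z (q := q)).zzs 1 0 (by decide))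
          (z_mul_zpw (f := X) (aeval_X _).symm) (zpw_zero_mul_aeval hq) p
    | hzs i =>
      intro y hy
      rw [← star_z]
      refine mul_mem_span_monom (fun p => ?_) hy
      fin_cases i
      · exact mul_monom_zero (s := -1) (star_z0_mul_b hq)
          (star_z_mul_zpw (f := 1 - C (((q : ℂ) ^ 2)⁻¹) * X)
            (by rw [map_sub, map_one, map_mul, aeval_C, aeval_X, ← Algebra.smul_def]
                exact star_z0_mul_z0)) p
      · exact mul_monom_one (s := -1) star_z1_mul_b (star_z1_mul_z0 hq) star_z1_mul_star_z0
          (star_z_mul_zpw (f := X) (star_z1_mul_z1.trans (aeval_X _).symm))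
          (zpw_zero_mul_aeval hq) p
  have h1 : (1 : SphereAlg q) = monom q (1, 0, 0) := by
    rw [monom, map_one, one_mul]
    exact (mul_one (1 : SphereAlg q)).symm.trans
      (congrArg₂ (· * ·) (pow_zero (z 0)).symm (pow_zero (z 1)).symm)
  have := key 1 (by rw [h1]; exact Submodule.subset_span ⟨_, rfl⟩)
  rwa [mul_one] at this

/-! ### Bihomogeneous elements -/

/-- `x` has bidegree `(α, β)` for the action of the 2-torus. -/
def HasPhase (α β : ℤ) (x : SphereAlg q) : Prop :=
  ∀ u : Fin 2 → Circle, phase u x = ((u 0 ^ α * u 1 ^ β : Circle) : ℂ) • x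

theorem HasPhase.mul {α β α' β' : ℤ} {x y : SphereAlg q} (hx : HasPhase α β x)
    (hy : HasPhase α' β' y) : HasPhase (α + α') (β + β') (x * y) := fun u => by
  rw [map_mul, hx, hy, smul_mul_smul_comm, ← Circle.coe_mul]
  congr 2
  rw [zpow_add, zpow_add]
  exact mul_mul_mul_comm _ _ _ _

theorem HasPhase.star {α β : ℤ} {x : SphereAlg q} (hx : HasPhase α β x) :
    HasPhase (-α) (-β) (star x) := fun u => by
  rw [map_star, hx, star_smul, zpow_neg, zpow_neg, ← mul_inv, Circle.coe_inv_eq_conj]; rfl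

theorem hasPhase_one : HasPhase 0 0 (1 : SphereAlg q) := fun u => by simp

theorem HasPhase.pow {α β : ℤ} {x : SphereAlg q} (hx : HasPhase α β x) (n : ℕ) :
    HasPhase (n * α) (n * β) (x ^ n) := by
  induction n with
  | zero => simpa using hasPhase_one
  | succ n ih =>
    rw [pow_succ]
    convert ih.mul hx using 1 <;> push_cast <;> ring

theorem hasPhase_z0 : HasPhase 1 0 (z 0 : SphereAlg q) := fun u => by
  rw [phase, lift_z]; simp

theorem hasPhase_z1 : HasPhase 0 1 (z 1 : SphereAlg q) := fun u => by
  rw [phase, lift_z]; simp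

theorem hasPhase_zpw_zero (n : ℤ) : HasPhase n 0 (zpw 0 n : SphereAlg q) := by
  obtain ⟨m, rfl | rfl⟩ := n.eq_nat_or_neg
  · rw [zpw_natCast]; simpa using hasPhase_z0.pow (q := q) m
  · rw [zpw_neg_natCast]; simpa using hasPhase_z0.star.pow (q := q) m

theorem hasPhase_zpw_one (n : ℤ) : HasPhase 0 n (zpw 1 n : SphereAlg q) := by
  obtain ⟨m, rfl | rfl⟩ := n.eq_nat_or_neg
  · rw [zpw_natCast]; simpa using hasPhase_z1.pow (q := q) m
  · rw [zpw_neg_natCast]; simpa using hasPhase_z1.star.pow (q := q) m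

theorem hasPhase_aeval_b (f : ℂ[X]) : HasPhase 0 0 (aeval (bElt q) f) := by
  have h : HasPhase 0 0 (bElt q) := hasPhase_z1.mul hasPhase_z1.star
  intro u
  rw [zpow_zero, zpow_zero, mul_one, Circle.coe_one, one_smul]
  have hb := h u
  rw [zpow_zero, zpow_zero, mul_one, Circle.coe_one, one_smul] at hb
  have := Polynomial.aeval_algHom_apply (phase u : SphereAlg q →⋆ₐ[ℂ] _).toAlgHom (bElt q) f
  change aeval (phase u (bElt q)) f = phase u _ at this
  rw [← this, hb]

theorem hasPhase_monom (p : ℂ[X] × ℤ × ℤ) : HasPhase p.2.1 p.2.2 (monom q p) := by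
  have := (hasPhase_aeval_b (q := q) p.1).mul ((hasPhase_zpw_zero p.2.1).mul (hasPhase_zpw_one p.2.2))
  rw [monom]
  simpa only [zero_add, add_zero] using this

/-- The weighted circle sits in the 2-torus as `w ↦ (wᵏ, wˡ)`. -/
theorem HasPhase.hasWeight {α β : ℤ} {x : SphereAlg q} (hx : HasPhase α β x) (k l : ℕ) :
    HasWeight q k l (k * α + l * β) x := fun w => by
  rw [circleAction, hx]
  congr 2
  rw [zpow_add, zpow_mul, zpow_mul, zpow_natCast, zpow_natCast]
  rfl

end monomials

/-! ### Finite averages -/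

theorem root_zpow_eq_one_iff {N : ℕ} (hN : 0 < N) (n : ℤ) : root N ^ n = 1 ↔ (N : ℤ) ∣ n := by
  have hN' : (N : ℝ) ≠ 0 := by exact_mod_cast hN.ne'
  rw [root, ← Circle.exp_zsmul, Circle.exp_eq_one]
  refine exists_congr fun m => ?_
  rw [zsmul_eq_mul, mul_div_assoc', div_eq_iff hN']
  have h2 : (2 * Real.pi) ≠ 0 := by positivity
  constructor
  · intro h
    have h' : (2 * Real.pi) * (n : ℝ) = (2 * Real.pi) * (N * m) := by linarith
    exact_mod_cast mul_left_cancel₀ h2 h'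
  · rintro rfl
    push_cast; ring

/-- Orthogonality of characters of the cyclic group of order `N`, by the geometric sum. -/
theorem sum_root_zpow {N : ℕ} (hN : 0 < N) (n : ℤ) :
    ∑ j ∈ Finset.range N, (((root N ^ j) ^ n : Circle) : ℂ) = if (N : ℤ) ∣ n then (N : ℂ) else 0 := by
  have h : ∀ j : ℕ, (((root N ^ j) ^ n : Circle) : ℂ) = ((root N ^ n : Circle) : ℂ) ^ j := fun j => by
    rw [← Circle.coe_pow, ← zpow_natCast, ← zpow_natCast, ← zpow_mul, ← zpow_mul, mul_comm]
  simp only [h]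
  split_ifs with hd
  · rw [(root_zpow_eq_one_iff hN n).2 hd]; simp
  · have h1 : ((root N ^ n : Circle) : ℂ) ≠ 1 := fun he =>
      hd ((root_zpow_eq_one_iff hN n).1 (Circle.coe_eq_one.1 he))
    have h2 : ((root N ^ n : Circle) : ℂ) ^ N = 1 := by
      rw [← Circle.coe_pow, ← zpow_natCast, ← zpow_mul,
        (root_zpow_eq_one_iff hN _).2 (dvd_mul_left _ _), Circle.coe_one]
    rw [geom_sum_eq h1, h2, sub_self, zero_div]

section averages

variable {M ι : Type*} [AddCommGroup M] [Module ℂ M] {T : Circle → M →ₗ[ℂ] M} {m : ι → M} {n : ι → ℤ}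

/-- The (unnormalised) average over the `N`-th roots of unity kills the eigenvectors whose weight is
not divisible by `N` and multiplies the others by `N`. -/
theorem average_mem_span (hT : ∀ w i, T w (m i) = ((w ^ n i : Circle) : ℂ) • m i) {N : ℕ} (hN : 0 < N)
    {x : M} (hx : x ∈ Submodule.span ℂ (Set.range m)) :
    ∑ j ∈ Finset.range N, T (root N ^ j) x ∈ Submodule.span ℂ (m '' {i | (N : ℤ) ∣ n i}) := by
  induction hx using Submodule.span_induction with
  | mem x hx =>
    obtain ⟨i, rfl⟩ := hx
    simp only [hT]
    rw [← Finset.sum_smul, sum_root_zpow hN]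
    split_ifs with h
    · exact Submodule.smul_mem _ _ (Submodule.subset_span ⟨i, h, rfl⟩)
    · rw [zero_smul]; exact zero_mem _
  | zero => simp
  | add x y _ _ hx hy => simp only [map_add, Finset.sum_add_distrib]; exact add_mem hx hy
  | smul c x _ hx =>
    simp only [map_smul, ← Finset.smul_sum]
    exact Submodule.smul_mem _ _ hx

/-- An element of the span involves only finitely many weights. As soon as `N` exceeds their
absolute values, `N` divides none of them but zero, so the average over the `N`-th roots of unity
projects onto weight zero. No topology or integration is needed at the algebraic level. -/
theorem mem_span_of_fixed (hT : ∀ w i, T w (m i) = ((w ^ n i : Circle) : ℂ) • m i) {x : M}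
    (hx : x ∈ Submodule.span ℂ (Set.range m)) (hfix : ∀ w, T w x = x) :
    x ∈ Submodule.span ℂ (m '' {i | n i = 0}) := by
  have key : ∃ y ∈ Submodule.span ℂ (m '' {i | n i = 0}), ∃ N₀ : ℕ, ∀ N : ℕ, N₀ < N →
      ∑ j ∈ Finset.range N, T (root N ^ j) x = (N : ℂ) • y := by
    -- Invariance holds for `x` alone and not for the members of the spanning family, so it must
    -- stay out of the induction.
    clear hfix
    induction hx using Submodule.span_induction with
    | mem x hx =>
      obtain ⟨i, rfl⟩ := hx
      simp only [hT]
      by_cases h : n i = 0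
      · refine ⟨m i, Submodule.subset_span ⟨i, h, rfl⟩, 0, fun N hN => ?_⟩
        rw [← Finset.sum_smul, sum_root_zpow hN, if_pos (h ▸ dvd_zero _)]
      · refine ⟨0, zero_mem _, (n i).natAbs, fun N hN => ?_⟩
        have h1 : ¬ (N : ℤ) ∣ n i := fun hd =>
          absurd (Int.natCast_dvd.1 hd) (Nat.not_dvd_of_pos_of_lt (Int.natAbs_pos.2 h) hN)
        rw [← Finset.sum_smul, sum_root_zpow (by omega), if_neg h1, zero_smul, smul_zero]
    | zero => exact ⟨0, zero_mem _, 0, fun N _ => by simp⟩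
    | add x x' _ _ hx hx' =>
      obtain ⟨y, hy, N₀, h⟩ := hx
      obtain ⟨y', hy', N₀', h'⟩ := hx'
      refine ⟨y + y', add_mem hy hy', max N₀ N₀', fun N hN => ?_⟩
      simp only [map_add, Finset.sum_add_distrib]
      rw [h N (lt_of_le_of_lt (le_max_left _ _) hN), h' N (lt_of_le_of_lt (le_max_right _ _) hN),
        smul_add]
    | smul c x _ hx =>
      obtain ⟨y, hy, N₀, h⟩ := hx
      refine ⟨c • y, Submodule.smul_mem _ _ hy, N₀, fun N hN => ?_⟩
      simp only [map_smul, ← Finset.smul_sum]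
      rw [h N hN, smul_comm]
  obtain ⟨y, hy, N₀, h⟩ := key
  have h1 := h (N₀ + 1) (Nat.lt_succ_self _)
  simp only [hfix] at h1
  rw [Finset.sum_const, Finset.card_range, ← Nat.cast_smul_eq_nsmul ℂ] at h1
  have h2 : ((N₀ + 1 : ℕ) : ℂ) ≠ 0 := Nat.cast_ne_zero.2 (Nat.succ_ne_zero _)
  rwa [smul_right_injective M h2 h1]

end averages

/-! ### The grading by weights -/

section weightSpace

variable {q : ℝ} {k l : ℕ}

variable (q k l) in
/-- The space of elements of weight `n`. -/
def wt (n : ℤ) : Submodule ℂ (SphereAlg q) where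
  carrier := {x | HasWeight q k l n x}
  add_mem' hx hy w := by rw [map_add, hx w, hy w, smul_add]
  zero_mem' w := by rw [map_zero, smul_zero]
  smul_mem' c x hx w := by rw [map_smul, hx w, smul_comm]

theorem wt_mul_le (m n : ℤ) : wt q k l m * wt q k l n ≤ wt q k l (m + n) :=
  Submodule.mul_le.2 fun _ hx _ hy => HasWeight.mul hx hy

theorem star_mem_wt {n : ℤ} {x : SphereAlg q} (hx : x ∈ wt q k l n) : star x ∈ wt q k l (-n) :=
  HasWeight.star hx

variable (q k l) in
/-- The weighted circle action by linear maps. -/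
def circleLin (w : Circle) : SphereAlg q →ₗ[ℂ] SphereAlg q :=
  (circleAction q k l w).toAlgHom.toLinearMap

theorem mem_span_monom_of_mem_projAlg (hq : q ≠ 0) {x : SphereAlg q} (hx : x ∈ projAlg q k l) :
    x ∈ Submodule.span ℂ (monom q '' {p | k * p.2.1 + l * p.2.2 = 0}) :=
  mem_span_of_fixed (T := circleLin q k l) (m := monom q) (n := fun p => k * p.2.1 + l * p.2.2)
    (fun w p => (hasPhase_monom p).hasWeight k l w)
    ((span_monom hq).symm ▸ Submodule.mem_top) hx

/-- The polynomial `P` with `(z₀*)ⁿ z₀ⁿ = P(b)`. -/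
def starPowPoly (q : ℝ) (n : ℕ) : ℂ[X] :=
  ∏ m ∈ Finset.range n, (1 - C ((((q : ℂ) ^ 2)⁻¹) ^ (m + 1)) * X)

/-- The polynomial `Q` with `z₀ⁿ (z₀*)ⁿ = Q(b)`. -/
def powStarPoly (q : ℝ) (n : ℕ) : ℂ[X] :=
  ∏ m ∈ Finset.range n, (1 - C (((q : ℂ) ^ 2) ^ m) * X)

theorem starPowPoly_succ (n : ℕ) : starPowPoly q (n + 1) =
    starPowPoly q n * (1 - C ((((q : ℂ) ^ 2)⁻¹) ^ (n + 1)) * X) := Finset.prod_range_succ _ _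

theorem powStarPoly_succ (n : ℕ) : powStarPoly q (n + 1) =
    powStarPoly q n * (1 - C (((q : ℂ) ^ 2) ^ n) * X) := Finset.prod_range_succ _ _

/-- The factors of `starPowPoly` and `powStarPoly` have constant term `1`; this coprimality is the
source of all decompositions of the unit below. -/
theorem isCoprime_one_sub (c : ℂ) : IsCoprime (1 - C c * X : ℂ[X]) X := ⟨1, C c, by ring⟩

/-- The innermost product is `z₀* z₀ = 1 - q⁻² b`, and moving this `b` past `z₀ⁿ` contributes a
further `q⁻²ⁿ`; hence the exponent `n + 1` in the new factor. -/
theorem star_z0_pow_mul (hq : q ≠ 0) (n : ℕ) :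
    star (z 0) ^ n * z 0 ^ n = aeval (bElt q) (starPowPoly q n) := by
  induction n with
  | zero => simp [starPowPoly]
  | succ n ih =>
    have e : star (z 0) ^ (n + 1) * z 0 ^ (n + 1) =
        star (z 0) ^ n * (star (z 0) * z 0) * (z 0 ^ n : SphereAlg q) := by
      rw [pow_succ, pow_succ']; noncomm_ring
    rw [e, star_z0_mul_z0, mul_sub, sub_mul, mul_one, mul_smul_comm, smul_mul_assoc, mul_assoc,
      mul_pow_of_qcomm (b_mul_z0 hq), mul_smul_comm, smul_smul, ← mul_assoc, ih, starPowPoly_succ, map_mul, map_sub, map_one, map_mul, aeval_C, aeval_X,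
      mul_sub, mul_one, ← Algebra.smul_def, mul_smul_comm, pow_succ' (_⁻¹)]

/-- Here the innermost product is `z₀ z₀* = 1 - b`, without a power of `q`, so the exponent in the
new factor is `n`. -/
theorem z0_pow_mul_star (n : ℕ) :
    z 0 ^ n * star (z 0) ^ n = aeval (bElt q) (powStarPoly q n) := by
  induction n with
  | zero => simp [powStarPoly]
  | succ n ih =>
    have e : z 0 ^ (n + 1) * star (z 0) ^ (n + 1) =
        z 0 ^ n * (z 0 * star (z 0)) * (star (z 0) ^ n : SphereAlg q) := by
      rw [pow_succ, pow_succ']; noncomm_ring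
    rw [e, z0_mul_star_z0, mul_sub, sub_mul, mul_one, pow_mul_of_qcomm z0_mul_b, smul_mul_assoc,
      mul_assoc, ih, powStarPoly_succ, mul_comm, map_mul, map_sub,
      map_one, map_mul, aeval_C, aeval_X, sub_mul, one_mul, ← Algebra.smul_def, smul_mul_assoc]

theorem bElt_pow (n : ℕ) : bElt q ^ n = star (z 1) ^ n * z 1 ^ n ∧
    bElt q ^ n = z 1 ^ n * star (z 1) ^ n := by
  have hn := (isSpherePair_z (q := q)).normal_one
  have hc : Commute (star (z 1)) (z 1 : SphereAlg q) := hn.symm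
  constructor
  · rw [← star_z1_mul_z1, hc.mul_pow]
  · rw [bElt, hc.symm.mul_pow]

theorem hasWeight_aeval_b (f : ℂ[X]) : HasWeight q k l 0 (aeval (bElt q) f) := by
  simpa using (hasPhase_aeval_b (q := q) f).hasWeight k l

/-- A Bezout identity `U P + V Xⁿ = 1` evaluated at `b`. The coefficients `U(b)` and `V(b)` have
weight zero and are absorbed into the right factors. -/
theorem one_mem_of_coprime {P : ℂ[X]} (hP : IsCoprime P X) {n : ℕ} {m : ℤ} {x y x' y' : SphereAlg q}
    (hx : x ∈ wt q k l m) (hy : y ∈ wt q k l (-m)) (hx' : x' ∈ wt q k l m)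
    (hy' : y' ∈ wt q k l (-m)) (h : x * y = aeval (bElt q) P) (h' : x' * y' = bElt q ^ n) :
    (1 : SphereAlg q) ∈ wt q k l m * wt q k l (-m) := by
  obtain ⟨U, V, hUV⟩ := hP.pow_right (n := n)
  have key : x * (y * aeval (bElt q) U) + x' * (y' * aeval (bElt q) V) = 1 := by
    have := congrArg (fun R : ℂ[X] => aeval (bElt q) R) hUV
    simp only [mul_comm U, mul_comm V, map_add, map_mul, map_pow, aeval_X, map_one] at this
    rw [← mul_assoc, ← mul_assoc, h, h', this]
  have hw : ∀ {y : SphereAlg q}, y ∈ wt q k l (-m) → ∀ R, y * aeval (bElt q) R ∈ wt q k l (-m) :=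
    fun hy R => by
      have := HasWeight.mul hy (hasWeight_aeval_b (q := q) (k := k) (l := l) R)
      rwa [add_zero] at this
  rw [← key]
  exact add_mem (Submodule.mul_mem_mul hx (hw hy U)) (Submodule.mul_mem_mul hx' (hw hy' V))

/-- Both signs of the weight are needed: the products `z₀ˡ (z₀*)ˡ` and `z₁ᵏ (z₁*)ᵏ` serve for `kl`,
those in the opposite order for `-kl`. -/
theorem one_mem_wt_mul (hq : q ≠ 0) :
    (1 : SphereAlg q) ∈ wt q k l (k * l) * wt q k l (-(k * l)) ∧
    (1 : SphereAlg q) ∈ wt q k l (-(k * l)) * wt q k l (- -(k * l)) := by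
  have h0 := hasWeight_z0l (q := q) (k := k) (l := l)
  have h1 := hasWeight_z1k (q := q) (k := k) (l := l)
  have h0' := h0.star
  have h1' := h1.star
  rw [star_pow] at h0' h1'
  constructor
  · exact one_mem_of_coprime (IsCoprime.prod_left fun m _ => isCoprime_one_sub _)
      h0 h0' h1 h1' (z0_pow_mul_star l) (bElt_pow k).2.symm
  · refine one_mem_of_coprime (IsCoprime.prod_left fun m _ => isCoprime_one_sub _)
      h0' ?_ h1' ?_ (star_z0_pow_mul hq l) (bElt_pow k).1.symm
    · rwa [neg_neg]
    · rwa [neg_neg]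

/-- Insert the decomposition of `1` for `n` in the middle of the one for `m`, and regroup the four
factors. -/
theorem one_mem_wt_add {m n : ℤ} (hm : (1 : SphereAlg q) ∈ wt q k l m * wt q k l (-m))
    (hn : (1 : SphereAlg q) ∈ wt q k l n * wt q k l (-n)) :
    (1 : SphereAlg q) ∈ wt q k l (m + n) * wt q k l (-(m + n)) := by
  have h1 : wt q k l m * wt q k l (-m) ≤
      wt q k l m * (wt q k l n * wt q k l (-n)) * wt q k l (-m) := by
    refine Submodule.mul_le.2 fun x hx y hy => ?_
    have := Submodule.mul_mem_mul (Submodule.mul_mem_mul hx hn) hy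
    rwa [mul_one] at this
  have h2 : wt q k l m * (wt q k l n * wt q k l (-n)) * wt q k l (-m) ≤
      wt q k l (m + n) * wt q k l (-(m + n)) := by
    rw [← mul_assoc, mul_assoc]
    refine mul_le_mul' (wt_mul_le m n) ?_
    rw [neg_add_rev]
    exact wt_mul_le _ _
  exact h2 (h1 hm)

theorem one_mem_wt_mul_of_dvd (hq : q ≠ 0) {m : ℤ} (hm : (k * l : ℤ) ∣ m) :
    (1 : SphereAlg q) ∈ wt q k l m * wt q k l (-m) := by
  have key : ∀ (a : ℤ), (1 : SphereAlg q) ∈ wt q k l a * wt q k l (-a) → ∀ j : ℕ,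
      (1 : SphereAlg q) ∈ wt q k l (a * j) * wt q k l (-(a * j)) := by
    intro a ha j
    induction j with
    | zero =>
      have h1 : (1 : SphereAlg q) ∈ wt q k l 0 := fun w => by simp
      have := Submodule.mul_mem_mul h1 h1
      simpa using this
    | succ j ih =>
      have := one_mem_wt_add ih ha
      convert this using 3 <;> push_cast <;> ring
  obtain ⟨j, rfl⟩ := hm
  obtain ⟨j, rfl | rfl⟩ := j.eq_nat_or_neg
  · exact key _ (one_mem_wt_mul hq).1 j
  · have := key _ (one_mem_wt_mul (k := k) (l := l) hq).2 j
    rwa [neg_mul_comm] at this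

end weightSpace

end QuantumLens

end

noncomputable section
open MulOpposite

namespace QuantumLens

open SphereAlg

/-! ### Averages over the circle -/

section circleAvg

variable {E : Type*} [NormedAddCommGroup E] [NormedSpace ℂ E]

/-- The mean value of a function on the circle. -/
def circleAvg (g : Circle → E) : E :=
  (2 * Real.pi)⁻¹ • ∫ t in (-Real.pi)..Real.pi, g (Circle.exp t)

theorem circleAvg_zpow_smul [CompleteSpace E] (n : ℤ) (c : E) :
    circleAvg (fun w => ((w ^ n : Circle) : ℂ) • c) = if n = 0 then c else 0 := by
  rw [circleAvg, intervalIntegral.integral_smul_const]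
  split_ifs with hn
  · subst hn
    simp only [zpow_zero, Circle.coe_one, intervalIntegral.integral_const]
    rw [sub_neg_eq_add, ← two_mul, smul_assoc, one_smul, smul_smul, inv_mul_cancel₀ (by positivity),
      one_smul]
  · have hc : (n : ℂ) * Complex.I ≠ 0 := mul_ne_zero (by exact_mod_cast hn) Complex.I_ne_zero
    have h1 : ∀ t : ℝ, ((Circle.exp t ^ n : Circle) : ℂ) = Complex.exp ((n * Complex.I) * t) := fun t => by
      rw [← Circle.exp_zsmul, Circle.coe_exp]; congr 1; push_cast [zsmul_eq_mul]; ring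
    simp only [h1]
    rw [integral_exp_mul_complex hc]
    have h2 : Complex.exp (n * Complex.I * (Real.pi : ℝ)) = Complex.exp (n * Complex.I * (-Real.pi : ℝ)) :=
      Complex.exp_eq_exp_iff_exists_int.2 ⟨n, by push_cast; ring⟩
    rw [h2, sub_self, zero_div, zero_smul, smul_zero]

theorem norm_circleAvg_le {g : Circle → E} {C : ℝ} (h : ∀ w, ‖g w‖ ≤ C) : ‖circleAvg g‖ ≤ C := by
  have h1 := intervalIntegral.norm_integral_le_of_norm_le_const (a := -Real.pi) (b := Real.pi)
    (f := fun t => g (Circle.exp t)) (C := C) fun t _ => h _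
  have hpi := Real.pi_pos
  rw [sub_neg_eq_add, ← two_mul, abs_of_pos (by positivity)] at h1
  rw [circleAvg, norm_smul, Real.norm_of_nonneg (by positivity), inv_mul_le_iff₀ (by positivity),
    mul_comm]
  exact h1

theorem intervalIntegrable_circle {E : Type*} [NormedAddCommGroup E] {g : Circle → E} (hg : Continuous g) (a b : ℝ) :
    IntervalIntegrable (fun t => g (Circle.exp t)) MeasureTheory.volume a b :=
  (hg.comp Circle.exp.continuous).intervalIntegrable a b

theorem circleAvg_add {f g : Circle → E} (hf : Continuous f) (hg : Continuous g) :
    circleAvg (fun w => f w + g w) = circleAvg f + circleAvg g := by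
  rw [circleAvg, circleAvg, circleAvg, ← smul_add, intervalIntegral.integral_add
    (intervalIntegrable_circle hf _ _) (intervalIntegrable_circle hg _ _)]

theorem map_circleAvg {F : Type*} [NormedAddCommGroup F] [NormedSpace ℂ F] [CompleteSpace E]
    [CompleteSpace F] (L : E →L[ℝ] F) {g : Circle → E} (hg : Continuous g) :
    L (circleAvg g) = circleAvg fun w => L (g w) := by
  rw [circleAvg, circleAvg, map_smul,
    L.intervalIntegral_comp_comm (intervalIntegrable_circle hg _ _)]

theorem circleAvg_smul [CompleteSpace E] (c : ℂ) {g : Circle → E} (hg : Continuous g) :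
    circleAvg (fun w => c • g w) = c • circleAvg g :=
  (map_circleAvg ((c • ContinuousLinearMap.id ℂ E).restrictScalars ℝ) hg).symm

variable {D : Type*} [CStarAlgebra D]

/-- Faithfulness of the mean: a continuous positive function with integral zero vanishes. Since the
values lie in a C*-algebra, the proof uses the order for the partial integrals and then
differentiates. -/
theorem eq_zero_of_circleAvg_star_mul_self {g : Circle → D} (hg : Continuous g)
    (h : circleAvg (fun w => star (g w) * g w) = 0) (w : Circle) : g w = 0 := by
  let _ := CStarAlgebra.spectralOrder D
  have := CStarAlgebra.spectralOrderedRing D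
  set f : ℝ → D := fun t => star (g (Circle.exp t)) * g (Circle.exp t) with hf
  have hc : Continuous fun w => star (g w) * g w := hg.star.mul hg
  have hfc : Continuous f := hc.comp Circle.exp.continuous
  have hint : ∀ a b, IntervalIntegrable f MeasureTheory.volume a b := fun a b =>
    hfc.intervalIntegrable a b
  have h0 : ∫ t in (-Real.pi)..Real.pi, f t = 0 := by
    refine (smul_eq_zero.1 h).resolve_left ?_
    have := Real.pi_pos
    positivity
  have hpos : ∀ a b : ℝ, a ≤ b → 0 ≤ ∫ t in a..b, f t := fun a b hab => by
    rw [intervalIntegral.integral_of_le hab]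
    exact MeasureTheory.integral_nonneg fun t => star_mul_self_nonneg _
  -- The integral up to `s` is positive and bounded above by the whole integral, which is zero.
  have h1 : ∀ s ∈ Set.Ioo (-Real.pi) Real.pi, ∫ t in (-Real.pi)..s, f t = 0 := fun s hs => by
    refine le_antisymm ?_ (hpos _ _ hs.1.le)
    rw [← h0, ← intervalIntegral.integral_add_adjacent_intervals (hint (-Real.pi) s)
      (hint s Real.pi)]
    exact le_add_of_nonneg_right (hpos _ _ hs.2.le)
  -- By the fundamental theorem of calculus `f t` is the derivative of a function that is locally
  -- zero.
  have h2 : Set.Ioo (-Real.pi) Real.pi ⊆ {t | f t = 0} := fun t ht => by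
    have h2 : HasDerivAt (fun s => ∫ t in (-Real.pi)..s, f t) (f t) t :=
      intervalIntegral.integral_hasDerivAt_right (hint _ _)
        (hfc.stronglyMeasurableAtFilter _ _) hfc.continuousAt
    refine h2.unique ((hasDerivAt_const t (0 : D)).congr_of_eventuallyEq ?_)
    filter_upwards [Ioo_mem_nhds ht.1 ht.2] with s hs using h1 s hs
  -- Passing to the closed interval catches the point `-1` of the circle, whose argument is the
  -- endpoint `π`.
  have h3 := closure_minimal h2 (isClosed_eq hfc continuous_const)
  rw [closure_Ioo (by linarith [Real.pi_pos])] at h3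
  have h4 : f (Complex.arg w) = 0 := h3 ⟨(Complex.neg_pi_lt_arg _).le, Complex.arg_le_pi _⟩
  rw [hf] at h4
  simpa using h4

end circleAvg

/-! ### The circle action on `C(S_q³)` -/

section circleC

variable {q : ℝ} {k l : ℕ}

theorem norm_starHom_le {A D : Type*} [CStarAlgebra A] [CStarAlgebra D] (f : A →⋆ₐ[ℂ] D) (x : A) :
    ‖f x‖ ≤ ‖x‖ := NonUnitalStarAlgHom.norm_apply_le f x

variable (q k l) in
/-- The weighted circle action on `C(S_q³)`. -/
def circleC (w : Circle) : CSphere q →⋆ₐ[ℂ] CSphere q := Enveloping.map (circleAction q k l w)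

theorem circleC_of (w : Circle) (x : SphereAlg q) :
    circleC q k l w (ofSphere q x) = ofSphere q (circleAction q k l w x) := Enveloping.map_of _ x

theorem continuous_starHom {A D : Type*} [CStarAlgebra A] [CStarAlgebra D] (f : A →⋆ₐ[ℂ] D) :
    Continuous f := AddMonoidHomClass.continuous_of_bound f 1 fun x => by
  rw [one_mul]; exact norm_starHom_le f x

theorem circleC_one (x : CSphere q) : circleC q k l 1 x = x := by
  refine Enveloping.induction_on (p := fun x => circleC q k l 1 x = x) x
    (isClosed_eq (continuous_starHom _) continuous_id) fun a => ?_
  change circleC q k l 1 (ofSphere q a) = ofSphere q a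
  rw [circleC_of]
  congr 1
  have : circleAction q k l 1 = StarAlgHom.id ℂ (SphereAlg q) := hom_ext fun i => by
    rw [circleAction_z]
    fin_cases i <;> simp
  rw [this]; rfl

theorem circleAction_monom (w : Circle) (p : Polynomial ℂ × ℤ × ℤ) :
    circleAction q k l w (monom q p) = ((w ^ (k * p.2.1 + l * p.2.2) : Circle) : ℂ) • monom q p :=
  (hasPhase_monom p).hasWeight k l w

/-- Since `*`-homomorphisms are contractive, an approximation of `x` by `y` gives an approximation
of `w ↦ T w x` by `w ↦ T w y` that is uniform in `w`. -/
theorem isClosed_setOf_continuous {X A D : Type*} [TopologicalSpace X] [CStarAlgebra A]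
    [CStarAlgebra D] (T : X → A →⋆ₐ[ℂ] D) : IsClosed {x : A | Continuous fun w => T w x} := by
  refine isClosed_of_closure_subset fun x hx => ?_
  refine continuous_of_uniform_approx_of_continuous fun u hu => ?_
  obtain ⟨ε, hε, hu⟩ := Metric.mem_uniformity_dist.1 hu
  obtain ⟨y, hy, hxy⟩ := Metric.mem_closure_iff.1 hx ε hε
  refine ⟨_, hy, fun w => hu ?_⟩
  rw [dist_eq_norm, ← map_sub]
  refine (norm_starHom_le _ _).trans_lt ?_
  rwa [← dist_eq_norm]

/-- Orbits of monomials are continuous because monomials are eigenvectors; the previous lemma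
carries this to the completion. -/
theorem continuous_circleC (hq : q ≠ 0) (x : CSphere q) : Continuous fun w => circleC q k l w x := by
  refine Enveloping.induction_on (p := fun x => Continuous fun w => circleC q k l w x) x
    (isClosed_setOf_continuous _) fun a => ?_
  change Continuous fun w => circleC q k l w (ofSphere q a)
  simp only [circleC_of]
  have ha : a ∈ Submodule.span ℂ (Set.range (monom q)) := by
    rw [span_monom hq]; exact Submodule.mem_top
  induction ha using Submodule.span_induction with
  | mem x hx =>
    obtain ⟨p, rfl⟩ := hx
    simp only [circleAction_monom, map_smul]
    exact (continuous_subtype_val.comp (continuous_zpow (G := Circle) _)).smul continuous_const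
  | zero => simpa only [map_zero] using continuous_const
  | add x y _ _ hx hy => simp only [map_add]; exact hx.add hy
  | smul c x _ hx => simp only [map_smul]; exact hx.const_smul c

variable (k l) in
/-- The mean over the weighted circle action. -/
def circleMean (hq : q ≠ 0) : CSphere q →L[ℂ] CSphere q :=
  LinearMap.mkContinuous
    { toFun := fun x => circleAvg fun w => circleC q k l w x
      map_add' := fun x y => by
        simp only [map_add]
        exact circleAvg_add (continuous_circleC hq x) (continuous_circleC hq y)
      map_smul' := fun c x => by
        simp only [map_smul]
        exact circleAvg_smul c (continuous_circleC hq x) }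
    1 fun x => by
      rw [one_mul]
      exact norm_circleAvg_le fun w => norm_starHom_le (circleC q k l w) x

theorem circleMean_apply (hq : q ≠ 0) (x : CSphere q) :
    circleMean k l hq x = circleAvg fun w => circleC q k l w x := rfl

theorem circleMean_monom (hq : q ≠ 0) (p : Polynomial ℂ × ℤ × ℤ) :
    circleMean k l hq (ofSphere q (monom q p)) =
      if k * p.2.1 + l * p.2.2 = 0 then ofSphere q (monom q p) else 0 := by
  rw [circleMean_apply]
  simp only [circleC_of, circleAction_monom, map_smul]
  exact circleAvg_zpow_smul _ _

variable (q k l) in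
/-- The closed space of elements of weight `n` in `C(S_q³)`. -/
def cwt (n : ℤ) : Submodule ℂ (CSphere q) :=
  ((wt q k l n).map (ofSphere q : SphereAlg q →ₗ[ℂ] CSphere q)).topologicalClosure

theorem cwt_coe (n : ℤ) : (cwt q k l n : Set (CSphere q)) =
    closure (ofSphere q '' (wt q k l n : Set (SphereAlg q))) := rfl

theorem isClosed_cwt (n : ℤ) : IsClosed (cwt q k l n : Set (CSphere q)) :=
  Submodule.isClosed_topologicalClosure _

theorem of_mem_cwt {n : ℤ} {x : SphereAlg q} (hx : x ∈ wt q k l n) : ofSphere q x ∈ cwt q k l n :=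
  subset_closure ⟨x, hx, rfl⟩

theorem cwt_zero_coe : (cwt q k l 0 : Set (CSphere q)) = projC q k l := by
  rw [cwt_coe, projC_coe]
  congr 2
  ext x
  exact hasWeight_zero_iff

theorem mem_cwt_zero {x : CSphere q} : x ∈ cwt q k l 0 ↔ x ∈ projC q k l := by
  rw [← SetLike.mem_coe, cwt_zero_coe, SetLike.mem_coe]

theorem mul_mem_cwt {m n : ℤ} {x y : CSphere q} (hx : x ∈ cwt q k l m) (hy : y ∈ cwt q k l n) :
    x * y ∈ cwt q k l (m + n) := by
  rw [← SetLike.mem_coe, cwt_coe] at hx hy ⊢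
  refine map_mem_closure₂ (f := fun a b => a * b) continuous_mul hx hy ?_
  rintro _ ⟨x, hx, rfl⟩ _ ⟨y, hy, rfl⟩
  exact ⟨x * y, HasWeight.mul hx hy, map_mul _ _ _⟩

theorem star_mem_cwt {n : ℤ} {x : CSphere q} (hx : x ∈ cwt q k l n) :
    star x ∈ cwt q k l (-n) := by
  rw [← SetLike.mem_coe, cwt_coe] at hx ⊢
  refine map_mem_closure continuous_star hx ?_
  rintro _ ⟨x, hx, rfl⟩
  exact ⟨star x, star_mem_wt hx, map_star _ _⟩

theorem circleC_of_mem_cwt {n : ℤ} {x : CSphere q} (hx : x ∈ cwt q k l n) (w : Circle) :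
    circleC q k l w x = ((w ^ n : Circle) : ℂ) • x := by
  rw [← SetLike.mem_coe, cwt_coe] at hx
  refine closure_minimal (s := _) (t := {x | circleC q k l w x = ((w ^ n : Circle) : ℂ) • x}) ?_
    (isClosed_eq (continuous_starHom _) (continuous_const_smul _)) hx
  rintro _ ⟨x, hx, rfl⟩
  rw [Set.mem_ofPred_eq, circleC_of, hx w, map_smul]

theorem circleMean_of_mem_cwt (hq : q ≠ 0) {n : ℤ} {x : CSphere q} (hx : x ∈ cwt q k l n) :
    circleMean k l hq x = if n = 0 then x else 0 := by
  rw [circleMean_apply]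
  simp only [circleC_of_mem_cwt hx]
  exact circleAvg_zpow_smul _ _

/-- The conditional expectation onto weight zero is faithful: the whole orbit of `x` vanishes, in
particular its value at `w = 1`. -/
theorem eq_zero_of_circleMean (hq : q ≠ 0) {x : CSphere q}
    (h : circleMean k l hq (star x * x) = 0) : x = 0 := by
  rw [circleMean_apply] at h
  simp only [map_mul, map_star] at h
  have := eq_zero_of_circleAvg_star_mul_self (continuous_circleC hq x) h 1
  rwa [circleC_one] at this

end circleC

end QuantumLens

end

noncomputable section
open MulOpposite

namespace QuantumLens

open SphereAlg Polynomial
open scoped DirectSum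

/-! ### A representation of the quantum 3-sphere -/

section rep

open Corr

/-- The algebraic direct sum of countably many copies of `ℂ`. -/
abbrev SeqSpace : Type := ⨁ n : ℕ, ((fun _ => unit ℂ : ℕ → Corr ℂ) n)

/-- The pre-Hilbert space of finitely supported sequences. -/
abbrev seqPre : PreHilbert ℂ SeqSpace := sumPre fun _ => unit ℂ

/-- The inclusion of the `n`-th summand. -/
def incl (n : ℕ) : ℂ →ₗ[ℂ] SeqSpace :=
  DirectSum.lof ℂ ℕ (fun n => ((fun _ => unit ℂ : ℕ → Corr ℂ) n : Type)) n

/-- The basis vectors of `SeqSpace`. -/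
def bas (n : ℕ) : SeqSpace := incl n 1

theorem incl_eq (n : ℕ) (a : ℂ) : incl n a = a • bas n := by
  rw [bas, ← map_smul, smul_eq_mul, mul_one]

/-- The linear map with given values on the basis vectors. -/
def ofBas (T : ℕ → SeqSpace) : Module.End ℂ SeqSpace :=
  DirectSum.toModule ℂ ℕ SeqSpace fun n => (LinearMap.toSpanSingleton ℂ SeqSpace (T n) : ℂ →ₗ[ℂ] SeqSpace)

theorem ofBas_bas (T : ℕ → SeqSpace) (n : ℕ) : ofBas T (bas n) = T n :=
  (DirectSum.toModule_lof (M := fun n => ((fun _ => unit ℂ : ℕ → Corr ℂ) n : Type)) ℂ n (1 : ℂ)).trans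
    (one_smul ℂ (T n))

theorem seqSpace_induction {p : SeqSpace → Prop} (x : SeqSpace) (h0 : p 0) (hb : ∀ n, p (bas n))
    (hs : ∀ (c : ℂ) x, p x → p (c • x)) (ha : ∀ x y, p x → p y → p (x + y)) : p x := by
  induction x using DirectSum.induction_on with
  | zero => exact h0
  | add x y hx hy => exact ha x y hx hy
  | of n a =>
    have h : DirectSum.of (fun n => ((fun _ => unit ℂ : ℕ → Corr ℂ) n : Type)) n a = _ := incl_eq n a
    rw [h]
    exact hs a _ (hb n)

theorem end_ext {S T : Module.End ℂ SeqSpace} (h : ∀ n, S (bas n) = T (bas n)) : S = T :=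
  LinearMap.ext fun x => by
    induction x using seqSpace_induction with
    | h0 => rw [map_zero, map_zero]
    | hb n => exact h n
    | hs c x hx => rw [map_smul, map_smul, hx]
    | ha x y hx hy => rw [map_add, map_add, hx, hy]

theorem inn_bas (m n : ℕ) : seqPre.inn (bas m) (bas n) = if m = n then 1 else 0 := by
  refine (sumPre_inn_lof _ m _ _).trans ?_
  split_ifs with h
  · subst h
    have h1 : (bas m) m = (1 : ℂ) := DirectSum.of_eq_same m _
    rw [h1]
    change star (1 : ℂ) * 1 = 1
    simp
  · have h1 : (bas n) m = 0 := DirectSum.of_eq_of_ne _ _ _ h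
    rw [h1]
    exact (unit ℂ).pre.inn_zero_right _

theorem adj_of_bas {S T : Module.End ℂ SeqSpace}
    (h : ∀ m n, seqPre.inn (S (bas m)) (bas n) = seqPre.inn (bas m) (T (bas n))) (x y : SeqSpace) :
    seqPre.inn (S x) y = seqPre.inn x (T y) := by
  have h0 : ∀ y, seqPre.inn 0 y = 0 := fun y => by
    rw [← seqPre.star_inn, seqPre.inn_zero_right, star_zero]
  induction x using seqSpace_induction with
  | h0 => rw [map_zero, h0, h0]
  | hs c x hx => rw [map_smul, seqPre.inn_smul_left, seqPre.inn_smul_left, hx]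
  | ha x x' hx hx' => rw [map_add, seqPre.inn_add_left, seqPre.inn_add_left, hx, hx']
  | hb m =>
    induction y using seqSpace_induction with
    | h0 => rw [map_zero, seqPre.inn_zero_right, seqPre.inn_zero_right]
    | hs c x hx => rw [map_smul, seqPre.inn_smul_right, seqPre.inn_smul_right, hx]
    | ha x x' hx hx' => rw [map_add, seqPre.inn_add_right, seqPre.inn_add_right, hx, hx']
    | hb n => exact h m n

variable (q : ℝ)

/-- The weights of the shift `z₀`. -/
def shiftWeight (n : ℕ) : ℝ := √(1 - (q ^ 2) ^ n)

/-- The operator `z₀ eₙ = √(1 - q²ⁿ) eₙ₋₁`. -/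
def opZ : Module.End ℂ SeqSpace := ofBas fun n => (shiftWeight q n : ℂ) • bas (n - 1)

/-- The adjoint of `opZ`. -/
def opZs : Module.End ℂ SeqSpace := ofBas fun n => (shiftWeight q (n + 1) : ℂ) • bas (n + 1)

/-- The operator `z₁ eₙ = qⁿ⁺¹ eₙ`. -/
def opD : Module.End ℂ SeqSpace := ofBas fun n => ((q : ℂ) ^ (n + 1)) • bas n

variable {q}

/-- This makes the truncated subtraction `n - 1` in `opZ` harmless: the weight at `n = 0` vanishes.
-/
theorem shiftWeight_zero : shiftWeight q 0 = 0 := by simp [shiftWeight]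

theorem opZ_zero : opZ q (bas 0) = 0 := by
  rw [opZ, ofBas_bas, shiftWeight_zero, Complex.ofReal_zero, zero_smul]

theorem opZ_succ (n : ℕ) : opZ q (bas (n + 1)) = (shiftWeight q (n + 1) : ℂ) • bas n := by
  rw [opZ, ofBas_bas]; rfl

theorem opZs_bas (n : ℕ) : opZs q (bas n) = (shiftWeight q (n + 1) : ℂ) • bas (n + 1) := ofBas_bas _ n

theorem opD_bas (n : ℕ) : opD q (bas n) = ((q : ℂ) ^ (n + 1)) • bas n := ofBas_bas _ n

theorem opZ_adj (x y : SeqSpace) : seqPre.inn (opZ q x) y = seqPre.inn x (opZs q y) := by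
  refine adj_of_bas (fun m n => ?_) x y
  rw [opZs_bas, seqPre.inn_smul_right]
  cases m with
  | zero =>
    rw [opZ_zero, ← seqPre.star_inn, seqPre.inn_zero_right, star_zero, inn_bas, if_neg (by omega),
      smul_zero]
  | succ m =>
    rw [opZ_succ, seqPre.inn_smul_left, inn_bas, inn_bas, Complex.conj_ofReal]
    by_cases h : m = n
    · subst h; simp
    · rw [if_neg h, if_neg (by omega), smul_zero, smul_zero]

theorem opD_adj (x y : SeqSpace) : seqPre.inn (opD q x) y = seqPre.inn x (opD q y) := by
  refine adj_of_bas (fun m n => ?_) x y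
  rw [opD_bas, opD_bas, seqPre.inn_smul_right, seqPre.inn_smul_left, inn_bas, map_pow,
    Complex.conj_ofReal]
  split_ifs with h
  · subst h; rfl
  · rw [smul_zero, smul_zero]

theorem shiftWeight_sq (h0 : 0 < q) (h1 : q < 1) (n : ℕ) :
    (shiftWeight q n : ℂ) * shiftWeight q n = 1 - ((q : ℂ) ^ 2) ^ n := by
  rw [← Complex.ofReal_mul, shiftWeight, Real.mul_self_sqrt]
  · push_cast; rfl
  · have : (q ^ 2) ^ n ≤ 1 := pow_le_one₀ (by positivity) (by nlinarith)
    linarith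

variable (h0 : 0 < q) (h1 : q < 1)

include h0 h1 in
theorem opZs_opZ : opZs q * opZ q = 1 - (((q : ℂ) ^ 2)⁻¹) • (opD q * opD q) := by
  have hq : (q : ℂ) ≠ 0 := by exact_mod_cast h0.ne'
  refine end_ext fun n => ?_
  rw [Module.End.mul_apply, LinearMap.sub_apply, LinearMap.smul_apply, Module.End.mul_apply,
    Module.End.one_apply, opD_bas, map_smul, opD_bas, smul_smul, smul_smul]
  have e : ((q : ℂ) ^ 2)⁻¹ * (q : ℂ) ^ (n + 1) * (q : ℂ) ^ (n + 1) = ((q : ℂ) ^ 2) ^ n := by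
    field_simp; ring
  rw [e]
  cases n with
  | zero => rw [opZ_zero, map_zero, pow_zero, one_smul, sub_self]
  | succ n =>
    rw [opZ_succ, map_smul, opZs_bas, smul_smul, shiftWeight_sq h0 h1, sub_smul, one_smul]

include h0 h1 in
theorem opZ_opZs : opZ q * opZs q = 1 - opD q * opD q := by
  refine end_ext fun n => ?_
  rw [Module.End.mul_apply, LinearMap.sub_apply, Module.End.mul_apply,
    Module.End.one_apply, opD_bas, map_smul, opD_bas, smul_smul, opZs_bas, map_smul, opZ_succ,
    smul_smul, shiftWeight_sq h0 h1, sub_smul, one_smul]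
  congr 2
  ring

theorem opZ_opD : opZ q * opD q = (q : ℂ) • (opD q * opZ q) := by
  refine end_ext fun n => ?_
  rw [Module.End.mul_apply, LinearMap.smul_apply, Module.End.mul_apply, opD_bas, map_smul]
  cases n with
  | zero => rw [opZ_zero, map_zero, smul_zero, smul_zero]
  | succ n =>
    rw [opZ_succ, map_smul, opD_bas, smul_smul, smul_smul, smul_smul]
    congr 1; ring

theorem opD_opZs : opD q * opZs q = (q : ℂ) • (opZs q * opD q) := by
  refine end_ext fun n => ?_
  rw [Module.End.mul_apply, LinearMap.smul_apply, Module.End.mul_apply, opD_bas, map_smul, opZs_bas,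
    map_smul, opD_bas, smul_smul, smul_smul, smul_smul]
  congr 1; ring

include h0 h1 in
theorem nrm_opZ_le (x : SeqSpace) : seqPre.nrm (opZ q x) ≤ 1 * seqPre.nrm x := by
  rw [← Real.sqrt_one]
  refine seqPre.nrm_le_of_isPos seqPre zero_le_one ?_
  -- By the relation for `z₀* z₀`, the defect `⟨x, x⟩ - ⟨z₀ x, z₀ x⟩` is the square of `q⁻¹ z₁ x`.
  have h := seqPre.inn_pos (((q⁻¹ : ℝ) : ℂ) • opD q x)
  convert h using 1
  rw [seqPre.inn_smul_real_left, seqPre.inn_smul_real_right, opZ_adj, opD_adj,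
    ← Module.End.mul_apply, ← Module.End.mul_apply, opZs_opZ h0 h1, one_smul, LinearMap.sub_apply,
    Module.End.one_apply, seqPre.inn_sub_right, LinearMap.smul_apply, seqPre.inn_smul_right,
    sub_sub_cancel, smul_smul]
  rw [Complex.real_smul, smul_eq_mul]
  congr 1
  push_cast; rw [sq, mul_inv]

include h0 h1 in
theorem nrm_opD_le (x : SeqSpace) : seqPre.nrm (opD q x) ≤ 1 * seqPre.nrm x := by
  rw [← Real.sqrt_one]
  refine seqPre.nrm_le_of_isPos seqPre zero_le_one ?_
  -- By the sphere relation, the defect is the square of `z₀* x`.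
  have h := seqPre.inn_pos (opZs q x)
  convert h using 1
  have e : seqPre.inn (opZs q x) (opZs q x) = seqPre.inn x (opZ q (opZs q x)) := by
    rw [← seqPre.star_inn, ← opZ_adj, seqPre.star_inn]
  rw [e, opD_adj, ← Module.End.mul_apply, ← Module.End.mul_apply, opZ_opZs h0 h1, one_smul,
    LinearMap.sub_apply, Module.End.one_apply, seqPre.inn_sub_right]

/-- The images of the generators in the representation on sequences. -/
def repGen : Fin 2 → Adjointable ℂ seqPre.Compl :=
  ![seqPre.liftAdj (opZ q) (opZs q) opZ_adj zero_le_one (nrm_opZ_le h0 h1),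
    seqPre.liftAdj (opD q) (opD q) opD_adj zero_le_one (nrm_opD_le h0 h1)]

theorem repGen_zero_of (x : SeqSpace) : (repGen h0 h1 0).1 (seqPre.of x) = seqPre.of (opZ q x) :=
  seqPre.liftAdj_of (opZ q) (opZs q) opZ_adj zero_le_one (nrm_opZ_le h0 h1) x

theorem repGen_one_of (x : SeqSpace) : (repGen h0 h1 1).1 (seqPre.of x) = seqPre.of (opD q x) :=
  seqPre.liftAdj_of (opD q) (opD q) opD_adj zero_le_one (nrm_opD_le h0 h1) x

theorem star_repGen_zero_of (x : SeqSpace) :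
    (star (repGen h0 h1 0)).1 (seqPre.of x) = seqPre.of (opZs q x) := by
  refine HilbertModule.ext_inn ℂ fun y => ?_
  rw [Adjointable.inn_star_right]
  refine seqPre.induction_on (p := fun y => HilbertModule.inn (B := ℂ) ((repGen h0 h1 0).1 y)
    (seqPre.of x) = HilbertModule.inn y (seqPre.of (opZs q x))) y (isClosed_eq ?_ ?_) fun a => ?_
  · exact HilbertModule.continuous_inn (repGen h0 h1 0).1.continuous continuous_const
  · exact HilbertModule.continuous_inn continuous_id continuous_const
  · rw [repGen_zero_of, seqPre.inn_of, seqPre.inn_of, opZ_adj]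

theorem star_repGen_one : star (repGen h0 h1 1) = repGen h0 h1 1 :=
  seqPre.adjointable_star fun x y => by
    rw [repGen_one_of, repGen_one_of, seqPre.inn_of, seqPre.inn_of, opD_adj]

theorem adjointable_mul_apply {B E : Type} [CStarAlgebra B] [NormedAddCommGroup E] [NormedSpace ℂ E]
    [Module Bᵐᵒᵖ E] [HilbertModule B E] (S T : Adjointable B E) (x : E) :
    (S * T).1 x = S.1 (T.1 x) := rfl

/-- `T` extends the operator `t` on finitely supported sequences. -/
def Extends (T : Adjointable ℂ seqPre.Compl) (t : Module.End ℂ SeqSpace) : Prop :=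
  ∀ x, T.1 (seqPre.of x) = seqPre.of (t x)

namespace Extends

variable {S T : Adjointable ℂ seqPre.Compl} {s t : Module.End ℂ SeqSpace}

theorem mul (hS : Extends S s) (hT : Extends T t) : Extends (S * T) (s * t) := fun x => by
  rw [adjointable_mul_apply, hT, hS]; rfl

theorem add (hS : Extends S s) (hT : Extends T t) : Extends (S + T) (s + t) := fun x => by
  rw [LinearMap.add_apply, map_add, ← hS, ← hT]; rfl

theorem smul (c : ℂ) (hS : Extends S s) : Extends (c • S) (c • s) := fun x => by
  rw [LinearMap.smul_apply, map_smul, ← hS]; rfl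

theorem one : Extends 1 1 := fun _ => rfl

theorem eq (hS : Extends S s) (hT : Extends T t) (h : s = t) : S = T :=
  seqPre.adjointable_ext fun x => by rw [hS, hT, h]

end Extends

theorem isSpherePair_repGen : IsSpherePair q (repGen h0 h1) := by
  have hZs : Extends (star (repGen h0 h1 0)) (opZs q) := star_repGen_zero_of h0 h1
  have hZ : Extends (repGen h0 h1 0) (opZ q) := repGen_zero_of h0 h1
  have hD : Extends (repGen h0 h1 1) (opD q) := repGen_one_of h0 h1
  have hDs : Extends (star (repGen h0 h1 1)) (opD q) := by rw [star_repGen_one]; exact hD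
  constructor
  · exact (hZ.mul hD).eq ((hD.mul hZ).smul _) opZ_opD
  · intro i j hij
    match i, j, hij with
    | 0, 1, _ => exact (hZ.mul hDs).eq ((hDs.mul hZ).smul _) opZ_opD
    | 1, 0, _ => exact (hD.mul hZs).eq ((hZs.mul hD).smul _) opD_opZs
    | 0, 0, h => exact absurd rfl h
    | 1, 1, h => exact absurd rfl h
  · refine (hZ.mul hZs).eq ((hZs.mul hZ).add ((hD.mul hDs).smul _)) ?_
    have : (q : ℂ) ^ (-2 : ℤ) = ((q : ℂ) ^ 2)⁻¹ := zpow_neg _ _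
    rw [opZ_opZs h0 h1, opZs_opZ h0 h1, this]
    refine LinearMap.ext fun x => ?_
    simp only [LinearMap.sub_apply, LinearMap.add_apply, LinearMap.smul_apply]
    rw [_root_.sub_smul, one_smul]
    abel
  · exact (hD.mul hDs).eq (hDs.mul hD) rfl
  · exact ((hZ.mul hZs).add (hD.mul hDs)).eq Extends.one (by rw [opZ_opZs h0 h1, sub_add_cancel])

/-- The representation of `C(S_q³)` on square summable sequences. -/
def seqRep : CSphere q →⋆ₐ[ℂ] Adjointable ℂ seqPre.Compl :=
  Enveloping.lift (SphereAlg.lift (repGen h0 h1) (isSpherePair_repGen h0 h1))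

include h0 h1 in
-- Spectra shrink under homomorphisms, and in the representation on sequences the basis vector `eₙ`
-- is an eigenvector of `b` for this number.
theorem mem_spectrum_b (n : ℕ) : ((q : ℂ) ^ 2) ^ (n + 1) ∈ spectrum ℂ (ofSphere q (bElt q)) := by
  refine AlgHom.spectrum_apply_subset (seqRep h0 h1) _ ?_
  rw [spectrum.mem_iff]
  rintro ⟨u, hu⟩
  have hb : seqRep h0 h1 (ofSphere q (bElt q)) = repGen h0 h1 1 * repGen h0 h1 1 := by
    rw [seqRep, Enveloping.lift_of, bElt, map_mul, map_star, lift_z, star_repGen_one]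
  have h2 : u.1.1 (seqPre.of (bas n)) = 0 := by
    rw [hu, hb]
    change ((q : ℂ) ^ 2) ^ (n + 1) • seqPre.of (bas n) -
      (repGen h0 h1 1).1 ((repGen h0 h1 1).1 (seqPre.of (bas n))) = 0
    rw [repGen_one_of, repGen_one_of, opD_bas, map_smul, opD_bas, smul_smul, map_smul, ← sub_smul]
    have e : ((q : ℂ) ^ 2) ^ (n + 1) - (q : ℂ) ^ (n + 1) * (q : ℂ) ^ (n + 1) = 0 := by ring
    rw [e, zero_smul]
  have h3 : seqPre.of (bas n) = 0 := by
    have h4 : (u⁻¹.1 * u.1).1 (seqPre.of (bas n)) = seqPre.of (bas n) := by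
      rw [Units.inv_mul]; rfl
    rw [← h4, adjointable_mul_apply, h2, map_zero]
  have h5 := seqPre.inn_of (bas n) (bas n)
  rw [inn_bas, if_pos rfl, h3] at h5
  have h6 := (HilbertModule.pre ℂ seqPre.Compl).inn_zero_right 0
  exact one_ne_zero (h5.symm.trans h6)

include h0 h1 in
-- The spectrum is closed, and `0` is the limit of the eigenvalues.
theorem zero_mem_spectrum_b : (0 : ℂ) ∈ spectrum ℂ (ofSphere q (bElt q)) := by
  refine (spectrum.isClosed (𝕜 := ℂ) _).mem_of_tendsto (b := Filter.atTop)
    (f := fun n : ℕ => ((q : ℂ) ^ 2) ^ (n + 1)) ?_ (Filter.Eventually.of_forall (mem_spectrum_b h0 h1))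
  refine (tendsto_pow_atTop_nhds_zero_of_norm_lt_one ?_).comp (Filter.tendsto_add_atTop_nat 1)
  rw [norm_pow, Complex.norm_real, Real.norm_of_nonneg h0.le]
  nlinarith

end rep

end QuantumLens

end

noncomputable section
open MulOpposite

namespace QuantumLens

open SphereAlg Polynomial

/-! ### The spectrum of `b` -/

section spectrum

theorem commute_aeval {A : Type*} [Ring A] [Algebra ℂ A] {x y : A} (h : Commute x y) (f : ℂ[X]) :
    Commute x (aeval y f) := by
  rw [aeval_eq_sum_range]
  exact Commute.sum_right _ _ _ fun i _ => (h.pow_right i).smul_right _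

/-- If `b a = r a b` and `a* a = p(b)`, then the spectrum of `b` is invariant under `λ ↦ r λ`, except
at the zeros of `p`. -/
theorem mul_mem_spectrum {A : Type*} [Ring A] [Algebra ℂ A] {a a' b : A} {r μ : ℂ} (hr : r ≠ 0)
    (h : b * a = r • (a * b)) (h' : a' * b = r • (b * a')) {p : ℂ[X]} (hp : a' * a = aeval b p)
    (hμ : μ ∈ spectrum ℂ b) (hpμ : p.eval μ ≠ 0) : r * μ ∈ spectrum ℂ b := by
  by_contra hn
  rw [spectrum.notMem_iff] at hn
  refine hμ ?_
  obtain ⟨u, hu⟩ := hn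
  -- Let `y` be the inverse of `rμ - b` and `c = μ - b`. The plan is to exhibit an inverse of `c`
  -- from `y` and the quotient `s` of `p - p(μ)` by `X - μ`.
  obtain ⟨s, hs⟩ := X_sub_C_dvd_sub_C_eval (a := μ) (p := p)
  set c : A := algebraMap ℂ A μ - b with hc
  set y : A := u⁻¹.1 with hy
  have hyb : Commute y b := by
    have h1 : Commute u.1 b := by
      rw [hu]
      exact (Algebra.commute_algebraMap_left _ _).sub_left (Commute.refl b)
    exact h1.units_inv_left
  have e1 : u.1 * a = r • (a * c) := by
    rw [hu, hc, sub_mul, h, mul_sub, smul_sub, ← Algebra.commutes (R := ℂ) μ a, ← Algebra.smul_def,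
      ← Algebra.smul_def, smul_smul]
  have e2 : a = r • (y * a * c) := by
    rw [mul_assoc, ← mul_smul_comm, ← e1, ← mul_assoc, hy, Units.inv_mul, one_mul]
  have e3 : a' * a = r • (a' * y * a) * c := by
    nth_rewrite 1 [e2]
    rw [mul_smul_comm, smul_mul_assoc]
    simp only [mul_assoc]
  have e4 : aeval b p = algebraMap ℂ A (p.eval μ) - aeval b s * c := by
    have := congrArg (aeval b) hs
    rw [map_sub, aeval_C, mul_comm, map_mul, map_sub, aeval_X, aeval_C, sub_eq_iff_eq_add] at this
    rw [this, hc, mul_sub, mul_sub]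
    abel
  -- Up to the nonzero scalar `p(μ)`, this provides a left inverse of `c`.
  have e5 : algebraMap ℂ A (p.eval μ) = (r • (a' * y * a) + aeval b s) * c := by
    rw [add_mul, ← e3, hp, e4, sub_add_cancel]
  -- The two scalars `r` from moving `b` past `a` and past `a'` cancel. Commutation with `b` is what
  -- turns the one-sided inverse of `c` into a two-sided one.
  have hcomm : Commute (a' * y * a) b := by
    have h2 : a' * y * a * b = r⁻¹ • (a' * y * (b * a)) := by
      rw [h, mul_smul_comm, smul_smul, inv_mul_cancel₀ hr, one_smul]
      simp only [mul_assoc]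
    have h3 : a' * y * (b * a) = r • (b * (a' * y * a)) := by
      calc a' * y * (b * a) = a' * (y * b) * a := by simp only [mul_assoc]
        _ = a' * b * (y * a) := by rw [hyb.eq]; simp only [mul_assoc]
        _ = _ := by rw [h', smul_mul_assoc]; simp only [mul_assoc]
    rw [commute_iff_eq, h2, h3, smul_smul, inv_mul_cancel₀ hr, one_smul]
  have hM : Commute (r • (a' * y * a) + aeval b s) c := by
    refine Commute.add_left (Commute.smul_left ?_ r) ?_
    · exact (Algebra.commute_algebraMap_right _ _).sub_right hcomm
    · exact (Algebra.commute_algebraMap_right _ _).sub_right (commute_aeval (Commute.refl b) s).symm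
  have hunit : IsUnit ((r • (a' * y * a) + aeval b s) * c) := by
    rw [← e5]
    exact (IsUnit.mk0 _ hpμ).map _
  exact (hM.isUnit_mul_iff.1 hunit).2

variable {q : ℝ} {k l : ℕ}

theorem bElt_mem : bElt q ∈ projAlg q k l := by
  rw [← hasWeight_zero_iff]
  simpa using hasWeight_aeval_b (q := q) (k := k) (l := l) X

variable (q k l) in
/-- The element `b = z₁ z₁*` of `𝒪(W_q(k,l))`. -/
def pB : projAlg q k l := ⟨bElt q, bElt_mem⟩

theorem aElt_mem : z 0 ^ l * star (z 1) ^ k ∈ projAlg q k l := by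
  rw [← hasWeight_zero_iff]
  have h := (hasWeight_z0l (q := q) (k := k) (l := l)).mul hasWeight_z1k.star
  rwa [star_pow, add_neg_cancel] at h

variable (q k l) in
/-- The element `a = z₀ˡ (z₁*)ᵏ` of `𝒪(W_q(k,l))`. -/
def pA : projAlg q k l := ⟨z 0 ^ l * star (z 1) ^ k, aElt_mem⟩

theorem coe_aeval_pB (f : ℂ[X]) :
    ((aeval (pB q k l) f : projAlg q k l) : SphereAlg q) = aeval (bElt q) f :=
  (Polynomial.aeval_algHom_apply (projAlg q k l).subtype.toAlgHom (pB q k l) f).symm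

theorem star_pB : star (pB q k l) = pB q k l := Subtype.ext star_bElt

theorem pB_mul_pA (hq : q ≠ 0) : pB q k l * pA q k l = (((q : ℂ) ^ 2)⁻¹ ^ l) • (pA q k l * pB q k l) := by
  refine Subtype.ext ?_
  change bElt q * (z 0 ^ l * star (z 1) ^ k) = _ • (z 0 ^ l * star (z 1) ^ k * bElt q)
  have h : star (z 1) ^ k * bElt q = bElt q * star (z 1) ^ k := by
    rw [pow_mul_of_qcomm star_z1_mul_b, one_pow, one_smul]
  rw [← mul_assoc, mul_pow_of_qcomm (b_mul_z0 hq), smul_mul_assoc, mul_assoc (z 0 ^ l) _ (bElt q), h,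
    mul_assoc]

theorem star_pA_mul_pB (hq : q ≠ 0) :
    star (pA q k l) * pB q k l = (((q : ℂ) ^ 2)⁻¹ ^ l) • (pB q k l * star (pA q k l)) := by
  have h := congrArg star (pB_mul_pA (k := k) (l := l) hq)
  rw [star_mul, star_smul, star_mul, star_pB] at h
  rw [h]
  congr 1
  rw [star_pow, star_inv₀, star_pow]
  congr 3
  exact Complex.conj_ofReal q

/-- The exceptional points for the scaling of the spectrum are the zeros of this polynomial, namely
`0` and `q²ᵐ⁺²` for `m < l`. -/
theorem star_pA_mul_pA (hq : q ≠ 0) :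
    star (pA q k l) * pA q k l = aeval (pB q k l) (starPowPoly q l * X ^ k) := by
  refine Subtype.ext ?_
  rw [coe_aeval_pB]
  change star (z 0 ^ l * star (z 1) ^ k) * (z 0 ^ l * star (z 1) ^ k) = _
  have h : Commute (z 1 ^ k) (aeval (bElt q) (starPowPoly q l)) := by
    refine commute_aeval (Commute.pow_left ?_ k) _
    have := z1_mul_b (q := q)
    rwa [one_smul] at this
  rw [star_mul, ← star_pow, star_star, star_pow, map_mul, ← star_z0_pow_mul hq, map_pow, aeval_X,
    (bElt_pow k).2, star_z0_pow_mul hq, star_pow, mul_assoc, ← mul_assoc (star (z 0) ^ l),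
    star_z0_pow_mul hq, ← mul_assoc, h.eq, mul_assoc]

theorem eval_starPowPoly_ne_zero (hq : q ≠ 0) {μ : ℂ} (h : ∀ n : ℕ, μ ≠ ((q : ℂ) ^ 2) ^ (n + 1)) (n : ℕ) :
    (starPowPoly q n).eval μ ≠ 0 := by
  have hq' : (q : ℂ) ≠ 0 := by exact_mod_cast hq
  rw [starPowPoly, eval_prod, Finset.prod_ne_zero_iff]
  intro m _ h0
  rw [eval_sub, eval_one, eval_mul, eval_C, eval_X, sub_eq_zero, inv_pow, eq_comm,
    inv_mul_eq_one₀ (by positivity)] at h0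
  exact h m h0.symm

variable {D : Type*} [CStarAlgebra D]

/-- By `mul_mem_spectrum` with the element `a`, the spectrum is stable under multiplication by `r =
q⁻²ˡ` away from the zeros of `a* a`. A point outside the asserted set never meets such a zero, and
its multiples by powers of `r` leave every bounded set. -/
theorem spectrum_map_pB_subset (hq0 : 0 < q) (hq1 : q < 1) (hl : 0 < l) (ρ : projAlg q k l →⋆ₐ[ℂ] D)
    {μ : ℂ} (hμ : μ ∈ spectrum ℂ (ρ (pB q k l))) : μ = 0 ∨ ∃ n : ℕ, μ = ((q : ℂ) ^ 2) ^ (n + 1) := by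
  by_contra hcon
  push Not at hcon
  obtain ⟨hμ0, hμS⟩ := hcon
  have hq : q ≠ 0 := hq0.ne'
  have hq' : (q : ℂ) ≠ 0 := by exact_mod_cast hq
  set r : ℂ := ((q : ℂ) ^ 2)⁻¹ ^ l with hr
  have hr0 : r ≠ 0 := by rw [hr]; positivity
  have key : ∀ j : ℕ, r ^ j * μ ∈ spectrum ℂ (ρ (pB q k l)) := by
    intro j
    induction j with
    | zero => simpa using hμ
    | succ j ih =>
      have h1 : (starPowPoly q l * X ^ k).eval (r ^ j * μ) ≠ 0 := by
        rw [eval_mul, eval_pow, eval_X]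
        refine mul_ne_zero (eval_starPowPoly_ne_zero hq (fun n hn => ?_) l) (pow_ne_zero _ (by positivity))
        -- If `rʲ μ = q²ⁿ⁺²`, then `μ` is the power of `q²` with exponent `lj + n + 1`.
        refine hμS (l * j + n) ?_
        have h2 : μ = (r ^ j)⁻¹ * ((q : ℂ) ^ 2) ^ (n + 1) := by
          rw [← hn, inv_mul_cancel_left₀ (pow_ne_zero _ hr0)]
        rw [h2, hr, ← pow_mul, inv_pow, inv_inv, ← pow_add, add_assoc]
      rw [pow_succ', mul_assoc]
      refine mul_mem_spectrum (a := ρ (pA q k l)) (a' := star (ρ (pA q k l))) hr0 ?_ ?_ ?_ ih h1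
      · rw [← map_mul, pB_mul_pA hq, map_smul, map_mul]
      · rw [← map_star, ← map_mul, star_pA_mul_pB hq, map_smul, map_mul]
      · rw [← map_star, ← map_mul, star_pA_mul_pA hq]
        exact (Polynomial.aeval_algHom_apply ρ.toAlgHom (pB q k l) _).symm
  -- The factor `‖1‖` is kept because the norm bound for the spectrum is stated for general normed
  -- algebras.
  have hbound : ∀ j : ℕ, ‖r‖ ^ j * ‖μ‖ ≤ ‖ρ (pB q k l)‖ * ‖(1 : D)‖ := fun j => by
    rw [← norm_pow, ← norm_mul]
    exact spectrum.norm_le_norm_mul_of_mem (key j)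
  have hr1 : 1 < ‖r‖ := by
    rw [hr, norm_pow, norm_inv, norm_pow, Complex.norm_real, Real.norm_of_nonneg hq0.le]
    refine one_lt_pow₀ ((one_lt_inv₀ (by positivity)).2 ?_) hl.ne'
    nlinarith
  have hlim := (tendsto_pow_atTop_atTop_of_one_lt hr1).atTop_mul_const (norm_pos_iff.2 hμ0)
  obtain ⟨j, hj⟩ := (hlim.eventually_gt_atTop (‖ρ (pB q k l)‖ * ‖(1 : D)‖)).exists
  exact absurd (hbound j) (not_le.2 hj)

/-- A polynomial with complex coefficients in a self-adjoint element need not be self-adjoint, but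
normality suffices for the norm to equal the spectral radius. -/
theorem isStarNormal_aeval {A : Type*} [CStarAlgebra A] {y : A} (hy : star y = y) (f : ℂ[X]) :
    IsStarNormal (aeval y f) := by
  refine ⟨commute_aeval ?_ f⟩
  have h := (commute_aeval (Commute.refl y) f).star_star
  rw [hy] at h
  exact h.symm

/-- The norm of a normal element is its spectral radius. By spectral mapping, the inequality follows
from the inclusion of the spectrum of `ρ(b)` in that of `b` in `C(S_q³)`. -/
theorem norm_map_aeval_pB_le (hq0 : 0 < q) (hq1 : q < 1) (hl : 0 < l) (ρ : projAlg q k l →⋆ₐ[ℂ] D)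
    (f : ℂ[X]) : ‖ρ (aeval (pB q k l) f)‖ ≤ ‖ofSphere q (aeval (bElt q) f)‖ := by
  -- The zero algebra is set apart because there the spectrum is empty.
  rcases subsingleton_or_nontrivial D with hD | hD
  · rw [Subsingleton.elim (ρ _) 0, norm_zero]; exact norm_nonneg _
  have e1 : ρ (aeval (pB q k l) f) = aeval (ρ (pB q k l)) f :=
    (Polynomial.aeval_algHom_apply ρ.toAlgHom (pB q k l) f).symm
  have e2 : ofSphere q (aeval (bElt q) f) = aeval (ofSphere q (bElt q)) f :=
    (Polynomial.aeval_algHom_apply (ofSphere q).toAlgHom (bElt q) f).symm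
  have hn : IsStarNormal (aeval (ρ (pB q k l)) f) :=
    isStarNormal_aeval (by rw [← map_star, star_pB]) f
  have h := hn.spectralRadius_eq_nnnorm
  rw [e1, e2, ← coe_nnnorm, ← coe_nnnorm, NNReal.coe_le_coe, ← ENNReal.coe_le_coe, ← h]
  refine iSup₂_le fun μ hμ => ?_
  rw [spectrum.map_polynomial_aeval_of_nonempty _ _ (spectrum.nonempty _)] at hμ
  obtain ⟨ν, hν, rfl⟩ := hμ
  have h1 : ν ∈ spectrum ℂ (ofSphere q (bElt q)) := by
    obtain rfl | ⟨n, rfl⟩ := spectrum_map_pB_subset hq0 hq1 hl ρ hν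
    · exact zero_mem_spectrum_b hq0 hq1
    · exact mem_spectrum_b hq0 hq1 n
  have h2 := spectrum.subset_polynomial_aeval (ofSphere q (bElt q)) f ⟨ν, h1, rfl⟩
  have h3 := spectrum.norm_le_norm_mul_of_mem h2
  have h4 := h3.trans (mul_le_of_le_one_right (norm_nonneg _) norm_one_le')
  exact ENNReal.coe_le_coe.2 h4

end spectrum

/-! ### The universal property of `B` -/

section enveloping

variable {q : ℝ} {k l : ℕ}

/-- Weight zero elements are combinations of weight zero monomials, by `mem_span_of_fixed`; the span
induction has to carry the membership along. -/
theorem projAlg_induction (hq : q ≠ 0) {P : projAlg q k l → Prop}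
    (hm : ∀ (p : ℂ[X] × ℤ × ℤ) (_ : k * p.2.1 + l * p.2.2 = 0) (h : monom q p ∈ projAlg q k l),
      P ⟨monom q p, h⟩)
    (h0 : P 0) (ha : ∀ x y, P x → P y → P (x + y)) (hs : ∀ (c : ℂ) x, P x → P (c • x))
    (x : projAlg q k l) : P x := by
  have key : ∀ y ∈ Submodule.span ℂ (monom q '' {p : ℂ[X] × ℤ × ℤ | k * p.2.1 + l * p.2.2 = 0}),
      ∃ h : y ∈ projAlg q k l, P ⟨y, h⟩ := by
    intro y hy
    induction hy using Submodule.span_induction with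
    | mem y hy =>
      obtain ⟨p, hp, rfl⟩ := hy
      have h : monom q p ∈ projAlg q k l := by
        rw [← hasWeight_zero_iff]
        have := (hasPhase_monom (q := q) p).hasWeight k l
        rwa [hp] at this
      exact ⟨h, hm p hp h⟩
    | zero => exact ⟨zero_mem _, h0⟩
    | add x y _ _ hx hy =>
      obtain ⟨hx, hx'⟩ := hx
      obtain ⟨hy, hy'⟩ := hy
      exact ⟨add_mem hx hy, ha _ _ hx' hy'⟩
    | smul c x _ hx =>
      obtain ⟨hx, hx'⟩ := hx
      exact ⟨SMulMemClass.smul_mem c hx, hs c _ hx'⟩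
  exact (key x.1 (mem_span_monom_of_mem_projAlg hq x.2)).2

/-- Both actions are diagonal on the generators. This is what lets the rotation of `z₀` act on the
fixed point algebra. -/
theorem circleAction_comm (k' l' : ℕ) (v w : Circle) (x : SphereAlg q) :
    circleAction q k l v (circleAction q k' l' w x) = circleAction q k' l' w (circleAction q k l v x) := by
  have : (circleAction q k l v).comp (circleAction q k' l' w) =
      (circleAction q k' l' w).comp (circleAction q k l v) := hom_ext fun i => by
    rw [StarAlgHom.comp_apply, StarAlgHom.comp_apply, circleAction_z, circleAction_z, map_smul,
      map_smul, circleAction_z, circleAction_z, smul_smul, smul_smul, mul_comm]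
  exact DFunLike.congr_fun this x

variable (q k l) in
/-- The gauge action on `𝒪(W_q(k,l))`, which rotates `z₀` and fixes `z₁`. -/
def gauge (w : Circle) : projAlg q k l →⋆ₐ[ℂ] projAlg q k l :=
  StarAlgHom.codRestrict ((circleAction q 1 0 w).comp (projAlg q k l).subtype) (projAlg q k l)
    fun x v => by
      rw [StarAlgHom.comp_apply, circleAction_comm]
      exact congrArg _ (x.2 v)

theorem gauge_coe (w : Circle) (x : projAlg q k l) :
    (gauge q k l w x : SphereAlg q) = circleAction q 1 0 w x := rfl

theorem gauge_monom (w : Circle) (p : ℂ[X] × ℤ × ℤ) (h : monom q p ∈ projAlg q k l) :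
    gauge q k l w ⟨monom q p, h⟩ = ((w ^ p.2.1 : Circle) : ℂ) • ⟨monom q p, h⟩ := by
  refine Subtype.ext ?_
  rw [gauge_coe, circleAction_monom]
  simp

theorem gauge_one (x : projAlg q k l) : gauge q k l 1 x = x := by
  refine Subtype.ext ?_
  have : circleAction q 1 0 1 = StarAlgHom.id ℂ (SphereAlg q) := hom_ext fun i => by
    rw [circleAction_z]
    fin_cases i <;> simp
  rw [gauge_coe, this]; rfl

variable {D : Type*} [CStarAlgebra D]

theorem continuous_gauge (hq : q ≠ 0) (ρ : projAlg q k l →⋆ₐ[ℂ] D) (x : projAlg q k l) :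
    Continuous fun w => ρ (gauge q k l w x) := by
  induction x using projAlg_induction hq with
  | hm p _ h =>
    simp only [gauge_monom, map_smul]
    exact (continuous_subtype_val.comp (continuous_zpow (G := Circle) _)).smul continuous_const
  | h0 => simpa only [map_zero] using continuous_const
  | ha x y hx hy => simp only [map_add]; exact hx.add hy
  | hs c x hx => simp only [map_smul]; exact hx.const_smul c

/-- On a monomial of weight zero, `kα + lβ = 0`. Averaging the rotation of `z₀` leaves only `α = 0`,
and then `β = 0` because `l > 0`, so that just `f(b)` remains. The point is that one polynomial
describes the mean in `D` and the mean in `C(S_q³)` at the same time. -/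
theorem exists_circleAvg_gauge (hq : q ≠ 0) (hl : 0 < l) (ρ : projAlg q k l →⋆ₐ[ℂ] D)
    (x : projAlg q k l) : ∃ f : ℂ[X],
      circleAvg (fun w => ρ (gauge q k l w x)) = ρ (aeval (pB q k l) f) ∧
      circleMean 1 0 hq (ofSphere q x) = ofSphere q (aeval (bElt q) f) := by
  induction x using projAlg_induction hq with
  | hm p hp h =>
    obtain ⟨f, α, β⟩ := p
    simp only [gauge_monom, map_smul]
    rw [circleAvg_zpow_smul, circleMean_monom]
    simp only [Nat.cast_one, one_mul, Nat.cast_zero, zero_mul, add_zero]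
    split_ifs with hα
    · have hβ : β = 0 := by
        have h1 : (l : ℤ) * β = 0 := by simpa [hα] using hp
        exact (mul_eq_zero.1 h1).resolve_left (by exact_mod_cast hl.ne')
      have hm : monom q (f, α, β) = aeval (bElt q) f := by
        rw [hα, hβ, monom]
        have h0 : ∀ i, (zpw i 0 : SphereAlg q) = 1 := fun i => pow_zero _
        rw [h0, h0, mul_one, mul_one]
      refine ⟨f, congrArg ρ (Subtype.ext ?_), congrArg _ hm⟩
      rw [coe_aeval_pB]
      exact hm
    · exact ⟨0, by rw [map_zero, map_zero], by rw [map_zero, map_zero]⟩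
  | h0 =>
    refine ⟨0, ?_, ?_⟩
    · simp only [map_zero]
      simp [circleAvg]
    · simp only [map_zero]
      exact (congrArg _ (map_zero (ofSphere q))).trans (map_zero _)
  | ha x y hx hy =>
    obtain ⟨f, hf, hf'⟩ := hx
    obtain ⟨g, hg, hg'⟩ := hy
    refine ⟨f + g, ?_, ?_⟩
    · simp only [map_add]
      rw [circleAvg_add (continuous_gauge hq ρ x) (continuous_gauge hq ρ y), hf, hg]
    · rw [map_add, map_add, ← hf', ← hg', ← map_add, ← map_add]; rfl
  | hs c x hx =>
    obtain ⟨f, hf, hf'⟩ := hx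
    refine ⟨c • f, ?_, ?_⟩
    · simp only [map_smul]
      rw [circleAvg_smul c (continuous_gauge hq ρ x), hf]
    · rw [map_smul, map_smul, ← hf', ← map_smul, ← map_smul]; rfl

/-- The orbit map of the gauge action. -/
def gaugeOrbit (hq : q ≠ 0) (ρ : projAlg q k l →⋆ₐ[ℂ] D) : projAlg q k l →⋆ₐ[ℂ] C(Circle, D) where
  toFun x := ⟨fun w => ρ (gauge q k l w x), continuous_gauge hq ρ x⟩
  map_one' := ContinuousMap.ext fun w => by simp
  map_mul' x y := ContinuousMap.ext fun w => by simp
  map_zero' := ContinuousMap.ext fun w => by simp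
  map_add' x y := ContinuousMap.ext fun w => by simp
  commutes' c := ContinuousMap.ext fun w => by
    change ρ (gauge q k l w (algebraMap ℂ _ c)) = algebraMap ℂ D c
    rw [AlgHomClass.commutes, AlgHomClass.commutes]
  map_star' x := ContinuousMap.ext fun w => by simp [map_star]

/-- The C*-algebra generated by the pairs of an element of `𝒪(W_q(k,l))` and its gauge orbit. -/
def orbitGraph (hq : q ≠ 0) (ρ : projAlg q k l →⋆ₐ[ℂ] D) : StarSubalgebra ℂ (CSphere q × C(Circle, D)) :=
  (StarAlgHom.range (((ofSphere q).comp (projAlg q k l).subtype).prod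
    (gaugeOrbit hq ρ))).topologicalClosure

instance (hq : q ≠ 0) (ρ : projAlg q k l →⋆ₐ[ℂ] D) : CStarAlgebra (orbitGraph hq ρ) :=
  haveI : IsClosed (orbitGraph hq ρ : Set (CSphere q × C(Circle, D))) :=
    StarSubalgebra.isClosed_topologicalClosure _
  StarSubalgebra.cstarAlgebra _

theorem orbitGraph_coe (hq : q ≠ 0) (ρ : projAlg q k l →⋆ₐ[ℂ] D) :
    (orbitGraph hq ρ : Set (CSphere q × C(Circle, D))) =
      closure (Set.range fun x : projAlg q k l => (ofSphere q x, gaugeOrbit hq ρ x)) := rfl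

theorem continuous_circleAvg : Continuous fun g : C(Circle, D) => circleAvg g := by
  let L : C(Circle, D) →ₗ[ℂ] D :=
    { toFun := fun g => circleAvg g
      map_add' := fun f g => circleAvg_add f.continuous g.continuous
      map_smul' := fun c g => circleAvg_smul c g.continuous }
  exact AddMonoidHomClass.continuous_of_bound L 1 fun g => by
    rw [one_mul]
    exact norm_circleAvg_le fun w => g.norm_coe_le_norm w

/-- On the dense part both means are given by one polynomial in `b`, to which the comparison of
norms `norm_map_aeval_pB_le` applies; the inequality is a closed condition. -/
theorem norm_circleAvg_le_of_mem (hq0 : 0 < q) (hq1 : q < 1) (hl : 0 < l)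
    (ρ : projAlg q k l →⋆ₐ[ℂ] D) {x : CSphere q × C(Circle, D)} (hx : x ∈ orbitGraph hq0.ne' ρ) :
    ‖circleAvg x.2‖ ≤ ‖circleMean 1 0 hq0.ne' x.1‖ := by
  rw [← SetLike.mem_coe, orbitGraph_coe] at hx
  refine closure_minimal (t := {x : CSphere q × C(Circle, D) |
    ‖circleAvg x.2‖ ≤ ‖circleMean 1 0 hq0.ne' x.1‖}) ?_ (isClosed_le ?_ ?_) hx
  · rintro _ ⟨x, rfl⟩
    obtain ⟨f, hf, hf'⟩ := exists_circleAvg_gauge hq0.ne' hl ρ x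
    change ‖circleAvg fun w => ρ (gauge q k l w x)‖ ≤ ‖circleMean 1 0 hq0.ne' (ofSphere q x)‖
    rw [hf, hf']
    exact norm_map_aeval_pB_le hq0 hq1 hl ρ f
  · exact (continuous_circleAvg.comp continuous_snd).norm
  · exact ((circleMean 1 0 hq0.ne').continuous.comp continuous_fst).norm

/-- The projection of the orbit graph to `B`. -/
def orbitFst (hq : q ≠ 0) (ρ : projAlg q k l →⋆ₐ[ℂ] D) : orbitGraph hq ρ →⋆ₐ[ℂ] projC q k l :=
  StarAlgHom.codRestrict ((StarAlgHom.fst ℂ _ _).comp (orbitGraph hq ρ).subtype) (projC q k l) fun x => by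
    have hx := x.2
    rw [← SetLike.mem_coe, orbitGraph_coe] at hx
    refine closure_minimal (t := {x : CSphere q × C(Circle, D) | x.1 ∈ projC q k l}) ?_
      ((StarSubalgebra.isClosed_topologicalClosure _).preimage continuous_fst) hx
    rintro _ ⟨x, rfl⟩
    exact mem_projC_of x.2

/-- If the first entry of `x` vanishes, then so does the mean of the second entry of `x* x`, and the
mean is faithful. -/
theorem orbitFst_injective (hq0 : 0 < q) (hq1 : q < 1) (hl : 0 < l) (ρ : projAlg q k l →⋆ₐ[ℂ] D) :
    Function.Injective (orbitFst hq0.ne' ρ) := by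
  refine (injective_iff_map_eq_zero _).2 fun x hx => ?_
  have h1 : x.1.1 = 0 := congrArg Subtype.val hx
  have h2 := norm_circleAvg_le_of_mem hq0 hq1 hl ρ (star x * x).2
  have h3 : (star x * x).1.1 = 0 := by
    change star x.1.1 * x.1.1 = 0
    rw [h1, mul_zero]
  rw [h3, map_zero, norm_zero, norm_le_zero_iff] at h2
  refine Subtype.ext (Prod.ext h1 (ContinuousMap.ext fun w => ?_))
  exact eq_zero_of_circleAvg_star_mul_self x.1.2.continuous h2 w

theorem projOf_denseRange : DenseRange (projOf q k l) := by
  intro b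
  have hb := b.2
  rw [← SetLike.mem_coe, projC_coe] at hb
  rw [closure_subtype]
  convert hb using 2
  ext y
  constructor
  · rintro ⟨_, ⟨x, rfl⟩, rfl⟩
    exact ⟨x, x.2, rfl⟩
  · rintro ⟨x, hx, rfl⟩
    exact ⟨projOf q k l ⟨x, hx⟩, ⟨_, rfl⟩, rfl⟩

/-- The element of the orbit graph defined by an element of `𝒪(W_q(k,l))`. -/
def toGraph (hq : q ≠ 0) (ρ : projAlg q k l →⋆ₐ[ℂ] D) (x : projAlg q k l) : orbitGraph hq ρ :=
  ⟨(ofSphere q x, gaugeOrbit hq ρ x), subset_closure ⟨x, rfl⟩⟩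

/-- An injective `*`-homomorphism of C*-algebras is isometric, so its range is closed; it contains
the dense image of `𝒪(W_q(k,l))`. -/
theorem orbitFst_bijective (hq0 : 0 < q) (hq1 : q < 1) (hl : 0 < l) (ρ : projAlg q k l →⋆ₐ[ℂ] D) :
    Function.Bijective (orbitFst hq0.ne' ρ) := by
  have hinj := orbitFst_injective hq0 hq1 hl ρ
  refine ⟨hinj, fun b => ?_⟩
  have hcl : IsClosed (Set.range (orbitFst hq0.ne' ρ)) :=
    (NonUnitalStarAlgHom.isometry _ hinj).isClosedEmbedding.isClosed_range
  refine closure_minimal ?_ hcl (projOf_denseRange b)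
  rintro _ ⟨x, rfl⟩
  exact ⟨toGraph hq0.ne' ρ x, rfl⟩

/-- The extension goes back from `B` to the orbit graph, takes the orbit function and evaluates it
at `1`, where the gauge action is trivial. Uniqueness is density. -/
theorem isEnveloping_projOf (hq0 : 0 < q) (hq1 : q < 1) (hl : 0 < l) :
    IsEnveloping.{u} (projOf q k l) := by
  intro D _ ρ
  let e : orbitGraph hq0.ne' ρ ≃⋆ₐ[ℂ] projC q k l :=
    StarAlgEquiv.ofBijective (orbitFst hq0.ne' ρ) (orbitFst_bijective hq0 hq1 hl ρ)
  let ev : C(Circle, D) →⋆ₐ[ℂ] D :=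
    { toFun := fun g => g 1
      map_one' := rfl
      map_mul' := fun _ _ => rfl
      map_zero' := rfl
      map_add' := fun _ _ => rfl
      commutes' := fun _ => rfl
      map_star' := fun _ => rfl }
  let ρ' : projC q k l →⋆ₐ[ℂ] D :=
    (ev.comp ((StarAlgHom.snd ℂ (CSphere q) C(Circle, D)).comp (orbitGraph hq0.ne' ρ).subtype)).comp
      (e.symm : projC q k l →⋆ₐ[ℂ] orbitGraph hq0.ne' ρ)
  have hρ' : ∀ x, ρ' (projOf q k l x) = ρ x := fun x => by
    have h1 : e.symm (projOf q k l x) = toGraph hq0.ne' ρ x := by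
      rw [StarAlgEquiv.symm_apply_eq]; rfl
    change ev (e.symm (projOf q k l x)).1.2 = ρ x
    rw [h1]
    change ρ (gauge q k l 1 x) = ρ x
    rw [gauge_one]
  refine ⟨ρ', hρ', fun f hf => DFunLike.coe_injective ?_⟩
  exact projOf_denseRange.equalizer (continuous_starHom f) (continuous_starHom ρ')
    (funext fun x => (hf x).trans (hρ' x).symm)

end enveloping

end QuantumLens

end

noncomputable section
open MulOpposite

namespace QuantumLens

open SphereAlg Corr
open QuantumLens.HilbertModule (inn)
open scoped TensorProduct

variable {q : ℝ} {k l : ℕ}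

/-! ### Correspondences inside `C(S_q³)` -/

/-- The elements of weight `m` and `-m` generate the unit. -/
def IsFullWeight (q : ℝ) (k l : ℕ) (m : ℤ) : Prop :=
  ∃ (ι : Type) (_ : Fintype ι) (u v : ι → CSphere q),
    (∀ i, u i ∈ cwt q k l m) ∧ (∀ i, v i ∈ cwt q k l (-m)) ∧ ∑ i, u i * v i = 1

/-- Turns the algebraic membership of `1` in a product of weight spaces into an explicit finite
family, the form in which it is used as a frame. -/
theorem isFullWeight_of_dvd (hq : q ≠ 0) {m : ℤ} (hm : (k * l : ℤ) ∣ m) : IsFullWeight q k l m := by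
  have key : ∀ x ∈ wt q k l m * wt q k l (-m), ∃ (ι : Type) (_ : Fintype ι) (u v : ι → CSphere q),
      (∀ i, u i ∈ cwt q k l m) ∧ (∀ i, v i ∈ cwt q k l (-m)) ∧ ∑ i, u i * v i = ofSphere q x := by
    intro x hx
    induction hx using Submodule.mul_induction_on' with
    | mem_mul_mem a ha b hb =>
      exact ⟨Unit, inferInstance, fun _ => ofSphere q a, fun _ => ofSphere q b,
        fun _ => of_mem_cwt ha, fun _ => of_mem_cwt hb, by simp⟩
    | add x _ y _ hx hy =>
      obtain ⟨ι, _, u, v, hu, hv, h⟩ := hx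
      obtain ⟨κ, _, u', v', hu', hv', h'⟩ := hy
      refine ⟨ι ⊕ κ, inferInstance, Sum.elim u u', Sum.elim v v', ?_, ?_, ?_⟩
      · rintro (i | i); exacts [hu i, hu' i]
      · rintro (i | i); exacts [hv i, hv' i]
      · rw [Fintype.sum_sum_type, map_add, ← h, ← h']; rfl
  obtain ⟨ι, _, u, v, hu, hv, h⟩ := key 1 (one_mem_wt_mul_of_dvd hq hm)
  exact ⟨ι, ‹_›, u, v, hu, hv, by rw [h, map_one]⟩

/-- A realization of the correspondence `F` as the space of elements of weight `n` in `C(S_q³)`. -/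
structure Realization (F : Corr (projC q k l)) (n : ℤ) where
  /-- the embedding -/
  toLin : F →ₗ[ℂ] CSphere q
  inn_eq : ∀ x y, star (toLin x) * toLin y = (F.pre.inn x y : projC q k l)
  act : ∀ b x, toLin (F.act b x) = (b : CSphere q) * toLin x
  range_eq : Set.range toLin = cwt q k l n

namespace Realization

variable {F G : Corr (projC q k l)} {m n : ℤ}

theorem mem_cwt (e : Realization F n) (x : F) : e.toLin x ∈ cwt q k l n := by
  rw [← SetLike.mem_coe, ← e.range_eq]; exact ⟨x, rfl⟩

theorem exists_eq (e : Realization F n) {c : CSphere q} (hc : c ∈ cwt q k l n) :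
    ∃ x, e.toLin x = c := by
  rw [← SetLike.mem_coe, ← e.range_eq] at hc; exact hc

theorem norm_toLin (e : Realization F n) (x : F) : ‖e.toLin x‖ = ‖x‖ := by
  have h : ‖e.toLin x‖ ^ 2 = ‖x‖ ^ 2 := by
    rw [sq, ← CStarRing.norm_star_mul_self, e.inn_eq, norm_sq]; rfl
  exact (pow_left_inj₀ (norm_nonneg _) (norm_nonneg _) two_ne_zero).1 h

theorem injective (e : Realization F n) : Function.Injective e.toLin :=
  (injective_iff_map_eq_zero _).2 fun x hx => by
    rw [← norm_eq_zero, ← e.norm_toLin, hx, norm_zero]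

/-- Right linearity is no field of `Realization` because the inner products force it: the difference
`δ` of the two sides is orthogonal to both of them, so `δ* δ = 0`. -/
theorem ract (e : Realization F n) (b : projC q k l) (x : F) :
    e.toLin (F.pre.ract (op b) x) = e.toLin x * b := by
  have key : ∀ u, star (e.toLin u) * (e.toLin (F.pre.ract (op b) x) - e.toLin x * b) = 0 := fun u => by
    rw [mul_sub, e.inn_eq, ← mul_assoc, e.inn_eq, F.pre.inn_ract]
    exact sub_self _
  rw [← sub_eq_zero, ← CStarRing.star_mul_self_eq_zero_iff, star_sub, sub_mul, key, StarMul.star_mul,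
    mul_assoc, key, mul_zero, sub_zero]

/-- Replace the weight by an equal one. -/
def cast (e : Realization F m) (h : m = n) : Realization F n where
  toLin := e.toLin
  inn_eq := e.inn_eq
  act := e.act
  range_eq := h ▸ e.range_eq

/-- The realization of the identity correspondence. -/
def unit : Realization (Corr.unit (projC q k l)) 0 where
  toLin := (projC q k l).subtype.toLinearMap
  inn_eq _ _ := rfl
  act _ _ := rfl
  range_eq := by
    rw [cwt_zero_coe]
    exact Subtype.range_coe

theorem lineC_eq_cwt (hq : q ≠ 0) : lineC q k l = cwt q k l (-(k * l)) := by
  have : lineMod q k l = wt q k l (-(k * l)) :=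
    SetLike.ext fun x => ⟨hasWeight_of_mem, mem_lineMod_of_hasWeight hq⟩
  rw [lineC, cwt, this]

/-- The realization of the correspondence `E`. -/
def line (hq : 0 < q) : Realization (lineCorr q hq k l) (-(k * l)) where
  toLin := (lineC q k l).subtype
  inn_eq _ _ := rfl
  act _ _ := rfl
  range_eq := by
    rw [← lineC_eq_cwt hq.ne']
    exact Subtype.range_coe

/-- The multiplication map on the algebraic tensor product. -/
def mulMap (e : Realization F m) (f : Realization G n) : F ⊗[ℂ] G →ₗ[ℂ] CSphere q :=
  TensorProduct.lift ((LinearMap.mul ℂ (CSphere q)).compl₁₂ e.toLin f.toLin)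

theorem mulMap_tmul (e : Realization F m) (f : Realization G n) (x : F) (y : G) :
    e.mulMap f (x ⊗ₜ y) = e.toLin x * f.toLin y := rfl

/-- In `(x y)* (x' y') = y* (x* x') y'` the middle factor is `⟨x, x'⟩`, which acts on `y'` by left
multiplication; this is the interior inner product. -/
theorem star_mulMap_mul (e : Realization F m) (f : Realization G n) (s t : F ⊗[ℂ] G) :
    star (e.mulMap f s) * e.mulMap f t = ((tensorPre F G).inn s t : projC q k l) := by
  induction t with
  | zero => rw [map_zero, mul_zero, PreHilbert.inn_zero_right]; rfl
  | add t t' h h' => rw [map_add, mul_add, h, h', PreHilbert.inn_add_right]; rfl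
  | tmul x' y' =>
    induction s with
    | zero => rw [map_zero, star_zero, zero_mul, ← PreHilbert.star_inn, PreHilbert.inn_zero_right,
        star_zero]; rfl
    | add s s' h h' => rw [map_add, star_add, add_mul, h, h', PreHilbert.inn_add_left]; rfl
    | tmul x y =>
      change _ = ((G.pre.inn y (G.act (F.pre.inn x x') y') : projC q k l) : CSphere q)
      rw [mulMap_tmul, mulMap_tmul, StarMul.star_mul, mul_assoc, ← mul_assoc (star (e.toLin x)), e.inn_eq,
        ← f.act, f.inn_eq]

theorem norm_mulMap (e : Realization F m) (f : Realization G n) (t : F ⊗[ℂ] G) :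
    ‖e.mulMap f t‖ = (tensorPre F G).nrm t := by
  have h : ‖e.mulMap f t‖ ^ 2 = (tensorPre F G).nrm t ^ 2 := by
    rw [sq, ← CStarRing.norm_star_mul_self, e.star_mulMap_mul, PreHilbert.nrm_sq]; rfl
  exact (pow_left_inj₀ (norm_nonneg _) (PreHilbert.nrm_nonneg _ _) two_ne_zero).1 h

/-- The multiplication map on the interior tensor product. -/
def mulCompl (e : Realization F m) (f : Realization G n) : Corr.tensor F G →L[ℂ] CSphere q :=
  (tensorPre F G).ext (e.mulMap f) 1 fun t => by rw [e.norm_mulMap, one_mul]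

theorem mulCompl_of (e : Realization F m) (f : Realization G n) (t : F ⊗[ℂ] G) :
    e.mulCompl f ((tensorPre F G).of t) = e.mulMap f t := PreHilbert.ext_of _ _ _ _ _

theorem mulMap_mem (e : Realization F m) (f : Realization G n) (t : F ⊗[ℂ] G) :
    e.mulMap f t ∈ cwt q k l (m + n) := by
  induction t with
  | zero => rw [map_zero]; exact zero_mem _
  | add t t' h h' => rw [map_add]; exact add_mem h h'
  | tmul x y => exact mul_mem_cwt (e.mem_cwt x) (f.mem_cwt y)

theorem continuous_coe_inn {X : Type*} [TopologicalSpace X] {f g : X → F}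
    (hf : Continuous f) (hg : Continuous g) :
    Continuous fun x => ((F.pre.inn (f x) (g x) : projC q k l) : CSphere q) :=
  continuous_subtype_val.comp (HilbertModule.continuous_inn hf hg)

/-- The realization of an interior tensor product. -/
def tensor (e : Realization F m) (f : Realization G n) (hm : IsFullWeight q k l m) :
    Realization (Corr.tensor F G) (m + n) where
  toLin := (e.mulCompl f).toLinearMap
  inn_eq x y := by
    change star (e.mulCompl f x) * e.mulCompl f y = _
    refine (tensorPre F G).induction_on₂ (p := fun x y => star (e.mulCompl f x) * e.mulCompl f y =
      (((Corr.tensor F G).pre.inn x y : projC q k l) : CSphere q)) x y (isClosed_eq ?_ ?_) ?_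
    · exact ((e.mulCompl f).continuous.comp continuous_fst).star.mul
        ((e.mulCompl f).continuous.comp continuous_snd)
    · exact continuous_coe_inn continuous_fst continuous_snd
    · intro s t
      rw [mulCompl_of, mulCompl_of, star_mulMap_mul]
      exact congrArg Subtype.val ((tensorPre F G).inn_of s t).symm
  act b x := by
    change e.mulCompl f (((Corr.tensor F G).φ b).1 x) = b * e.mulCompl f x
    refine (tensorPre F G).induction_on (p := fun x =>
      e.mulCompl f (((Corr.tensor F G).φ b).1 x) = b * e.mulCompl f x) x (isClosed_eq ?_ ?_) ?_
    · exact (e.mulCompl f).continuous.comp ((Corr.tensor F G).φ b).1.continuous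
    · exact continuous_const.mul (e.mulCompl f).continuous
    · intro t
      have h : ((Corr.tensor F G).φ b).1 ((tensorPre F G).of t) =
          (tensorPre F G).of ((tensorAct F G).act b t) := (tensorAct F G).lift_of b t
      rw [h, mulCompl_of, mulCompl_of]
      induction t with
      | zero => rw [map_zero, map_zero, mul_zero]
      | add t t' ht ht' =>
        rw [map_add, map_add, map_add, mul_add, ht ((tensorAct F G).lift_of b t),
          ht' ((tensorAct F G).lift_of b t')]
      | tmul x y =>
        change e.mulMap f (F.act b x ⊗ₜ y) = _
        rw [mulMap_tmul, mulMap_tmul, e.act, mul_assoc]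
  range_eq := by
    refine Set.Subset.antisymm ?_ fun c hc => ?_
    · rintro _ ⟨x, rfl⟩
      change e.mulCompl f x ∈ cwt q k l (m + n)
      refine (tensorPre F G).induction_on (p := fun x => e.mulCompl f x ∈ cwt q k l (m + n)) x
        ((isClosed_cwt _).preimage (e.mulCompl f).continuous) fun t => ?_
      rw [mulCompl_of]
      exact e.mulMap_mem f t
    -- Write `c = ∑ uᵢ (vᵢ c)`: fullness makes already the algebraic tensors exhaust the weight
    -- space.
    · obtain ⟨ι, _, u, v, hu, hv, h⟩ := hm
      choose x hx using fun i => e.exists_eq (hu i)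
      have hv' : ∀ i, v i * c ∈ cwt q k l n := fun i => by
        have := mul_mem_cwt (hv i) hc
        rwa [neg_add_cancel_left] at this
      choose y hy using fun i => f.exists_eq (hv' i)
      refine ⟨(tensorPre F G).of (∑ i, x i ⊗ₜ y i), ?_⟩
      change e.mulCompl f _ = c
      rw [mulCompl_of, map_sum]
      simp only [mulMap_tmul, hx, hy, ← mul_assoc]
      rw [← Finset.sum_mul, h, one_mul]

theorem tensor_tmul (e : Realization F m) (f : Realization G n) (hm : IsFullWeight q k l m) (x : F)
    (y : G) : (e.tensor f hm).toLin (tmul x y) = e.toLin x * f.toLin y :=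
  e.mulCompl_of f (x ⊗ₜ y)

theorem pow_weight (m : ℤ) (n : ℕ) : m + ((n + 1 : ℕ) : ℤ) * m = ((n + 2 : ℕ) : ℤ) * m := by
  push_cast; ring

/-- The realization of the tensor powers. -/
def pow (e : Realization F m) (hm : IsFullWeight q k l m) :
    (n : ℕ) → Realization (tensorPow F n) ((n : ℤ) * m)
  | 0 => unit.cast (by simp)
  | 1 => e.cast (by simp)
  | n + 2 => (e.tensor (pow e hm (n + 1)) hm).cast (pow_weight m n)

theorem pow_tprod (e : Realization F m) (hm : IsFullWeight q k l m) :
    ∀ (n : ℕ) (ξ : Fin n → F),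
      (e.pow hm n).toLin (tprod F n ξ) = (List.ofFn fun i => e.toLin (ξ i)).prod
  | 0, ξ => by rw [List.ofFn_zero, List.prod_nil]; rfl
  | 1, ξ => by
    rw [List.ofFn_succ, List.ofFn_zero, List.prod_cons, List.prod_nil, mul_one]; rfl
  | n + 2, ξ => by
    rw [List.ofFn_succ, List.prod_cons]
    refine (e.tensor_tmul (e.pow hm (n + 1)) hm (ξ 0) (tprod F (n + 1) (Fin.tail ξ))).trans ?_
    rw [pow_tprod e hm (n + 1) (Fin.tail ξ)]; rfl

/-- The map `λ_ξ ↦ ξ*`. -/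
def starLin (e : Realization F n) : Dual F →ₗ[ℂ] CSphere q where
  toFun x := star (e.toLin (unlam x))
  map_add' x y := by rw [Dual.unlam_add, map_add, star_add]
  map_smul' c x := by
    rw [Dual.smul_def, Dual.unlam_lam, map_smul, star_smul]
    congr 1
    exact Complex.conj_conj c

/-- The realization of the dual correspondence. -/
def dual (e : Realization F n) (h : F.IsPimsnerPair) : Realization (Corr.dual F h) (-n) where
  toLin := e.starLin
  inn_eq x y := by
    change star (star (e.toLin (unlam x))) * star (e.toLin (unlam y)) =
      (h.inv (unlam x) (unlam y) : projC q k l)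
    -- The operator `θ_{x,y}` is left multiplication by the weight zero element `x y*`, which
    -- therefore is its preimage under `φ`.
    have hb : e.toLin (unlam x) * star (e.toLin (unlam y)) ∈ projC q k l := by
      have := mul_mem_cwt (e.mem_cwt (unlam x)) (star_mem_cwt (e.mem_cwt (unlam y)))
      rwa [add_neg_cancel, mem_cwt_zero] at this
    rw [star_star, h.inv_eq (b := ⟨_, hb⟩) fun ζ => e.injective ?_]
    rw [e.act, e.ract, mul_assoc, e.inn_eq]
  act b x := by
    change star (e.toLin (F.pre.ract (op (star b)) (unlam x))) = b * star (e.toLin (unlam x))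
    rw [e.ract, StarMul.star_mul]
    congr 1
    exact star_star b.1
  range_eq := by
    ext c
    constructor
    · rintro ⟨x, rfl⟩
      exact star_mem_cwt (e.mem_cwt (unlam x))
    · intro hc
      have h1 := star_mem_cwt hc
      rw [neg_neg] at h1
      obtain ⟨x, hx⟩ := e.exists_eq h1
      refine ⟨lam x, ?_⟩
      change star (e.toLin x) = c
      rw [hx, star_star]

theorem dual_lam (e : Realization F n) (h : F.IsPimsnerPair) (x : F) :
    (e.dual h).toLin (lam x) = star (e.toLin x) := rfl

end Realization

end QuantumLens

end

noncomputable section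
open MulOpposite

namespace QuantumLens

open SphereAlg Corr
open QuantumLens.HilbertModule (inn)

variable {q : ℝ} {k l : ℕ}

/-! ### The standing assumptions -/

/-- The monomials `bⁱ z₀^α z₁^β` form a countable family whose span is dense. -/
theorem separableSpace_CSphere (hq : q ≠ 0) : TopologicalSpace.SeparableSpace (CSphere q) := by
  let m : ℕ × ℤ × ℤ → SphereAlg q := fun p => monom q (Polynomial.X ^ p.1, p.2)
  have h1 : Submodule.span ℂ (Set.range m) = ⊤ := by
    rw [← top_le_iff, ← span_monom hq, Submodule.span_le]
    rintro _ ⟨⟨P, p⟩, rfl⟩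
    have : monom q (P, p) = ∑ i ∈ Finset.range (P.natDegree + 1), P.coeff i • m (i, p) := by
      simp only [m, monom, Polynomial.aeval_eq_sum_range (p := P), map_pow, Polynomial.aeval_X,
        Finset.sum_mul, smul_mul_assoc]
    rw [this]
    exact sum_mem fun i _ => Submodule.smul_mem _ _ (Submodule.subset_span ⟨_, rfl⟩)
  have h2 : Set.range (ofSphere q) =
      (Submodule.span ℂ (Set.range fun p => ofSphere q (m p)) : Set (CSphere q)) := by
    have h := congrArg (Submodule.map (ofSphere q : SphereAlg q →ₗ[ℂ] CSphere q)) h1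
    rw [Submodule.map_span, Submodule.map_top] at h
    have h' := congrArg (fun S : Submodule ℂ (CSphere q) => (S : Set (CSphere q))) h
    rw [Set.range_comp' (ofSphere q) m]
    exact h'.symm
  have h3 := (Set.countable_range fun p => ofSphere q (m p)).isSeparable.span (R := ℂ)
  rw [← h2] at h3
  rw [← TopologicalSpace.isSeparable_univ_iff, ← (Enveloping.denseRange_of (𝒜 := SphereAlg q)).closure_range]
  exact h3.closure

namespace Realization

variable {F : Corr (projC q k l)} {n : ℤ}

theorem mem_projC_of_neg_mul {u v : CSphere q} (hu : u ∈ cwt q k l (-n)) (hv : v ∈ cwt q k l n) :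
    u * v ∈ projC q k l := by
  have := mul_mem_cwt hu hv
  rwa [neg_add_cancel, mem_cwt_zero] at this

theorem mem_projC_of_mul_neg {u v : CSphere q} (hu : u ∈ cwt q k l n) (hv : v ∈ cwt q k l (-n)) :
    u * v ∈ projC q k l := by
  have := mul_mem_cwt hu hv
  rwa [add_neg_cancel, mem_cwt_zero] at this

theorem mul_projC_mem {u : CSphere q} (hu : u ∈ cwt q k l n) (b : projC q k l) :
    u * b ∈ cwt q k l n := by
  have := mul_mem_cwt hu (mem_cwt_zero.2 b.2)
  rwa [add_zero] at this

/-- The `uᵢ` form a finite frame: `ξ = ∑ uᵢ (vᵢ ξ)`, where `vᵢ ξ` lies in `B`. -/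
theorem exists_countable_generators (e : Realization F n) (hn : IsFullWeight q k l n) :
    ∃ s : Set F, s.Countable ∧ Dense (Submodule.span (projC q k l)ᵐᵒᵖ s : Set F) := by
  obtain ⟨ι, _, u, v, hu, hv, h⟩ := hn
  choose x hx using fun i => e.exists_eq (hu i)
  refine ⟨Set.range x, Set.countable_range x, ?_⟩
  have : Submodule.span (projC q k l)ᵐᵒᵖ (Set.range x) = ⊤ := by
    refine (Submodule.eq_top_iff').2 fun ξ => ?_
    have hξ : ξ = ∑ i, op (⟨v i * e.toLin ξ, mem_projC_of_neg_mul (hv i) (e.mem_cwt ξ)⟩ :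
        projC q k l) • x i := by
      refine e.injective ?_
      rw [map_sum]
      have h1 : ∀ i, e.toLin (op (⟨v i * e.toLin ξ, mem_projC_of_neg_mul (hv i) (e.mem_cwt ξ)⟩ :
          projC q k l) • x i) = u i * v i * e.toLin ξ := fun i => by
        refine (e.ract _ _).trans ?_
        rw [hx, mul_assoc]
      simp only [h1]
      rw [← Finset.sum_mul, h, one_mul]
    rw [hξ]
    exact sum_mem fun i _ => Submodule.smul_mem _ _ (Submodule.subset_span ⟨i, rfl⟩)
  rw [this]
  exact dense_univ

/-- Here the decomposition of `1` for the opposite weight is used: `b = ∑ ⟨uᵢ*, vᵢ b⟩` with `uᵢ*`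
and `vᵢ b` of weight `n`. -/
theorem dense_span_inn (e : Realization F n) (hn : IsFullWeight q k l (-n)) :
    Dense (Submodule.span ℂ {b : projC q k l | ∃ ξ η : F, b = inn ξ η} : Set (projC q k l)) := by
  obtain ⟨ι, _, u, v, hu, hv, h⟩ := hn
  rw [neg_neg] at hv
  have hu' : ∀ i, star (u i) ∈ cwt q k l n := fun i => by
    have := star_mem_cwt (hu i)
    rwa [neg_neg] at this
  choose x hx using fun i => e.exists_eq (hu' i)
  have : Submodule.span ℂ {b : projC q k l | ∃ ξ η : F, b = inn ξ η} = ⊤ := by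
    refine (Submodule.eq_top_iff').2 fun b => ?_
    choose y hy using fun i => e.exists_eq (mul_projC_mem (hv i) b)
    have hb : b = ∑ i, F.pre.inn (x i) (y i) := by
      refine Subtype.ext ?_
      rw [AddSubmonoidClass.coe_finsetSum]
      simp only [← e.inn_eq, hx, hy, star_star, ← mul_assoc]
      rw [← Finset.sum_mul, h, one_mul]
    rw [hb]
    exact sum_mem fun i _ => Submodule.subset_span ⟨x i, y i, rfl⟩
  rw [this]
  exact dense_univ

theorem φ_injective (e : Realization F n) (hn : IsFullWeight q k l n) :
    Function.Injective F.φ := fun a b hab => by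
  obtain ⟨ι, _, u, v, hu, hv, h⟩ := hn
  choose x hx using fun i => e.exists_eq (hu i)
  have h1 : ∀ i, (a : CSphere q) * u i = b * u i := fun i => by
    rw [← hx, ← e.act, ← e.act, act_apply, act_apply, hab]
  refine Subtype.ext ?_
  rw [← mul_one a.1, ← mul_one b.1, ← h, Finset.mul_sum, Finset.mul_sum]
  simp only [← mul_assoc, h1]

/-- In `C(S_q³)` the formula `ξ ⟨η, ζ⟩ = (ξ η*) ζ` is associativity. -/
theorem theta_eq (e : Realization F n) (ξ η : F) :
    theta (projC q k l) ξ η = F.φ ⟨e.toLin ξ * star (e.toLin η),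
      mem_projC_of_mul_neg (e.mem_cwt ξ) (star_mem_cwt (e.mem_cwt η))⟩ :=
  Adjointable.ext fun ζ => e.injective <| by
    refine (e.ract (F.pre.inn η ζ) ξ).trans (Eq.trans ?_ (e.act _ ζ).symm)
    rw [← e.inn_eq, mul_assoc]

/-- Writing `b = ∑ uᵢ (vᵢ b)` shows that `φ(b)` is even a finite sum of operators `θ`. -/
theorem range_φ (e : Realization F n) (hn : IsFullWeight q k l n) :
    Set.range F.φ = compacts (projC q k l) F := by
  refine Set.Subset.antisymm ?_ (closure_minimal ?_ ?_)
  · rintro _ ⟨b, rfl⟩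
    obtain ⟨ι, _, u, v, hu, hv, h⟩ := hn
    choose x hx using fun i => e.exists_eq (hu i)
    have hv' : ∀ i, star (v i * b) ∈ cwt q k l n := fun i => by
      have := star_mem_cwt (mul_projC_mem (hv i) b)
      rwa [neg_neg] at this
    choose y hy using fun i => e.exists_eq (hv' i)
    have hb : F.φ b = ∑ i, theta (projC q k l) (x i) (y i) := by
      simp only [e.theta_eq, ← map_sum]
      congr 1
      refine Subtype.ext ?_
      rw [AddSubmonoidClass.coe_finsetSum]
      simp only [hx, hy, star_star, ← mul_assoc]
      rw [← Finset.sum_mul, h, one_mul]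
    rw [hb]
    exact subset_closure (sum_mem fun i _ => Submodule.subset_span ⟨x i, y i, rfl⟩)
  -- Conversely every `θ` lies in the range of `φ`, which is closed because `φ` is injective and
  -- hence isometric.
  · have : Submodule.span ℂ {T | ∃ ξ η : F, T = theta (projC q k l) ξ η} ≤
        LinearMap.range F.φ.toAlgHom.toLinearMap := by
      rw [Submodule.span_le]
      rintro _ ⟨ξ, η, rfl⟩
      exact ⟨_, (e.theta_eq ξ η).symm⟩
    exact this
  · exact (NonUnitalStarAlgHom.isometry F.φ (e.φ_injective hn)).isClosedEmbedding.isClosed_range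

theorem isPimsnerPair (e : Realization F n) (hq : q ≠ 0) (hn : IsFullWeight q k l n)
    (hn' : IsFullWeight q k l (-n)) : F.IsPimsnerPair where
  separable :=
    haveI := separableSpace_CSphere hq
    (TopologicalSpace.IsSeparable.of_separableSpace (projC q k l : Set (CSphere q))).separableSpace
  countablyGenerated := e.exists_countable_generators hn
  full := e.dense_span_inn hn'
  injective := e.φ_injective hn
  range_eq := e.range_φ hn

/-! ### The realization of the Fock module -/

/-- The realizations of the components of the Fock module. -/
def fock (e : Realization F n) (h : F.IsPimsnerPair) (hn : IsFullWeight q k l n)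
    (hn' : IsFullWeight q k l (-n)) : ∀ j : ℤ, Realization (fockMod F h j) (j * n)
  | Int.ofNat j => e.pow hn j
  | Int.negSucc j => ((e.dual h).pow hn' (j + 1)).cast (by
      rw [Int.negSucc_eq]; push_cast; ring)

/-- The adjoint of left multiplication by `t` is left multiplication by `t*`. The difference of the
two candidates has weight `m`, hence comes from some `z` in `F`, and testing against `z` gives zero.
-/
theorem down_eq {F G : Corr (projC q k l)} {m n : ℤ} {M : ℝ} (e : Realization F m)
    (f : Realization G n) (p : AdjPair F G M) {t : CSphere q} (ht : t ∈ cwt q k l (n - m))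
    (hp : ∀ w, f.toLin (p.up w) = t * e.toLin w) (y : G) :
    e.toLin (p.down y) = star t * f.toLin y := by
  obtain ⟨z, hz⟩ := e.exists_eq (c := e.toLin (p.down y) - star t * f.toLin y) (by
    refine sub_mem (e.mem_cwt _) ?_
    have := mul_mem_cwt (star_mem_cwt ht) (f.mem_cwt y)
    rwa [neg_sub, sub_add_cancel] at this)
  rw [← sub_eq_zero, ← CStarRing.star_mul_self_eq_zero_iff]
  nth_rewrite 1 [← hz]
  rw [mul_sub, e.inn_eq, ← p.adj, ← f.inn_eq, hp, StarMul.star_mul, mul_assoc, sub_self]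

theorem powPair_up (e : Realization F n) (hn : IsFullWeight q k l n) (ξ : F) {M : ℝ}
    (hM : ‖ξ‖ ^ 2 ≤ M) :
    ∀ (j : ℕ) (x : tensorPow F j), (e.pow hn (j + 1)).toLin ((F.powPair ξ hM j).up x) =
      e.toLin ξ * (e.pow hn j).toLin x
  | 0, b => e.ract b ξ
  | j + 1, x => e.tensor_tmul (e.pow hn (j + 1)) hn ξ x

theorem powPair_down (e : Realization F n) (hn : IsFullWeight q k l n) (ξ : F) {M : ℝ}
    (hM : ‖ξ‖ ^ 2 ≤ M) (j : ℕ) (y : tensorPow F (j + 1)) :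
    (e.pow hn j).toLin ((F.powPair ξ hM j).down y) =
      star (e.toLin ξ) * (e.pow hn (j + 1)).toLin y :=
  (e.pow hn j).down_eq (e.pow hn (j + 1)) _ (by
    have : ((j + 1 : ℕ) : ℤ) * n - j * n = n := by push_cast; ring
    rw [this]
    exact e.mem_cwt ξ) (e.powPair_up hn ξ hM j) y

/-- In negative degrees the component of `S_ξ` is the adjoint of multiplication by `λ_ξ`, which is
realized as `ξ*`; so it is again multiplication by `ξ`, uniformly in `j`. -/
theorem fockPair_up (e : Realization F n) (h : F.IsPimsnerPair) (hn : IsFullWeight q k l n)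
    (hn' : IsFullWeight q k l (-n)) (ξ : F) : ∀ (j : ℤ) (x : fockMod F h j),
      (e.fock h hn hn' (j + 1)).toLin ((fockPair F h ξ j).up x) =
        e.toLin ξ * (e.fock h hn hn' j).toLin x
  | Int.ofNat j, x => e.powPair_up hn ξ _ j x
  | Int.negSucc 0, x => by
    have := (e.dual h).powPair_down hn' (lam ξ) (norm_sq_lam_le_succ F h ξ) 0 x
    rwa [dual_lam, star_star] at this
  | Int.negSucc (j + 1), x => by
    have := (e.dual h).powPair_down hn' (lam ξ) (norm_sq_lam_le_succ F h ξ) (j + 1) x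
    rwa [dual_lam, star_star] at this

theorem fockPair_down (e : Realization F n) (h : F.IsPimsnerPair) (hn : IsFullWeight q k l n)
    (hn' : IsFullWeight q k l (-n)) (ξ : F) (j : ℤ) (y : fockMod F h (j + 1)) :
    (e.fock h hn hn' j).toLin ((fockPair F h ξ j).down y) =
      star (e.toLin ξ) * (e.fock h hn hn' (j + 1)).toLin y :=
  (e.fock h hn hn' j).down_eq (e.fock h hn hn' (j + 1)) _ (by
    have : (j + 1) * n - j * n = n := by ring
    rw [this]
    exact e.mem_cwt ξ) (e.fockPair_up h hn hn' ξ j) y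

end Realization

end QuantumLens

end

noncomputable section
open MulOpposite

namespace QuantumLens

open SphereAlg Corr
open QuantumLens.HilbertModule (inn)
open scoped DirectSum

/-! ### C*-algebras generated by pairs -/

section pairs

variable {A C ι : Type} [CStarAlgebra A] [CStarAlgebra C] (a : ι → A) (c : ι → C)

/-- The C*-algebra generated by the family `a`. -/
def genAlg : NonUnitalStarSubalgebra ℂ A :=
  (NonUnitalStarAlgebra.adjoin ℂ (Set.range a)).topologicalClosure

theorem mem_genAlg (i : ι) : a i ∈ genAlg a :=
  NonUnitalStarSubalgebra.le_topologicalClosure _ (NonUnitalStarAlgebra.subset_adjoin ℂ _ ⟨i, rfl⟩)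

theorem isClosed_genAlg : IsClosed (genAlg a : Set A) :=
  NonUnitalStarSubalgebra.isClosed_topologicalClosure _

instance : NonUnitalCStarAlgebra (genAlg a) :=
  NonUnitalStarSubalgebra.nonUnitalCStarAlgebra (genAlg a) (h_closed := isClosed_genAlg a)

theorem genAlg_le {S : NonUnitalStarSubalgebra ℂ A} (hS : IsClosed (S : Set A)) (h : ∀ i, a i ∈ S) :
    genAlg a ≤ S := by
  refine NonUnitalStarSubalgebra.topologicalClosure_minimal _ (NonUnitalStarAlgebra.adjoin_le ?_) hS
  rintro _ ⟨i, rfl⟩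
  exact h i

/-- The C*-algebra generated by the pairs `(a i, c i)`. -/
abbrev pairAlg : NonUnitalStarSubalgebra ℂ (A × C) := genAlg fun i => (a i, c i)

variable {a c}

/-- `P` is an algebraic property, possibly lost in limits; `Q` is a weaker property that is closed.
`P` is required for the adjoints of the generators only, not to be stable under adjoints. -/
theorem pairAlg_induction {P Q : A → C → Prop} (hgen : ∀ i, P (a i) (c i))
    (hstar : ∀ i, P (star (a i)) (star (c i))) (hzero : P 0 0)
    (hadd : ∀ T T' t t', P T t → P T' t' → P (T + T') (t + t'))
    (hmul : ∀ T T' t t', P T t → P T' t' → P (T * T') (t * t'))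
    (hsmul : ∀ (r : ℂ) T t, P T t → P (r • T) (r • t))
    (hPQ : ∀ T t, P T t → Q T t) (hQ : IsClosed {x : A × C | Q x.1 x.2})
    {x : A × C} (hx : x ∈ pairAlg a c) : Q x.1 x.2 := by
  refine closure_minimal (t := {x : A × C | Q x.1 x.2}) ?_ hQ hx
  intro x hx
  refine hPQ _ _ ?_
  -- Carrying `P` for `x` and its adjoint together gets the induction through the star step.
  suffices hs : P x.1 x.2 ∧ P (star x).1 (star x).2 from hs.1
  induction hx using NonUnitalStarAlgebra.adjoin_induction with
  | mem x hx =>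
    obtain ⟨i, rfl⟩ := hx
    exact ⟨hgen i, hstar i⟩
  | add x y _ _ hx hy =>
    rw [star_add]
    exact ⟨hadd _ _ _ _ hx.1 hy.1, hadd _ _ _ _ hx.2 hy.2⟩
  | zero =>
    rw [star_zero]
    exact ⟨hzero, hzero⟩
  | mul x y _ _ hx hy =>
    rw [star_mul]
    exact ⟨hmul _ _ _ _ hx.1 hy.1, hmul _ _ _ _ hy.2 hx.2⟩
  | smul r x _ hx =>
    rw [star_smul]
    exact ⟨hsmul _ _ _ hx.1, hsmul _ _ _ hx.2⟩
  | star x _ hx =>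
    rw [star_star]
    exact ⟨hx.2, hx.1⟩

/-- An injective `*`-homomorphism on a generated C*-algebra is an isomorphism onto the C*-algebra
generated by the images of the generators. -/
theorem exists_equiv_of_injective (f : A →⋆ₙₐ[ℂ] C) (hf : ∀ i, f (a i) = c i)
    (hinj : ∀ x ∈ genAlg a, f x = 0 → x = 0) :
    ∃ Φ : genAlg a ≃⋆ₐ[ℂ] genAlg c, ∀ x, (Φ x : C) = f x := by
  let g : genAlg a →⋆ₙₐ[ℂ] C := f.comp (NonUnitalStarSubalgebraClass.subtype (genAlg a))
  have hg : Function.Injective g :=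
    (injective_iff_map_eq_zero _).2 fun x hx => Subtype.ext (hinj x x.2 hx)
  have hcl : IsClosed (NonUnitalStarAlgHom.range g : Set C) :=
    (NonUnitalStarAlgHom.isometry g hg).isClosedEmbedding.isClosed_range
  have h1 : genAlg c ≤ NonUnitalStarAlgHom.range g :=
    genAlg_le c hcl fun i => ⟨⟨a i, mem_genAlg a i⟩, hf i⟩
  have h2 : genAlg a ≤ (genAlg c).comap f :=
    genAlg_le a ((isClosed_genAlg c).preimage
      (AddMonoidHomClass.continuous_of_bound f 1 fun x => by
        rw [one_mul]; exact NonUnitalStarAlgHom.norm_apply_le f x)) fun i => by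
      rw [NonUnitalStarSubalgebra.mem_comap, hf]; exact mem_genAlg c i
  refine ⟨StarAlgEquiv.ofBijective
    (NonUnitalStarAlgHom.codRestrict g (genAlg c) fun x => h2 x.2)
    ⟨fun x y hxy => hg (congrArg Subtype.val hxy), fun y => ?_⟩, fun x => rfl⟩
  obtain ⟨x, hx⟩ := h1 y.2
  exact ⟨x, Subtype.ext hx⟩

/-- The hypothesis makes both projections of the algebra of pairs injective, hence isomorphisms onto
the two generated algebras; compose one with the inverse of the other. -/
theorem exists_equiv_of_pairs (h : ∀ x ∈ pairAlg a c, x.1 = 0 ↔ x.2 = 0) :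
    ∃ Φ : genAlg a ≃⋆ₐ[ℂ] genAlg c, ∀ i, (Φ ⟨a i, mem_genAlg a i⟩ : C) = c i := by
  obtain ⟨Φ₁, h₁⟩ := exists_equiv_of_injective (a := fun i => (a i, c i)) (c := a)
    (NonUnitalStarAlgHom.fst ℂ A C) (fun i => rfl) fun x hx h0 => Prod.ext h0 ((h x hx).1 h0)
  obtain ⟨Φ₂, h₂⟩ := exists_equiv_of_injective (a := fun i => (a i, c i)) (c := c)
    (NonUnitalStarAlgHom.snd ℂ A C) (fun i => rfl) fun x hx h0 => Prod.ext ((h x hx).2 h0) h0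
  refine ⟨Φ₁.symm.trans Φ₂, fun i => ?_⟩
  have h3 : Φ₁ ⟨(a i, c i), mem_genAlg _ i⟩ = ⟨a i, mem_genAlg a i⟩ := Subtype.ext (h₁ _)
  rw [StarAlgEquiv.trans_apply, ← h3, StarAlgEquiv.symm_apply_apply, h₂]
  rfl

end pairs

variable {q : ℝ} {k l : ℕ}

/-! ### Operators on the Fock module and their symbols -/

namespace Realization

variable {F : Corr (projC q k l)} {n : ℤ} (e : Realization F n) (h : F.IsPimsnerPair)
  (hn : IsFullWeight q k l n) (hn' : IsFullWeight q k l (-n))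

/-- The sum of the realizations of the components of the Fock module. -/
def sumLin : (⨁ j, fockMod F h j) →ₗ[ℂ] CSphere q :=
  DirectSum.toModule ℂ ℤ _ fun j => (e.fock h hn hn' j).toLin

theorem sumLin_lof (j : ℤ) (a : fockMod F h j) :
    e.sumLin h hn hn' (DirectSum.lof ℂ ℤ (fun j => fockMod F h j) j a) =
      (e.fock h hn hn' j).toLin a :=
  DirectSum.toModule_lof (M := fun j => (fockMod F h j : Type)) ℂ j a

theorem sum_induction {ι : Type} [DecidableEq ι] {F : ι → Corr (projC q k l)}
    {P : (⨁ j, F j) → Prop} (x : ⨁ j, F j) (h0 : P 0)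
    (ha : ∀ x y, P x → P y → P (x + y)) (hl : ∀ j a, P (DirectSum.lof ℂ ι (fun j => F j) j a)) :
    P x := by
  induction x using DirectSum.induction_on with
  | zero => exact h0
  | add x y hx hy => exact ha x y hx hy
  | of j a => exact hl j a

/-- The components have the weights `jn`, which are distinct because `n ≠ 0`. The mean kills
products of different components, just as the direct sum makes them orthogonal. -/
theorem circleMean_star_sumLin_mul (hq : q ≠ 0) (hn0 : n ≠ 0) (x y : ⨁ j, fockMod F h j) :
    circleMean k l hq (star (e.sumLin h hn hn' x) * e.sumLin h hn hn' y) =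
      ((sumPre (fockMod F h)).inn x y : projC q k l) := by
  refine sum_induction (P := fun x => circleMean k l hq (star (e.sumLin h hn hn' x) *
    e.sumLin h hn hn' y) = ((sumPre (fockMod F h)).inn x y : projC q k l)) x ?_ ?_ ?_
  · rw [map_zero, star_zero, zero_mul, map_zero, ← PreHilbert.star_inn, PreHilbert.inn_zero_right,
      star_zero]; rfl
  · intro x x' hx hx'
    rw [map_add, star_add, add_mul, map_add, hx, hx', PreHilbert.inn_add_left]; rfl
  · intro i a
    refine sum_induction (P := fun y => circleMean k l hq (star (e.sumLin h hn hn'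
      (DirectSum.lof ℂ ℤ (fun j => fockMod F h j) i a)) * e.sumLin h hn hn' y) =
      ((sumPre (fockMod F h)).inn (DirectSum.lof ℂ ℤ (fun j => fockMod F h j) i a) y :
        projC q k l)) y ?_ ?_ ?_
    · rw [map_zero, mul_zero, map_zero, PreHilbert.inn_zero_right]; rfl
    · intro y y' hy hy'
      rw [map_add, mul_add, map_add, hy, hy', PreHilbert.inn_add_right]; rfl
    · intro j b
      rw [sumLin_lof, sumLin_lof, sumPre_inn_lof]
      have hmem := mul_mem_cwt (star_mem_cwt ((e.fock h hn hn' i).mem_cwt a))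
        ((e.fock h hn hn' j).mem_cwt b)
      rw [circleMean_of_mem_cwt hq hmem]
      rcases eq_or_ne j i with rfl | hij
      · rw [if_pos (by ring), (e.fock h hn hn' j).inn_eq, DirectSum.lof_apply]
      · rw [if_neg, DirectSum.lof_eq_of, DirectSum.of_eq_of_ne _ _ _ hij.symm,
          PreHilbert.inn_zero_right]
        · rfl
        · intro h0
          have : (j - i) * n = 0 := by linear_combination h0
          rcases mul_eq_zero.1 this with h1 | h1
          · exact hij (sub_eq_zero.1 h1)
          · exact hn0 h1

theorem sumLin_shiftUp (ξ : F) (x : ⨁ j, fockMod F h j) :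
    e.sumLin h hn hn' (shiftUp (fockPair F h ξ) x) = e.toLin ξ * e.sumLin h hn hn' x := by
  refine sum_induction (P := fun x => e.sumLin h hn hn' (shiftUp (fockPair F h ξ) x) =
    e.toLin ξ * e.sumLin h hn hn' x) x ?_ ?_ ?_
  · rw [map_zero, map_zero, mul_zero]
  · intro x y hx hy
    rw [map_add, map_add, map_add, mul_add, hx, hy]
  · intro j a
    rw [shiftUp_lof, sumLin_lof, sumLin_lof, fockPair_up]

theorem shiftDown_lof {B : Type} [CStarAlgebra B] {F : ℤ → Corr B} {M : ℝ}
    (p : ∀ n, AdjPair (F n) (F (n + 1)) M) (j : ℤ) (a : F (j + 1)) :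
    shiftDown p (DirectSum.lof ℂ ℤ (fun n => F n) (j + 1) a) =
      DirectSum.lof ℂ ℤ (fun n => F n) j ((p j).down a) := by
  refine DFinsupp.ext fun m => ?_
  rw [shiftDown_apply]
  rcases eq_or_ne m j with rfl | hm
  · rw [DirectSum.lof_apply, DirectSum.lof_apply]
  · rw [DirectSum.lof_eq_of, DirectSum.lof_eq_of, DirectSum.of_eq_of_ne _ _ _ hm,
      DirectSum.of_eq_of_ne _ _ _ fun h => hm (by omega), map_zero]

theorem sumLin_shiftDown (ξ : F) (x : ⨁ j, fockMod F h j) :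
    e.sumLin h hn hn' (shiftDown (fockPair F h ξ) x) =
      star (e.toLin ξ) * e.sumLin h hn hn' x := by
  refine sum_induction (P := fun x => e.sumLin h hn hn' (shiftDown (fockPair F h ξ) x) =
    star (e.toLin ξ) * e.sumLin h hn hn' x) x ?_ ?_ ?_
  · rw [map_zero, map_zero, mul_zero]
  · intro x y hx hy
    rw [map_add, map_add, map_add, mul_add, hx, hy]
  · intro j a
    obtain ⟨i, rfl⟩ : ∃ i, j = i + 1 := ⟨j - 1, by ring⟩
    rw [shiftDown_lof, sumLin_lof, sumLin_lof, fockPair_down]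

/-- The operator `T` restricts to the algebraic direct sum, where it is the multiplication by `t`. -/
def IsSymbol (T : Adjointable (projC q k l) (Fock F h)) (t : CSphere q) : Prop :=
  ∃ A : (⨁ j, fockMod F h j) →ₗ[ℂ] (⨁ j, fockMod F h j),
    (∀ y, T.1 ((sumPre (fockMod F h)).of y) = (sumPre (fockMod F h)).of (A y)) ∧
    ∀ y, e.sumLin h hn hn' (A y) = t * e.sumLin h hn hn' y

section IsSymbol

variable {e h hn hn'}
variable {T T' : Adjointable (projC q k l) (Fock F h)} {t t' : CSphere q}

theorem IsSymbol.mul (hx : e.IsSymbol h hn hn' T t) (hy : e.IsSymbol h hn hn' T' t') :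
    e.IsSymbol h hn hn' (T * T') (t * t') := by
  obtain ⟨A, hA, hA'⟩ := hx
  obtain ⟨A', hB, hB'⟩ := hy
  refine ⟨A ∘ₗ A', fun z => ?_, fun z => ?_⟩
  · change T.1 (T'.1 _) = _
    rw [hB, hA]; rfl
  · rw [LinearMap.comp_apply, hA', hB', ← mul_assoc]

theorem IsSymbol.add (hx : e.IsSymbol h hn hn' T t) (hy : e.IsSymbol h hn hn' T' t') :
    e.IsSymbol h hn hn' (T + T') (t + t') := by
  obtain ⟨A, hA, hA'⟩ := hx
  obtain ⟨A', hB, hB'⟩ := hy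
  refine ⟨A + A', fun z => ?_, fun z => ?_⟩
  · change T.1 _ + T'.1 _ = _
    rw [hB, hA, LinearMap.add_apply, map_add]
  · rw [LinearMap.add_apply, map_add, hA', hB', ← add_mul]

theorem IsSymbol.smul (c : ℂ) (hx : e.IsSymbol h hn hn' T t) :
    e.IsSymbol h hn hn' (c • T) (c • t) := by
  obtain ⟨A, hA, hA'⟩ := hx
  refine ⟨c • A, fun z => ?_, fun z => ?_⟩
  · change c • T.1 _ = _
    rw [hA, LinearMap.smul_apply, map_smul]
  · rw [LinearMap.smul_apply, map_smul, hA', ← smul_mul_assoc]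

variable (e h hn hn')

theorem isSymbol_zero : e.IsSymbol h hn hn' 0 0 := by
  refine ⟨0, fun z => ?_, fun z => ?_⟩
  · rw [LinearMap.zero_apply, map_zero]; rfl
  · rw [LinearMap.zero_apply, map_zero, zero_mul]

end IsSymbol

theorem S_of (ξ : F) (y : ⨁ j, fockMod F h j) :
    (S F h ξ).1 ((sumPre (fockMod F h)).of y) =
      (sumPre (fockMod F h)).of (shiftUp (fockPair F h ξ) y) :=
  PreHilbert.ext_of _ _ _ _ _

theorem isSymbol_S (ξ : F) : e.IsSymbol h hn hn' (S F h ξ) (e.toLin ξ) :=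
  ⟨shiftUp (fockPair F h ξ), S_of h ξ, e.sumLin_shiftUp h hn hn' ξ⟩

theorem star_S_of (ξ : F) (y : ⨁ j, fockMod F h j) :
    (star (S F h ξ) : Adjointable (projC q k l) (Fock F h)).1 ((sumPre (fockMod F h)).of y) =
      (sumPre (fockMod F h)).of (shiftDown (fockPair F h ξ) y) := by
  refine HilbertModule.ext_inn (projC q k l) fun z => ?_
  refine (sumPre (fockMod F h)).induction_on (p := fun z => inn (B := projC q k l) z
    ((star (S F h ξ) : Adjointable (projC q k l) (Fock F h)).1 ((sumPre (fockMod F h)).of y)) =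
    inn z ((sumPre (fockMod F h)).of (shiftDown (fockPair F h ξ) y))) z (isClosed_eq
    (HilbertModule.continuous_inn continuous_id continuous_const)
    (HilbertModule.continuous_inn continuous_id continuous_const)) fun x => ?_
  rw [Adjointable.inn_star_right, PreHilbert.inn_of, ← shift_adj, ← PreHilbert.inn_of, S_of]

theorem isSymbol_star_S (ξ : F) : e.IsSymbol h hn hn' (star (S F h ξ)) (star (e.toLin ξ)) :=
  ⟨shiftDown (fockPair F h ξ), star_S_of h ξ, e.sumLin_shiftDown h hn hn' ξ⟩

theorem symbol_induction {Q : Adjointable (projC q k l) (Fock F h) → CSphere q → Prop}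
    (hPQ : ∀ T t, e.IsSymbol h hn hn' T t → Q T t)
    (hQ : IsClosed {x : Adjointable (projC q k l) (Fock F h) × CSphere q | Q x.1 x.2})
    {x : Adjointable (projC q k l) (Fock F h) × CSphere q} (hx : x ∈ pairAlg (S F h) e.toLin) :
    Q x.1 x.2 :=
  pairAlg_induction (P := e.IsSymbol h hn hn') (e.isSymbol_S h hn hn') (e.isSymbol_star_S h hn hn')
    (e.isSymbol_zero h hn hn') (fun _ _ _ _ => .add) (fun _ _ _ _ => .mul) (fun c _ _ => .smul c)
    hPQ hQ hx

/-- The matrix coefficients of the operator of a pair. -/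
theorem inn_of_mem_pairAlg (hq : q ≠ 0) (hn0 : n ≠ 0)
    {x : Adjointable (projC q k l) (Fock F h) × CSphere q} (hx : x ∈ pairAlg (S F h) e.toLin)
    (y z : ⨁ j, fockMod F h j) :
    ((inn ((sumPre (fockMod F h)).of y) (x.1.1 ((sumPre (fockMod F h)).of z)) : projC q k l) :
      CSphere q) =
      circleMean k l hq (star (e.sumLin h hn hn' y) * (x.2 * e.sumLin h hn hn' z)) := by
  refine e.symbol_induction h hn hn' (Q := fun T t =>
    ((inn ((sumPre (fockMod F h)).of y) (T.1 ((sumPre (fockMod F h)).of z)) : projC q k l) :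
      CSphere q) = circleMean k l hq (star (e.sumLin h hn hn' y) * (t * e.sumLin h hn hn' z)))
    ?_ (isClosed_eq ?_ ?_) hx
  · rintro T t ⟨A, hA, hA'⟩
    rw [hA, PreHilbert.inn_of, ← hA', e.circleMean_star_sumLin_mul h hn hn' hq hn0]
  · refine continuous_subtype_val.comp (HilbertModule.continuous_inn continuous_const ?_)
    exact ((ContinuousLinearMap.apply ℂ (Fock F h) _).continuous).comp
      (continuous_subtype_val.comp continuous_fst)
  · exact (circleMean k l hq).continuous.comp
      (continuous_const.mul (continuous_snd.mul continuous_const))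

theorem exists_sumLin_eq_one : ∃ y, e.sumLin h hn hn' y = 1 := by
  obtain ⟨a, ha⟩ := (e.fock h hn hn' 0).exists_eq (c := 1)
    (by rw [zero_mul, mem_cwt_zero]; exact one_mem _)
  exact ⟨_, (e.sumLin_lof h hn hn' 0 a).trans ha⟩

/-- Apply the multiplication by `t` to a vector realized as `1`. Some argument is needed since the
range of `sumLin` is confined to weights divisible by `n`. -/
theorem snd_mem_closure {x : Adjointable (projC q k l) (Fock F h) × CSphere q}
    (hx : x ∈ pairAlg (S F h) e.toLin) : x.2 ∈ closure (Set.range (e.sumLin h hn hn')) := by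
  refine e.symbol_induction h hn hn' (Q := fun _ t => t ∈ closure (Set.range (e.sumLin h hn hn')))
    ?_ (isClosed_closure.preimage continuous_snd) hx
  rintro T t ⟨A, -, hA⟩
  obtain ⟨y, hy⟩ := e.exists_sumLin_eq_one h hn hn'
  exact subset_closure ⟨A y, by rw [hA, hy, mul_one]⟩

include hn hn' in
-- The matrix coefficients of `T` are the means of `y* t z`. If `t = 0` they all vanish, so `T = 0`.
-- If `T = 0`, take `z` realized as `1` and let `y` tend to `t`: the mean of `t* t` is zero, so `t =
-- 0` by faithfulness.
theorem fst_eq_zero_iff (hq : q ≠ 0) (hn0 : n ≠ 0)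
    (x : Adjointable (projC q k l) (Fock F h) × CSphere q) (hx : x ∈ pairAlg (S F h) e.toLin) :
    x.1 = 0 ↔ x.2 = 0 := by
  constructor
  · intro h1
    obtain ⟨z, hz⟩ := e.exists_sumLin_eq_one h hn hn'
    refine eq_zero_of_circleMean (k := k) (l := l) hq ?_
    -- The condition on `u` is closed and holds on the range of `sumLin`, so it may be used at `u =
    -- t`.
    refine closure_minimal (t := {u | circleMean k l hq (star u * x.2) = 0}) ?_
      (isClosed_eq ((circleMean k l hq).continuous.comp
        (continuous_star.mul continuous_const)) continuous_const) (e.snd_mem_closure h hn hn' hx)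
    rintro _ ⟨y, rfl⟩
    have h2 := e.inn_of_mem_pairAlg h hn hn' hq hn0 hx y z
    rw [hz, mul_one, h1] at h2
    refine h2.symm.trans ?_
    exact congrArg Subtype.val ((HilbertModule.pre (projC q k l) (Fock F h)).inn_zero_right _)
  · intro h1
    refine (sumPre (fockMod F h)).adjointable_ext fun z =>
      HilbertModule.ext_inn (projC q k l) fun y => ?_
    refine (sumPre (fockMod F h)).induction_on (p := fun y => inn (B := projC q k l) y
      (x.1.1 ((sumPre (fockMod F h)).of z)) = inn y
      ((0 : Adjointable (projC q k l) (Fock F h)).1 ((sumPre (fockMod F h)).of z))) y (isClosed_eq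
      (HilbertModule.continuous_inn continuous_id continuous_const)
      (HilbertModule.continuous_inn continuous_id continuous_const)) fun y => ?_
    refine Eq.trans (Subtype.ext ?_)
      ((HilbertModule.pre (projC q k l) (Fock F h)).inn_zero_right _).symm
    rw [e.inn_of_mem_pairAlg h hn hn' hq hn0 hx y z, h1, zero_mul, mul_zero, map_zero]; rfl

end Realization

end QuantumLens

end

noncomputable section
open MulOpposite

namespace QuantumLens

open SphereAlg Corr

variable {q : ℝ} {k l : ℕ}

/-! ### Generators of the quantum lens space -/

/-- An element of weight `jn` is split as `∑ uᵢ (vᵢ c)`, which moves `j` one step towards zero.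
Neither sign of `j` can be dispensed with, so both decompositions of `1` enter. -/
theorem mem_of_weight {n : ℤ} {A : NonUnitalStarSubalgebra ℂ (CSphere q)}
    (hn : IsFullWeight q k l n) (hn' : IsFullWeight q k l (-n)) (hA : ∀ c ∈ cwt q k l n, c ∈ A)
    (j : ℤ) : ∀ c ∈ cwt q k l (j * n), c ∈ A := by
  have hA' : ∀ c ∈ cwt q k l (-n), c ∈ A := fun c hc => by
    have := star_mem_cwt hc
    rw [neg_neg] at this
    rw [← star_star c]
    exact star_mem (hA _ this)
  obtain ⟨ι, _, u, v, hu, hv, huv⟩ := hn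
  obtain ⟨ι', _, u', v', hu', hv', huv'⟩ := hn'
  rw [neg_neg] at hv'
  have hsum : ∀ c, c = ∑ i, u i * (v i * c) := fun c => by
    simp only [← mul_assoc]
    rw [← Finset.sum_mul, huv, one_mul]
  have hsum' : ∀ c, c = ∑ i, u' i * (v' i * c) := fun c => by
    simp only [← mul_assoc]
    rw [← Finset.sum_mul, huv', one_mul]
  induction j using Int.induction_on with
  | zero =>
    intro c hc
    -- In weight zero the second factors `vᵢ c` have weight `-n`, which is reached by taking
    -- adjoints.
    rw [hsum c]
    refine sum_mem fun i _ => mul_mem (hA _ (hu i)) (hA' _ ?_)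
    have := mul_mem_cwt (hv i) hc
    rwa [zero_mul, add_zero] at this
  | succ j ih =>
    intro c hc
    rw [hsum c]
    refine sum_mem fun i _ => mul_mem (hA _ (hu i)) (ih _ ?_)
    have := mul_mem_cwt (hv i) hc
    rwa [show -n + ((j : ℤ) + 1) * n = j * n by ring] at this
  | pred j ih =>
    intro c hc
    rw [hsum' c]
    refine sum_mem fun i _ => mul_mem (hA' _ (hu' i)) (ih _ ?_)
    have := mul_mem_cwt (hv' i) hc
    rwa [show n + (-(j : ℤ) - 1) * n = -j * n by ring] at this

theorem root_mul_pow {m n : ℕ} (hm : 0 < m) : root (m * n) ^ m = root n := by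
  rw [root, root, ← Circle.exp_nsmul, nsmul_eq_mul]
  congr 1
  have : (m : ℝ) ≠ 0 := by positivity
  push_cast
  rw [mul_div_assoc', mul_div_mul_left _ _ this]

/-- The generator of the cyclic action is a single element of the weighted circle, since `k/(dkl) =
1/(dl)` and `l/(dkl) = 1/(dk)`. -/
theorem cyclicAction_eq {d : ℕ} (hk : 0 < k) (hl : 0 < l) :
    cyclicAction q k l d = circleC q k l (root (d * k * l)) := by
  have h0 : root (d * k * l) ^ k = root (d * l) := by
    rw [show d * k * l = k * (d * l) by ring, root_mul_pow hk]
  have h1 : root (d * k * l) ^ l = root (d * k) := by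
    rw [show d * k * l = l * (d * k) by ring, root_mul_pow hl]
  rw [cyclicAction, circleC, circleAction, h0, h1]

theorem isClosed_lensAlg (d : ℕ) : IsClosed (lensAlg q k l d : Set (CSphere q)) :=
  isClosed_eq (continuous_starHom (cyclicAction q k l d)) continuous_id

theorem cwt_le_lensAlg {d : ℕ} (hd : 0 < d) (hk : 0 < k) (hl : 0 < l) {c : CSphere q} 
    (hc : c ∈ cwt q k l ((d : ℤ) * -(k * l))) : c ∈ lensAlg q k l d := by
  change cyclicAction q k l d c = c
  rw [cyclicAction_eq hk hl, circleC_of_mem_cwt hc,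
    (root_zpow_eq_one_iff (by positivity) _).2 ⟨-1, by push_cast; ring⟩, Circle.coe_one, one_smul]

/-- The normalised average over the `N`-th roots of unity is continuous, fixes `c`, and sends
algebraic elements approximating `c` to combinations of monomials of weight divisible by `N`. -/
theorem mem_closure_of_mem_lensAlg (hq : q ≠ 0) {d : ℕ} (hd : 0 < d) (hk : 0 < k) (hl : 0 < l)
    {c : CSphere q} (hc : c ∈ lensAlg q k l d) : c ∈ closure (ofSphere q ''
      (Submodule.span ℂ (monom q '' {p | ((d * k * l : ℕ) : ℤ) ∣ k * p.2.1 + l * p.2.2}) :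
        Set (SphereAlg q))) := by
  set N := d * k * l with hN
  have hN0 : 0 < N := by positivity
  have hN0' : (N : ℂ) ≠ 0 := by exact_mod_cast hN0.ne'
  have h1 : circleC q k l (root N) c = c := by
    rw [← cyclicAction_eq hk hl]; exact hc
  -- Multiplicativity in `w` is needed to pass from invariance under the generator to invariance
  -- under all its powers.
  have hpow : ∀ (v w : Circle) (x : CSphere q),
      circleC q k l (v * w) x = circleC q k l v (circleC q k l w x) := fun v w x => by
    refine Enveloping.induction_on (p := fun x => circleC q k l (v * w) x =
      circleC q k l v (circleC q k l w x)) x (isClosed_eq (continuous_starHom _)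
      ((continuous_starHom _).comp (continuous_starHom _))) fun a => ?_
    change circleC q k l (v * w) (ofSphere q a) =
      circleC q k l v (circleC q k l w (ofSphere q a))
    rw [circleC_of, circleC_of, circleC_of]
    congr 1
    have := (span_monom hq).symm ▸ Submodule.mem_top (x := a)
    induction this using Submodule.span_induction with
    | mem y hy =>
      obtain ⟨p, rfl⟩ := hy
      rw [circleAction_monom, circleAction_monom, map_smul, circleAction_monom, smul_smul, mul_zpow,
        Circle.coe_mul, mul_comm]
    | zero => simp only [map_zero]
    | add x y _ _ hx hy => simp only [map_add, hx, hy]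
    | smul c x _ hx => simp only [map_smul, hx]
  have h2 : ∀ j : ℕ, circleC q k l (root N ^ j) c = c := fun j => by
    induction j with
    | zero => rw [pow_zero, circleC_one]
    | succ j ih => rw [pow_succ, hpow, h1, ih]
  let A : CSphere q → CSphere q := fun x =>
    (N : ℂ)⁻¹ • ∑ j ∈ Finset.range N, circleC q k l (root N ^ j) x
  have hA : A c = c := by
    simp only [A, h2, Finset.sum_const, Finset.card_range]
    rw [← Nat.cast_smul_eq_nsmul ℂ, smul_smul, inv_mul_cancel₀ hN0', one_smul]
  have hAc : Continuous A :=
    (continuous_finsetSum (Finset.range N) fun j _ =>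
      continuous_starHom (circleC q k l (root N ^ j))).const_smul (N : ℂ)⁻¹
  rw [← hA]
  refine map_mem_closure hAc (Enveloping.denseRange_of c) ?_
  rintro _ ⟨a, rfl⟩
  refine ⟨(N : ℂ)⁻¹ • ∑ j ∈ Finset.range N, circleLin q k l (root N ^ j) a,
    Submodule.smul_mem _ _ (average_mem_span (T := circleLin q k l) (m := monom q)
      (n := fun p => k * p.2.1 + l * p.2.2) (fun w p => circleAction_monom w p) hN0
      ((span_monom hq).symm ▸ Submodule.mem_top)), ?_⟩
  rw [map_smul, map_sum]
  refine congrArg _ (Finset.sum_congr rfl fun j _ => ?_)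
  exact (circleC_of _ _).symm


/-- The weights in the lens space are the multiples of `dkl`, that is, of the weight of `F`, and
elements of such weights are products of elements of `F` and their adjoints, up to finite sums. -/
theorem lensAlg_eq_genAlg (hq : q ≠ 0) {d : ℕ} (hd : 0 < d) (hk : 0 < k) (hl : 0 < l)
    {F : Corr (projC q k l)} (e : Realization F ((d : ℤ) * -(k * l)))
    (hn : IsFullWeight q k l ((d : ℤ) * -(k * l)))
    (hn' : IsFullWeight q k l (-((d : ℤ) * -(k * l)))) :
    genAlg e.toLin = (lensAlg q k l d).toNonUnitalStarSubalgebra := by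
  refine le_antisymm (genAlg_le _ (isClosed_lensAlg d)
    fun ξ => cwt_le_lensAlg hd hk hl (e.mem_cwt ξ)) fun c hc => ?_
  refine closure_minimal ?_ (isClosed_genAlg e.toLin) (mem_closure_of_mem_lensAlg hq hd hk hl hc)
  rintro _ ⟨a, ha, rfl⟩
  change ofSphere q a ∈ genAlg e.toLin
  induction ha using Submodule.span_induction with
  | mem a ha =>
    obtain ⟨p, ⟨j, hj⟩, rfl⟩ := ha
    -- The sign in `-j` compensates for the negative weight `-dkl` of `F`.
    refine mem_of_weight hn hn' (fun c hc => ?_) (-j) _ (of_mem_cwt ?_)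
    · obtain ⟨ξ, rfl⟩ := e.exists_eq hc
      exact mem_genAlg _ ξ
    · have := (hasPhase_monom (q := q) p).hasWeight k l
      rwa [hj, show ((d * k * l : ℕ) : ℤ) * j = -j * ((d : ℤ) * -(k * l)) by push_cast; ring] at this
  | zero => rw [map_zero]; exact zero_mem _
  | add x y _ _ hx hy => rw [map_add]; exact add_mem hx hy
  | smul c x _ hx => rw [map_smul]; exact SMulMemClass.smul_mem c hx

theorem Realization.exists_equiv (hq : q ≠ 0) {d : ℕ} (hd : 0 < d) (hk : 0 < k) (hl : 0 < l)
    {F : Corr (projC q k l)} (e : Realization F ((d : ℤ) * -(k * l))) (h : F.IsPimsnerPair)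
    (hn : IsFullWeight q k l ((d : ℤ) * -(k * l)))
    (hn' : IsFullWeight q k l (-((d : ℤ) * -(k * l)))) :
    ∃ Φ : PimsnerAlg F h ≃⋆ₐ[ℂ] lensAlg q k l d, ∀ ξ, (Φ (pimsnerS F h ξ) : CSphere q) = e.toLin ξ := by
  have hn0 : (d : ℤ) * -(k * l) ≠ 0 := by
    have h1 : (d : ℤ) ≠ 0 := by exact_mod_cast hd.ne'
    have h2 : (k : ℤ) ≠ 0 := by exact_mod_cast hk.ne'
    have h3 : (l : ℤ) ≠ 0 := by exact_mod_cast hl.ne'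
    exact mul_ne_zero h1 (neg_ne_zero.2 (mul_ne_zero h2 h3))
  -- Generalising the target lets the equality of subalgebras be substituted instead of transporting
  -- the isomorphism along it.
  have key : ∀ L : NonUnitalStarSubalgebra ℂ (CSphere q), genAlg e.toLin = L →
      ∃ Φ : PimsnerAlg F h ≃⋆ₐ[ℂ] L, ∀ ξ, (Φ (pimsnerS F h ξ) : CSphere q) = e.toLin ξ := by
    rintro _ rfl
    exact exists_equiv_of_pairs (e.fst_eq_zero_iff h hn hn' hq hn0)
  exact key _ (lensAlg_eq_genAlg hq hd hk hl e hn hn')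

end QuantumLens

end

/-! ### The theorem -/

theorem theoremt (q : ℝ) (hq0 : 0 < q) (hq1 : q < 1) (k l : ℕ) (hk : 0 < k) (hl : 0 < l)
    (hkl : k.Coprime l) (d : ℕ) (hd : 0 < d) :
    IsEnveloping.{u} (projOf q k l) ∧
    ∃ h : (tensorPow (lineCorr q hq0 k l) d).IsPimsnerPair,
    ∃ Φ : PimsnerAlg (tensorPow (lineCorr q hq0 k l) d) h ≃⋆ₐ[ℂ] lensAlg q k l d,
      ∀ ξ : Fin d → LineSpace q k l,
        (Φ (pimsnerS (tensorPow (lineCorr q hq0 k l) d) h (tprod (lineCorr q hq0 k l) d ξ)) :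
            CSphere q) =
          (List.ofFn fun i => (ξ i : CSphere q)).prod := by
  have hq : q ≠ 0 := hq0.ne'
  have hm : IsFullWeight q k l (-(k * l)) := isFullWeight_of_dvd hq (dvd_neg.2 dvd_rfl)
  have hn : IsFullWeight q k l ((d : ℤ) * -(k * l)) :=
    isFullWeight_of_dvd hq (Dvd.intro_left (-(d : ℤ)) (by ring))
  have hn' : IsFullWeight q k l (-((d : ℤ) * -(k * l))) :=
    isFullWeight_of_dvd hq (Dvd.intro_left (d : ℤ) (by ring))
  let e := (Realization.line (q := q) (k := k) (l := l) hq0).pow hm d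
  have h := e.isPimsnerPair hq hn hn'
  obtain ⟨Φ, hΦ⟩ := e.exists_equiv hq hd hk hl h hn hn'
  exact ⟨isEnveloping_projOf hq0 hq1 hl, h, Φ, fun ξ =>
    (hΦ _).trans (Realization.pow_tprod (Realization.line hq0) hm d ξ)⟩
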